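/- Let $n\ge 2$ and let $(M,\alpha)$ be a $(2n-1)$-dimensional contact manifold ($M$ Hausdorff, second countable, without boundary; everything is $C^\infty$). Let $F\subset M$ be a maximally foliated submanifold, i.e. an embedded $n$-dimensional submanifold, possibly with boundary, such that $(\alpha\wedge d\alpha)|_{TF}=0$, so that $\ker\alpha|_{TF}$ is a possibly singular foliation. Let $S\subset F$ be a nonempty elliptic singular set, i.e. a compact submanifold without boundary, of codimension $2$ in $F$, for which there are an open neighborhood of $S$ in $F$ and a diffeomorphism from $\mathbb D^2\times S$ (where $\mathbb D^2\subset\mathbb R^2$ is an open disk about $0$ with coordinates $(x,y)$) onto this neighborhood, which maps $(0,s)$ to $s$ and in which $\alpha|_{TF}=g\,(x\,dy-y\,dx)$ for some smooth nowhere vanishing function $g$. (A connected component of an elliptic singular set is again an elliptic singular set.) Then there are an open neighborhood $U$ of $S$ in $M$, an open neighborhood $V$ of $\{0\}\times S$ in $$\Bigl(\mathbb D^3\times T^*S,\ \alpha_0 = dz+\tfrac12(x\,dy-y\,dx)+\lambda_{\mathrm{can}}\Bigr),\qquad \lambda_{\mathrm{can}}=-\mathbf p\cdot d\mathbf q,$$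 where $\mathbb D^3$ is the open unit ball with coordinates $(x,y,z)$ and $S$ is identified with the zero section $\sigma_0(S)\subset T^*S$, and a contactomorphism $\Phi\colon U\to V$, i.e. a diffeomorphism with $\alpha|_U=h\,\Phi^*\alpha_0$ for some smooth function $h>0$, such that $\Phi(s)=(0,\sigma_0(s))$ for all $s\in S$ and $$\Phi(F\cap U)\subset\{(x,y,0;\sigma_0(s))\}.$$ If moreover a diffeomorphism as in the definition of an elliptic singular set exists with $g\equiv 1$, i.e. $\alpha|_{TF}=x\,dy-y\,dx$, then $\Phi$ can be chosen to be strict, i.e. with $h\equiv 1$. -/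

import Mathlib

open Set
open scoped Manifold ContDiff

noncomputable section

namespace ContactGeometry

section Forms

variable {E : Type*} [NormedAddCommGroup E] [NormedSpace ℝ E]
  {H : Type*} [TopologicalSpace H]

/-- The total space of the cotangent bundle of `X`, with Mathlib's bundle topology and smooth
structure. A point is a pair `⟨x, p⟩` with `p` a continuous linear form on the tangent space
at `x`. -/
abbrev CotangentBundle (I : ModelWithCorners ℝ E H) (X : Type*) [TopologicalSpace X]
    [ChartedSpace H X] [IsManifold I ∞ X] : Type _ :=
  Bundle.TotalSpace (E →L[ℝ] ℝ) (fun x : X => TangentSpace I x →L[ℝ] ℝ)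

/-- A `1`-form on `X`, without any regularity. -/
abbrev OneForm (I : ModelWithCorners ℝ E H) (X : Type*) [TopologicalSpace X]
    [ChartedSpace H X] : Type _ :=
  ∀ x : X, TangentSpace I x →L[ℝ] ℝ

/-- A `1`-form is smooth if it is smooth as a section of the cotangent bundle. -/
def OneForm.IsSmooth {I : ModelWithCorners ℝ E H} {X : Type*} [TopologicalSpace X]
    [ChartedSpace H X] [IsManifold I ∞ X] (α : OneForm I X) : Prop :=
  ContMDiff I (I.prod 𝓘(ℝ, E →L[ℝ] ℝ)) ∞
    (fun x : X => (⟨x, α x⟩ : CotangentBundle I X))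

/-- The `1`-form `α` written in the preferred chart at `x₀`: the pullback of `α` under the
inverse of that chart, a `1`-form on the model vector space. -/
def OneForm.inChart {I : ModelWithCorners ℝ E H} {X : Type*} [TopologicalSpace X]
    [ChartedSpace H X] (α : OneForm I X) (x₀ : X) (y : E) : E →L[ℝ] ℝ :=
  (α ((extChartAt I x₀).symm y)).comp (mfderiv 𝓘(ℝ, E) I (extChartAt I x₀).symm y)

/-- The exterior derivative of a smooth `1`-form `α` on a manifold without boundary, as a function
of two tangent vectors at `x₀`. In a chart it is `dα (v, w) = (D_v α) w - (D_w α) v`. -/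
def OneForm.extDeriv {I : ModelWithCorners ℝ E H} {X : Type*} [TopologicalSpace X]
    [ChartedSpace H X] (α : OneForm I X) (x₀ : X) (v w : TangentSpace I x₀) : ℝ :=
  let φ := extChartAt I x₀
  let v' : E := mfderiv I 𝓘(ℝ, E) φ x₀ v
  let w' : E := mfderiv I 𝓘(ℝ, E) φ x₀ w
  fderiv ℝ (α.inChart x₀) (φ x₀) v' w' - fderiv ℝ (α.inChart x₀) (φ x₀) w' v'

/-- A contact form on an odd-dimensional manifold: a smooth `1`-form `α` which vanishes nowhere and
whose exterior derivative is nondegenerate on the hyperplane `ker α` at every point. -/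
structure IsContactForm {I : ModelWithCorners ℝ E H} {X : Type*} [TopologicalSpace X]
    [ChartedSpace H X] [IsManifold I ∞ X] (α : OneForm I X) : Prop where
  odd_finrank : Odd (Module.finrank ℝ E)
  smooth : α.IsSmooth
  ne_zero : ∀ x, α x ≠ 0
  nondegenerate : ∀ (x : X) (v : TangentSpace I x), α x v = 0 →
    (∀ w : TangentSpace I x, α x w = 0 → α.extDeriv x v w = 0) → v = 0

end Forms

section MaximallyFoliated

variable {k : ℕ}
  {M : Type*} [TopologicalSpace M] [ChartedSpace (EuclideanSpace ℝ (Fin (2 * k + 3))) M]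
  {HF : Type*} [TopologicalSpace HF]
  {F : Type*} [TopologicalSpace F] [ChartedSpace HF F]
  {S : Type*} [TopologicalSpace S] [ChartedSpace (EuclideanSpace ℝ (Fin k)) S]

/-- With `n = k + 2`, the `n`-dimensional manifold `F` (possibly with boundary), embedded by `ι`, is
a maximally foliated submanifold of the `(2n - 1)`-dimensional manifold `M` with `1`-form `α`: the
kernel of the restriction of `α` to `F` is a (singular) foliation, that is, the `3`-form `α ∧ dα`
restricts to zero on `F`. -/
structure IsMaximallyFoliated (IF : ModelWithCorners ℝ (EuclideanSpace ℝ (Fin (k + 2))) HF)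
    (α : OneForm (𝓡 (2 * k + 3)) M) (ι : F → M) : Prop where
  embedding : Manifold.IsSmoothEmbedding IF (𝓡 (2 * k + 3)) ∞ ι
  frobenius : ∀ (q : F) (u v w : TangentSpace IF q),
    let D := mfderiv IF (𝓡 (2 * k + 3)) ι q
    α (ι q) (D u) * α.extDeriv (ι q) (D v) (D w)
      + α (ι q) (D v) * α.extDeriv (ι q) (D w) (D u)
      + α (ι q) (D w) * α.extDeriv (ι q) (D u) (D v) = 0

/-- `ψ` is a diffeomorphism from `D × S`, with `D` the open disk of radius `r` about `0` in the
plane, onto an open neighborhood of `j(S)` in `F`, with `ψ (0, s) = j s`, in which the restriction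
of `α` to `F` equals `g (x dy - y dx)` for a smooth function `g` without zeros. -/
structure IsEllipticChart (IF : ModelWithCorners ℝ (EuclideanSpace ℝ (Fin (k + 2))) HF)
    (α : OneForm (𝓡 (2 * k + 3)) M) (ι : F → M) (j : S → F) (r : ℝ)
    (ψ : OpenPartialHomeomorph (EuclideanSpace ℝ (Fin 2) × S) F)
    (g : EuclideanSpace ℝ (Fin 2) × S → ℝ) : Prop where
  radius_pos : 0 < r
  source_eq : ψ.source = Metric.ball 0 r ×ˢ univ
  smooth : ContMDiffOn ((𝓡 2).prod (𝓡 k)) IF ∞ ψ ψ.source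
  smooth_symm : ContMDiffOn IF ((𝓡 2).prod (𝓡 k)) ∞ ψ.symm ψ.target
  apply_zero : ∀ s : S, ψ (0, s) = j s
  smooth_factor : ContMDiffOn ((𝓡 2).prod (𝓡 k)) 𝓘(ℝ, ℝ) ∞ g ψ.source
  factor_ne_zero : ∀ a ∈ ψ.source, g a ≠ 0
  form_eq : ∀ a ∈ ψ.source, ∀ (v : EuclideanSpace ℝ (Fin 2)) (τ : TangentSpace (𝓡 k) a.2),
    α (ι (ψ a)) (mfderiv IF (𝓡 (2 * k + 3)) ι (ψ a)
        (mfderiv ((𝓡 2).prod (𝓡 k)) IF ψ a (v, τ)))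
      = g a * (a.1 0 * v 1 - a.1 1 * v 0)

/-- The compact manifold `S` without boundary, embedded by `j` in codimension `2`, is an elliptic
singular set of `F`: near it the foliation of `F` is represented by `x dy - y dx`. -/
def IsEllipticSingularSet (IF : ModelWithCorners ℝ (EuclideanSpace ℝ (Fin (k + 2))) HF)
    (α : OneForm (𝓡 (2 * k + 3)) M) (ι : F → M) (j : S → F) : Prop :=
  CompactSpace S ∧ Manifold.IsSmoothEmbedding (𝓡 k) IF ∞ j ∧
    ∃ r ψ g, IsEllipticChart IF α ι j r ψ g

/-- `S` is an elliptic singular set of `F`, and `x dy - y dx` even equals the restriction of the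
form `α` itself. -/
def IsStrictEllipticSingularSet (IF : ModelWithCorners ℝ (EuclideanSpace ℝ (Fin (k + 2))) HF)
    (α : OneForm (𝓡 (2 * k + 3)) M) (ι : F → M) (j : S → F) : Prop :=
  CompactSpace S ∧ Manifold.IsSmoothEmbedding (𝓡 k) IF ∞ j ∧
    ∃ r ψ, IsEllipticChart IF α ι j r ψ (fun _ => 1)

end MaximallyFoliated

section Model

variable {k : ℕ} (S : Type*) [TopologicalSpace S] [ChartedSpace (EuclideanSpace ℝ (Fin k)) S]
  [IsManifold (𝓡 k) ∞ S]

/-- The canonical `1`-form `-p dq` on the cotangent bundle of `S`: at the covector `ξ = ⟨s, p⟩` it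
maps a tangent vector `V` to `-p (dπ V)`, where `π` is the bundle projection. -/
def canonicalForm :
    OneForm ((𝓡 k).prod 𝓘(ℝ, EuclideanSpace ℝ (Fin k) →L[ℝ] ℝ)) (CotangentBundle (𝓡 k) S) :=
  fun ξ => -(ξ.2.comp
    (mfderiv ((𝓡 k).prod 𝓘(ℝ, EuclideanSpace ℝ (Fin k) →L[ℝ] ℝ)) (𝓡 k)
      (fun η : CotangentBundle (𝓡 k) S => η.1) ξ))

/-- The model space: the product of Euclidean `3`-space, with coordinates `(x, y, z)`, and the
cotangent bundle of `S`. -/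
abbrev Model : Type _ := EuclideanSpace ℝ (Fin 3) × CotangentBundle (𝓡 k) S

/-- The model with corners of `Model`. -/
abbrev modelI (k : ℕ) :=
  (𝓡 3).prod ((𝓡 k).prod 𝓘(ℝ, EuclideanSpace ℝ (Fin k) →L[ℝ] ℝ))

/-- The contact form `dz + (x dy - y dx) / 2 + λ_can` on the model space. -/
def modelForm : OneForm (modelI k) (Model (k := k) S) :=
  fun a =>
    let dx (i : Fin 3) : EuclideanSpace ℝ (Fin 3) →L[ℝ] ℝ := EuclideanSpace.proj i
    ContinuousLinearMap.coprod
      (dx 2 + (1 / 2 : ℝ) • (a.1 0 • dx 1 - a.1 1 • dx 0))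
      (canonicalForm (k := k) S a.2)

end Model

section StandardNeighborhood

variable {k : ℕ}
  {M : Type*} [TopologicalSpace M] [ChartedSpace (EuclideanSpace ℝ (Fin (2 * k + 3))) M]
  {F : Type*}
  {S : Type*} [TopologicalSpace S] [ChartedSpace (EuclideanSpace ℝ (Fin k)) S]
  [IsManifold (𝓡 k) ∞ S]

/-- `Φ` is a diffeomorphism from an open neighborhood `U` of `S` in `M` onto an open neighborhood
of `{0} × S` (`S` being the zero section) in the product of the open unit `3`-ball and the
cotangent bundle of `S`. It maps every point of `S` to the corresponding point of `{0} × S`,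
satisfies `α = h Φ^*(dz + (x dy - y dx) / 2 + λ_can)` on `U` for a smooth function `h > 0`
(so that it is a contactomorphism), and maps the part of `F` in `U` into the set of points
`(x, y, 0; σ₀ s)`, with `σ₀` the zero section. -/
structure IsStandardNeighborhood (α : OneForm (𝓡 (2 * k + 3)) M) (ι : F → M) (j : S → F)
    (Φ : OpenPartialHomeomorph M (Model (k := k) S)) (h : M → ℝ) : Prop where
  mem_source : ∀ s : S, ι (j s) ∈ Φ.source
  target_subset : Φ.target ⊆ Metric.ball 0 1 ×ˢ univ
  smooth : ContMDiffOn (𝓡 (2 * k + 3)) (modelI k) ∞ Φ Φ.source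
  smooth_symm : ContMDiffOn (modelI k) (𝓡 (2 * k + 3)) ∞ Φ.symm Φ.target
  apply_singular : ∀ s : S, Φ (ι (j s)) = (0, ⟨s, 0⟩)
  smooth_factor : ContMDiffOn (𝓡 (2 * k + 3)) 𝓘(ℝ, ℝ) ∞ h Φ.source
  factor_pos : ∀ p ∈ Φ.source, 0 < h p
  form_eq : ∀ p ∈ Φ.source, ∀ v : TangentSpace (𝓡 (2 * k + 3)) p,
    α p v = h p * modelForm (k := k) S (Φ p) (mfderiv (𝓡 (2 * k + 3)) (modelI k) Φ p v)
  foliated_subset : ∀ q : F, ι q ∈ Φ.source → (Φ (ι q)).1 2 = 0 ∧ (Φ (ι q)).2.2 = 0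

end StandardNeighborhood

end ContactGeometry

end

-- Near `S` the contact form is first multiplied by a positive function and the disk factor is
-- reparametrised. This gives an immersion `f` of a neighborhood of `0 × S` in `ℝ² × S` into `M`
-- that pulls the form back to `(x dy - y dx) / 2` (`IsEllipticChart.isEllipticDisk`). The model
-- form `α₀` has the same restriction to the plane times the zero section. It remains to extend `f`
-- to a strict contact embedding of a neighborhood of the zero section in `ℝ³ × T*S`.
--
-- Transversal extension. A covector `p` is sent in a direction `W p` in the kernel of `α` with `dα
-- (W p, f_* τ) = -p τ` for `τ` tangent to `S`. Such directions exist because `dα` is nondegenerate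
-- on this kernel and the vectors `f_* τ` are independent of the Reeb vector. The resulting map `G`
-- satisfies `G^*α = α₀ - dz` along the plane times the zero section and has the pairings of `dα₀`
-- with vectors tangent to `S` (`IsEllipticDisk.exists_isAdapted_one`). The hypersurface `z = 0` is
-- then carried along by the Reeb flow for time `z`. This flow preserves `α`, and `α` is `1` on its
-- generator, so the pullback of `α` is `α₀ + β` with `β` independent of `z` and without a `dz`
-- component; `β` vanishes on the plane times the zero section, and along `S` also `dβ (·, τ) = 0`
-- (`IsAdapted.reebExtension_isFlatPerturbation`).
--
-- Moser's argument. These conditions on `β` make all the forms `α₀ + t β` contact along `S`, with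
-- the common Reeb field `∂/∂z`. The field `X` in the kernel of `α₀ + t β` with `d(α₀ + t β) (X, ·)
-- = -β` therefore exists, and its flow removes `β` without any conformal factor. It vanishes where
-- `β` does, so the values on the plane times the zero section remain those of `f`
-- (`IsFlatPerturbation.exists_isCorrection`).
--
-- Both constructions are carried out in charts of `S`. To glue them, the statements are formulated
-- for a function `σ` on `S` that measures how much has been achieved, and `patching_induction`
-- passes from `0` to `1` along a partition of unity. The final map pulls `α` back to the contact
-- form `α₀`, hence is a local diffeomorphism; it is injective on the compact set `S`, so its
-- inverse near `S` is the required `Φ` (`exists_diffeomorph_near_compact`). The only conformal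
-- factor is the one from the beginning, and it is `1` if `g = 1`.
--
-- The smooth dependence of flows on initial values, needed for the Reeb flow and for Moser's
-- argument, comes from the inverse function theorem in a Banach space of curves
-- (`exists_contDiff_flow`).

universe u

noncomputable section

namespace ContactGeometry

/-! ### Smoothness of composition operators on spaces of curves. -/

section Nemytskii

open Topology Filter

/-- Pointwise evaluation of a continuous family of operators on a continuous family of vectors. -/
def pointwiseApply (K : Type*) [TopologicalSpace K] [CompactSpace K]
    (E F : Type*) [NormedAddCommGroup E] [NormedSpace ℝ E]
    [NormedAddCommGroup F] [NormedSpace ℝ F] :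
    C(K, E →L[ℝ] F) →L[ℝ] C(K, E) →L[ℝ] C(K, F) :=
  LinearMap.mkContinuous₂
    (LinearMap.mk₂ ℝ (fun (A : C(K, E →L[ℝ] F)) (h : C(K, E)) => (⟨fun t => A t (h t), by fun_prop⟩ : C(K, F)))
      (by intros; ext; simp) (by intros; ext; simp) (by intros; ext; simp) (by intros; ext; simp))
    1 (by
      intro A h
      rw [ContinuousMap.norm_le _ (by positivity)]
      intro t
      calc ‖A t (h t)‖ ≤ ‖A t‖ * ‖h t‖ := (A t).le_opNorm _
        _ ≤ 1 * ‖A‖ * ‖h‖ := by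
          rw [one_mul]
          gcongr
          · exact A.norm_coe_le_norm t
          · exact h.norm_coe_le_norm t)

variable {K : Type*} [TopologicalSpace K] [CompactSpace K]

@[simp] theorem pointwiseApply_apply {E F : Type*} [NormedAddCommGroup E] [NormedSpace ℝ E]
    [NormedAddCommGroup F] [NormedSpace ℝ F] (A : C(K, E →L[ℝ] F)) (h : C(K, E)) (t : K) :
    pointwiseApply K E F A h t = A t (h t) := rfl

/-- Postcomposition with `V'` is continuous for the uniform norm, so `V'` is nearly constant on a
ball about `γ t` whose radius does not depend on `t`. The mean value inequality on these balls gives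
a uniform estimate. -/
theorem hasFDerivAt_postcomp {E F : Type*} [NormedAddCommGroup E] [NormedSpace ℝ E]
    [NormedAddCommGroup F] [NormedSpace ℝ F] (V : C(E, F)) (V' : C(E, E →L[ℝ] F))
    (hV : ∀ x, HasFDerivAt V (V' x) x) (γ : C(K, E)) :
    HasFDerivAt (fun γ : C(K, E) => V.comp γ) (pointwiseApply K E F (V'.comp γ)) γ := by
  rw [hasFDerivAt_iff_isLittleO_nhds_zero, Asymptotics.isLittleO_iff]
  intro ε hε
  have hcont : Continuous (fun γ : C(K, E) => V'.comp γ) := V'.continuous_postcomp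
  obtain ⟨δ, hδ, hball⟩ : ∃ δ > 0, ∀ γ' : C(K, E), dist γ' γ < δ →
      dist (V'.comp γ') (V'.comp γ) < ε := by
    simpa using Metric.tendsto_nhds_nhds.1 (hcont.tendsto γ) ε hε
  filter_upwards [Metric.ball_mem_nhds (0 : C(K, E)) hδ] with h hh
  rw [ContinuousMap.norm_le _ (by positivity)]
  intro t
  have hbound : ∀ x ∈ Metric.ball (γ t) δ, ‖V' x - V' (γ t)‖ ≤ ε := by
    intro x hx
    -- A translate of `γ` through `x` at the parameter `t` turns closeness of curves into closeness
    -- of `V' x` and `V' (γ t)`.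
    have h1 : dist (γ + ContinuousMap.const K (x - γ t)) γ < δ := by
      rw [dist_eq_norm, add_sub_cancel_left, ContinuousMap.norm_lt_iff _ hδ]
      intro y
      simpa [dist_eq_norm] using hx
    have h2 := (ContinuousMap.dist_lt_iff hε).1 (hball _ h1) t
    rw [dist_eq_norm] at h2
    simpa using h2.le
  have hmem : γ t + h t ∈ Metric.ball (γ t) δ := by
    rw [mem_ball_iff_norm, add_sub_cancel_left]
    exact lt_of_le_of_lt (h.norm_coe_le_norm t) (by simpa using hh)
  have := (convex_ball (γ t) δ).norm_image_sub_le_of_norm_hasFDerivWithin_le'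
    (fun x _ => (hV x).hasFDerivWithinAt) hbound (Metric.mem_ball_self hδ) hmem
  calc ‖V (γ t + h t) - V (γ t) - V' (γ t) (h t)‖
      = ‖V (γ t + h t) - V (γ t) - V' (γ t) (γ t + h t - γ t)‖ := by rw [add_sub_cancel_left]
    _ ≤ ε * ‖γ t + h t - γ t‖ := this
    _ ≤ ε * ‖h‖ := by
      rw [add_sub_cancel_left]
      gcongr
      exact h.norm_coe_le_norm t

/-- The derivative is postcomposition with `V'` followed by a continuous linear map, so the order
can be raised by induction. The induction replaces `F` by `E →L[ℝ] F`, which is why both spaces live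
in one universe. -/
theorem contDiff_postcomp {E : Type u} [NormedAddCommGroup E] [NormedSpace ℝ E] (n : ℕ) :
    ∀ {F : Type u} [NormedAddCommGroup F] [NormedSpace ℝ F] (V : C(E, F)),
      ContDiff ℝ ∞ V → ContDiff ℝ n (fun γ : C(K, E) => V.comp γ) := by
  induction n with
  | zero =>
    intro F _ _ V _
    exact contDiff_zero.2 V.continuous_postcomp
  | succ n ih =>
    intro F _ _ V hV
    let V' : C(E, E →L[ℝ] F) := ⟨fderiv ℝ V, hV.continuous_fderiv (by simp)⟩
    have hd : ∀ γ : C(K, E), HasFDerivAt (fun γ : C(K, E) => V.comp γ)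
        (pointwiseApply K E F (V'.comp γ)) γ :=
      hasFDerivAt_postcomp V V' fun x => (hV.differentiable (by simp) x).hasFDerivAt
    have hV' : ContDiff ℝ ∞ V' := hV.fderiv_right (by simp)
    refine contDiff_succ_iff_hasFDerivAt.2 ⟨fun γ => pointwiseApply K E F (V'.comp γ), ?_, hd⟩
    exact (pointwiseApply K E F).contDiff.comp (ih V' hV')

/-- The constant curve, as a continuous linear function of its value. -/
def constCurve (K : Type*) [TopologicalSpace K] [CompactSpace K] (E : Type*)
    [NormedAddCommGroup E] [NormedSpace ℝ E] : E →L[ℝ] C(K, E) :=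
  LinearMap.mkContinuous 
    ⟨⟨fun x => ContinuousMap.const K x, fun _ _ => by ext; rfl⟩, fun _ _ => by ext; rfl⟩ 1
    (by
      intro x
      rw [one_mul, ContinuousMap.norm_le _ (norm_nonneg _)]
      intro t
      exact le_rfl)

@[simp] theorem constCurve_apply {E : Type*} [NormedAddCommGroup E] [NormedSpace ℝ E] (x : E)
    (t : K) : constCurve K E x t = x := rfl

/-- The primitive vanishing at `0`, as a continuous linear operator on curves. -/
def primitiveCurve (E : Type*) [NormedAddCommGroup E] [NormedSpace ℝ E] [CompleteSpace E] :
    C(Icc (0 : ℝ) 1, E) →L[ℝ] C(Icc (0 : ℝ) 1, E) :=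
  LinearMap.mkContinuous
    ⟨⟨fun γ => ⟨fun t => ∫ s in (0 : ℝ)..t, γ (projIcc 0 1 zero_le_one s),
        (intervalIntegral.continuous_primitive (fun a b =>
          (γ.continuous.comp continuous_projIcc).intervalIntegrable a b) 0).comp
            continuous_subtype_val⟩,
      fun γ γ' => by
        ext t
        exact intervalIntegral.integral_add
          ((γ.continuous.comp continuous_projIcc).intervalIntegrable _ _)
          ((γ'.continuous.comp continuous_projIcc).intervalIntegrable _ _)⟩,
      fun c γ => by
        ext t
        exact intervalIntegral.integral_smul c _⟩ 1
    (by
      intro γ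
      rw [one_mul, ContinuousMap.norm_le _ (norm_nonneg _)]
      intro t
      have := intervalIntegral.norm_integral_le_of_norm_le_const (a := (0 : ℝ)) (b := t)
        (f := fun s => γ (projIcc 0 1 zero_le_one s)) (C := ‖γ‖) fun s _ => γ.norm_coe_le_norm _
      refine this.trans ?_
      have h1 : |(t : ℝ) - 0| ≤ 1 := by
        rw [sub_zero, abs_of_nonneg t.2.1]; exact t.2.2
      exact mul_le_of_le_one_right (norm_nonneg _) h1)

theorem primitiveCurve_apply {E : Type*} [NormedAddCommGroup E] [NormedSpace ℝ E]
    [CompleteSpace E] (γ : C(Icc (0 : ℝ) 1, E)) (t : Icc (0 : ℝ) 1) :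
    primitiveCurve E γ t = ∫ s in (0 : ℝ)..t, γ (projIcc 0 1 zero_le_one s) := rfl

end Nemytskii

/-! ### Global smooth flows of bounded Lipschitz vector fields. -/

section GlobalFlow

open Topology Filter NNReal

variable {E : Type u} [NormedAddCommGroup E] [NormedSpace ℝ E] {V : E → E} {K C : ℝ≥0}

theorem integralCurve_unique (hK : LipschitzWith K V) {γ γ' : ℝ → E}
    (hγ : ∀ t, HasDerivAt γ (V (γ t)) t) (hγ' : ∀ t, HasDerivAt γ' (V (γ' t)) t) (t₀ : ℝ)
    (h : γ t₀ = γ' t₀) : γ = γ' :=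
  ODE_solution_unique_univ (v := fun _ => V) (s := fun _ => univ) (t₀ := t₀)
    (fun _ => hK.lipschitzOnWith) (fun t => ⟨hγ t, trivial⟩) (fun t => ⟨hγ' t, trivial⟩) h

theorem exists_integralCurve_Ioo [CompleteSpace E] (hK : LipschitzWith K V) (hC : ∀ x, ‖V x‖ ≤ C)
    (x : E) (T : ℝ≥0) :
    ∃ γ : ℝ → E, γ 0 = x ∧ ∀ t ∈ Ioo (-(T : ℝ)) T, HasDerivAt γ (V (γ t)) t := by
  have h0 : (0 : ℝ) ∈ Icc (-(T : ℝ)) T := by simp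
  have hpl : IsPicardLindelof (fun _ => V) (⟨0, h0⟩ : Icc (-(T : ℝ)) T) x (C * T) 0 C K :=
    { lipschitzOnWith := fun _ _ => hK.lipschitzOnWith
      continuousOn := fun _ _ => continuousOn_const
      norm_le := fun _ _ x _ => hC x
      mul_max_le := by simp }
  obtain ⟨γ, h1, h2⟩ := hpl.exists_eq_forall_mem_Icc_hasDerivWithinAt₀
  exact ⟨γ, h1, fun t ht => (h2 t (Ioo_subset_Icc_self ht)).hasDerivAt (Icc_mem_nhds ht.1 ht.2)⟩

theorem exists_integralCurve [CompleteSpace E] (hK : LipschitzWith K V) (hC : ∀ x, ‖V x‖ ≤ C)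
    (x : E) : ∃ γ : ℝ → E, γ 0 = x ∧ ∀ t, HasDerivAt γ (V (γ t)) t := by
  choose γ h0 h1 using fun n : ℕ => exists_integralCurve_Ioo hK hC x (n + 1 : ℝ≥0)
  have hagree : ∀ m n : ℕ, m ≤ n → EqOn (γ m) (γ n) (Ioo (-((m : ℝ) + 1)) (m + 1)) := by
    intro m n hmn
    have hmn' : (m : ℝ) ≤ n := by exact_mod_cast hmn
    have hsub : Ioo (-((m : ℝ) + 1)) (m + 1) ⊆ Ioo (-((n : ℝ) + 1)) (n + 1) :=
      Ioo_subset_Ioo (by linarith) (by linarith)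
    refine ODE_solution_unique_of_mem_Ioo (v := fun _ => V) (s := fun _ => univ) (t₀ := 0)
      (fun _ _ => hK.lipschitzOnWith) ⟨by linarith [m.cast_nonneg (α := ℝ)], by positivity⟩
      (fun t ht => ⟨h1 m t (by simpa using ht), trivial⟩)
      (fun t ht => ⟨h1 n t (by simpa using hsub ht), trivial⟩) (by rw [h0, h0])
  -- The `n`-th solution lives for times of modulus below `n + 1`, so the one with index `⌈|t|⌉₊` is
  -- defined around `t`. For nearby times it agrees with the solution of the next index.
  refine ⟨fun t => γ ⌈|t|⌉₊ t, by simp [h0], fun t => ?_⟩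
  have hN : ∀ s : ℝ, s ∈ Ioo (-((⌈|s|⌉₊ : ℝ) + 1)) (⌈|s|⌉₊ + 1) := by
    intro s
    have := abs_le.1 (Nat.le_ceil |s|)
    exact ⟨by linarith, by linarith⟩
  let n := ⌈|t|⌉₊ + 1
  have hev : (fun s => γ ⌈|s|⌉₊ s) =ᶠ[𝓝 t] γ n := by
    filter_upwards [Metric.ball_mem_nhds t one_pos] with s hs
    rw [Metric.mem_ball, Real.dist_eq] at hs
    refine hagree _ n ?_ (hN s)
    rw [Nat.ceil_le]
    have h2 := Nat.le_ceil |t|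
    have h3 : |s| ≤ |s - t| + |t| := by simpa using abs_add_le (s - t) t
    push_cast [n]
    linarith
  rw [show (fun t => γ ⌈|t|⌉₊ t) t = γ n t from hev.self_of_nhds]
  refine (h1 n t ?_).congr_of_eventuallyEq hev
  have := hN t
  push_cast [n]
  constructor <;> linarith [this.1, this.2]

/-- A map is a flow of `V` if it solves the differential equation of `V` with every initial
value. -/
structure IsFlowOf (V : E → E) (Φ : ℝ → E → E) : Prop where
  zero : ∀ x, Φ 0 x = x
  hasDerivAt : ∀ t x, HasDerivAt (fun s => Φ s x) (V (Φ t x)) t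

theorem IsFlowOf.add {Φ : ℝ → E → E} (hΦ : IsFlowOf V Φ) (hK : LipschitzWith K V) (s t : ℝ)
    (x : E) : Φ (s + t) x = Φ s (Φ t x) := by
  have h1 : ∀ s, HasDerivAt (fun s => Φ (s + t) x) (V (Φ (s + t) x)) s := fun s =>
    (hΦ.hasDerivAt (s + t) x).comp_add_const s t
  have := integralCurve_unique hK h1 (fun s => hΦ.hasDerivAt s (Φ t x)) 0
    (by simp [hΦ.zero])
  exact congrFun this s

/-- The map whose zeros in the curve variable are the integral curves of `V` over a time interval
of length `c`, reparametrised by the unit interval. -/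
def curveEquation [CompleteSpace E] (V : C(E, E)) (p : (ℝ × E) × C(Icc (0 : ℝ) 1, E)) :
    (ℝ × E) × C(Icc (0 : ℝ) 1, E) :=
  (p.1, p.2 - constCurve _ E p.1.2 - p.1.1 • primitiveCurve E (V.comp p.2))

theorem contDiff_curveEquation [CompleteSpace E] {V : C(E, E)} (hV : ContDiff ℝ ∞ V) (n : ℕ) :
    ContDiff ℝ n (curveEquation V) := by
  have h1 := contDiff_postcomp (K := Icc (0 : ℝ) 1) n V hV
  refine contDiff_fst.prodMk ((contDiff_snd.sub ?_).sub ?_)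
  · exact (constCurve (Icc (0 : ℝ) 1) E).contDiff.comp (contDiff_snd.comp contDiff_fst)
  · exact (contDiff_fst.comp contDiff_fst).smul
      ((primitiveCurve E).contDiff.comp (h1.comp contDiff_snd))

/-- The shear subtracting `x + c • w` from the curve variable. -/
def curveShear [CompleteSpace E] (w : C(Icc (0 : ℝ) 1, E)) :
    ((ℝ × E) × C(Icc (0 : ℝ) 1, E)) ≃L[ℝ] ((ℝ × E) × C(Icc (0 : ℝ) 1, E)) :=
  let S : (ℝ × E) →L[ℝ] C(Icc (0 : ℝ) 1, E) :=
    (constCurve _ E).comp (ContinuousLinearMap.snd ℝ ℝ E) +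
      (ContinuousLinearMap.fst ℝ ℝ E).smulRight w
  ContinuousLinearEquiv.equivOfInverse
    ((ContinuousLinearMap.fst ℝ _ _).prod
      (ContinuousLinearMap.snd ℝ _ _ - S.comp (ContinuousLinearMap.fst ℝ _ _)))
    ((ContinuousLinearMap.fst ℝ _ _).prod
      (ContinuousLinearMap.snd ℝ _ _ + S.comp (ContinuousLinearMap.fst ℝ _ _)))
    (fun p => by ext1 <;> simp) (fun p => by ext1 <;> simp)

/-- For time length `0` the nonlinear term contributes only through the derivative of its factor
`c`. The derivative is thus a shear, which is invertible without any smallness assumption on `V`. -/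
theorem hasFDerivAt_curveEquation [CompleteSpace E] {V : C(E, E)} (hV : ContDiff ℝ ∞ V) (x : E) :
    HasFDerivAt (curveEquation V)
      (curveShear (primitiveCurve E (V.comp (constCurve _ E x))) :
        ((ℝ × E) × C(Icc (0 : ℝ) 1, E)) →L[ℝ] ((ℝ × E) × C(Icc (0 : ℝ) 1, E)))
      ((0, x), constCurve _ E x) := by
  have h1 := (contDiff_postcomp (K := Icc (0 : ℝ) 1) 1 V hV).differentiable (by simp)
    (constCurve _ E x)
  have h2 := (primitiveCurve E).hasFDerivAt.comp _ h1.hasFDerivAt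
  have h3 : HasFDerivAt (fun p : (ℝ × E) × C(Icc (0 : ℝ) 1, E) => p.1.1)
    ((ContinuousLinearMap.fst ℝ _ _).comp (ContinuousLinearMap.fst ℝ _ _))
    ((0, x), constCurve _ E x) := hasFDerivAt_fst.fst
  have h4 := h3.smul (HasFDerivAt.comp ((0, x), constCurve _ E x) h2 hasFDerivAt_snd)
  have h5 := (constCurve (Icc (0 : ℝ) 1) E).hasFDerivAt.comp ((0, x), constCurve _ E x)
    (hasFDerivAt_fst.snd : HasFDerivAt (fun p : (ℝ × E) × C(Icc (0 : ℝ) 1, E) => p.1.2) _ _)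
  have h6 := hasFDerivAt_fst.prodMk ((hasFDerivAt_snd.sub h5).sub h4)
  refine h6.congr_fderiv ?_
  refine ContinuousLinearMap.ext fun p => Prod.ext rfl ?_
  let w := primitiveCurve E (V.comp (constCurve (Icc (0 : ℝ) 1) E x))
  change p.2 - constCurve _ E p.1.2 - ((0 : ℝ) • _ + p.1.1 • w)
    = p.2 - (constCurve _ E p.1.2 + p.1.1 • w)
  rw [zero_smul, zero_add, sub_sub]

/-- The curve `s ↦ Φ (c s) x` on the unit interval. -/
def flowCurve {Φ : ℝ → E → E} (hΦ : IsFlowOf V Φ) (p : ℝ × E) : C(Icc (0 : ℝ) 1, E) :=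
  ⟨fun s => Φ (p.1 * s) p.2, by
    have : Continuous fun s => Φ s p.2 :=
      continuous_iff_continuousAt.2 fun t => (hΦ.hasDerivAt t p.2).continuousAt
    exact this.comp (by fun_prop)⟩

theorem curveEquation_flowCurve [CompleteSpace E] {V : C(E, E)} {Φ : ℝ → E → E}
    (hΦ : IsFlowOf V Φ) (p : ℝ × E) :
    curveEquation V (p, flowCurve hΦ p) = (p, 0) := by
  refine Prod.ext rfl ?_
  ext t
  have hd : ∀ s : ℝ, HasDerivAt (fun s => Φ (p.1 * s) p.2) (p.1 • V (Φ (p.1 * s) p.2)) s := by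
    intro s
    have := (hΦ.hasDerivAt (p.1 * s) p.2).scomp s ((hasDerivAt_id s).const_mul p.1)
    simpa [Function.comp_def] using this
  have hcont : Continuous fun s => p.1 • V (Φ (p.1 * s) p.2) :=
    continuous_const.smul (V.continuous.comp
      (continuous_iff_continuousAt.2 fun t => (hd t).continuousAt))
  have h1 := intervalIntegral.integral_eq_sub_of_hasDerivAt (a := 0) (b := t)
    (fun s _ => hd s) (hcont.intervalIntegrable _ _)
  have h2 : primitiveCurve E (V.comp (flowCurve hΦ p)) t
      = ∫ s in (0 : ℝ)..t, V (Φ (p.1 * s) p.2) := by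
    rw [primitiveCurve_apply]
    refine intervalIntegral.integral_congr fun s hs => ?_
    rw [uIcc_of_le t.2.1] at hs
    have hs' : s ∈ Icc (0 : ℝ) 1 := ⟨hs.1, hs.2.trans t.2.2⟩
    simp only [projIcc_of_mem zero_le_one hs']
    rfl
  change Φ (p.1 * t) p.2 - p.2 - p.1 • primitiveCurve E (V.comp (flowCurve hΦ p)) t = 0
  rw [h2, ← intervalIntegral.integral_smul, h1]
  simp [hΦ.zero]

/-- By the inverse function theorem for `curveEquation`, the curve `flowCurve hΦ p` depends on `p`
as the local inverse at `(p, 0)` does. The flow is recovered by evaluating this curve at its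
endpoint, which is a continuous linear operation. -/
theorem IsFlowOf.contDiffAt_zero [CompleteSpace E] {Φ : ℝ → E → E} (hΦ : IsFlowOf V Φ)
    (hV : ContDiff ℝ ∞ V) (hC : ∀ x, ‖V x‖ ≤ C) (x : E) (n : ℕ) (hn : n ≠ 0) :
    ContDiffAt ℝ n (fun p : ℝ × E => Φ p.1 p.2) (0, x) := by
  let W : C(E, E) := ⟨V, hV.continuous⟩
  have hd := hasFDerivAt_curveEquation (V := W) hV x
  have hs := (contDiff_curveEquation (V := W) hV n).contDiffAt
    (x := ((0, x), constCurve (Icc (0 : ℝ) 1) E x))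
  have hn' : (n : WithTop ℕ∞) ≠ 0 := by exact_mod_cast hn
  have hinv := hs.to_localInverse hd hn'
  have hstrict := hs.hasStrictFDerivAt' hd hn'
  have h0 : flowCurve (V := W) hΦ (0, x) = constCurve _ E x := by
    ext s
    simp [flowCurve, hΦ.zero]
  have hbase : curveEquation W ((0, x), constCurve _ E x) = ((0, x), 0) := by
    rw [← h0, curveEquation_flowCurve]
  have hlip : ∀ t y, ‖Φ t y - y‖ ≤ C * |t| := by
    intro t y
    have := convex_univ.norm_image_sub_le_of_norm_hasDerivWithin_le (f := fun s => Φ s y)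
      (C := C) (fun s _ => (hΦ.hasDerivAt s y).hasDerivWithinAt) (fun s _ => hC _)
      (mem_univ 0) (mem_univ t)
    simpa [hΦ.zero] using this
  -- The local inverse recovers only solutions near the constant curve. The bound on `V` shows that
  -- flow curves over short times are uniformly close to it.
  have hcont : Tendsto (fun p => (p, flowCurve (V := W) hΦ p)) (𝓝 (0, x))
      (𝓝 ((0, x), constCurve _ E x)) := by
    refine tendsto_id.prodMk_nhds ?_
    rw [tendsto_iff_norm_sub_tendsto_zero]
    have hz : Tendsto (fun p : ℝ × E => C * |p.1| + ‖p.2 - x‖) (𝓝 (0, x)) (𝓝 0) := by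
      have : Continuous (fun p : ℝ × E => C * |p.1| + ‖p.2 - x‖) := by fun_prop
      simpa using this.tendsto (0, x)
    refine squeeze_zero (fun _ => norm_nonneg _) (fun p => ?_) hz
    rw [ContinuousMap.norm_le _ (by positivity)]
    intro s
    change ‖Φ (p.1 * s) p.2 - x‖ ≤ _
    calc ‖Φ (p.1 * s) p.2 - x‖ ≤ ‖Φ (p.1 * s) p.2 - p.2‖ + ‖p.2 - x‖ := norm_sub_le_norm_sub_add_norm_sub _ _ _
      _ ≤ C * |p.1| + ‖p.2 - x‖ := by
        gcongr
        refine (hlip _ _).trans ?_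
        rw [abs_mul, abs_of_nonneg s.2.1]
        gcongr
        exact mul_le_of_le_one_right (abs_nonneg _) s.2.2
  have hev := hcont.eventually (hstrict.eventually_left_inverse)
  rw [hbase] at hinv
  have hcomp : ContDiffAt ℝ n (fun p : ℝ × E =>
      (hs.localInverse hd hn' (p, 0)).2 ⟨1, by simp⟩) (0, x) := by
    have h1 : ContDiffAt ℝ n (fun p : ℝ × E => (p, (0 : C(Icc (0 : ℝ) 1, E)))) (0, x) := by
      fun_prop
    have h2 := (contDiffAt_snd).comp (0, x) (ContDiffAt.comp (0, x) hinv h1)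
    exact (ContinuousMap.evalCLM ℝ (⟨1, by simp⟩ : Icc (0 : ℝ) 1)).contDiff.contDiffAt.comp _ h2
  refine hcomp.congr_of_eventuallyEq ?_
  filter_upwards [hev] with p hp
  have h3 : hs.localInverse hd hn' (p, 0) = (p, flowCurve (V := W) hΦ p) := by
    rw [← curveEquation_flowCurve (V := W) hΦ p]
    exact hp
  rw [h3]
  simp [flowCurve]

/-- For fixed `x`, the times `t` at which the flow is `C^n` at `(t, x)` form an open set containing
`0`. It is also closed: near a limit time `s` the group law writes the flow as the flow up to a good
time `r`, followed by a flow for the short time close to `s - r`. -/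
theorem IsFlowOf.contDiff [CompleteSpace E] {Φ : ℝ → E → E} (hΦ : IsFlowOf V Φ)
    (hV : ContDiff ℝ ∞ V) (hK : LipschitzWith K V) (hC : ∀ x, ‖V x‖ ≤ C) :
    ContDiff ℝ ∞ (fun p : ℝ × E => Φ p.1 p.2) := by
  rw [contDiff_infty]
  intro m
  -- The order must be finite for `C^n` at a point to spread to a neighborhood, and nonzero for the
  -- inverse function theorem.
  suffices H : ContDiff ℝ (m + 1 : ℕ) (fun p : ℝ × E => Φ p.1 p.2) from
    H.of_le (by exact_mod_cast Nat.le_succ m)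
  set n := m + 1
  have hn : (n : WithTop ℕ∞) ≠ ∞ := by simp
  have hopen : ∀ p, ContDiffAt ℝ n (fun p : ℝ × E => Φ p.1 p.2) p →
      ∀ᶠ q in 𝓝 p, ContDiffAt ℝ n (fun p : ℝ × E => Φ p.1 p.2) q := fun p hp => hp.eventually hn
  rw [contDiff_iff_contDiffAt]
  rintro ⟨t, x⟩
  let T : Set ℝ := {t | ContDiffAt ℝ n (fun p : ℝ × E => Φ p.1 p.2) (t, x)}
  have hΦc : Continuous fun s => Φ s x :=
    continuous_iff_continuousAt.2 fun t => (hΦ.hasDerivAt t x).continuousAt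
  have hTo : IsOpen T := isOpen_iff_mem_nhds.2 fun s hs => by
    have h1 : Tendsto (fun s : ℝ => (s, x)) (𝓝 s) (𝓝 (s, x)) :=
      (Continuous.prodMk_left x).tendsto s
    exact h1.eventually (hopen _ hs)
  have hTc : IsClosed T := by
    refine isClosed_of_closure_subset fun s hs => ?_
    have h0 := hopen _ (hΦ.contDiffAt_zero hV hC (Φ s x) n (Nat.succ_ne_zero m))
    have h1 : Tendsto (fun r : ℝ => (s - r, Φ r x)) (𝓝 s) (𝓝 (0, Φ s x)) := by
      have : Continuous fun r : ℝ => (s - r, Φ r x) := by fun_prop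
      simpa using this.tendsto s
    obtain ⟨r, hr, hrT⟩ := mem_closure_iff_nhds.1 hs _ (h1.eventually h0)
    have h2 : ContDiffAt ℝ n (fun p : ℝ × E => (p.1 - r, Φ r p.2)) (s, x) := by
      refine (contDiffAt_fst.sub contDiffAt_const).prodMk ?_
      have h3 : ContDiffAt ℝ n (fun p : ℝ × E => (r, p.2)) (s, x) := by fun_prop
      have h5 : ContDiffAt ℝ n (fun p : ℝ × E => Φ p.1 p.2) ((fun p : ℝ × E => (r, p.2)) (s, x)) :=
        hrT
      have h6 := ContDiffAt.comp (s, x) h5 h3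
      exact h6
    have h5 : ContDiffAt ℝ n (fun p : ℝ × E => Φ p.1 p.2)
        ((fun p : ℝ × E => (p.1 - r, Φ r p.2)) (s, x)) := hr
    have h4 := ContDiffAt.comp (s, x) h5 h2
    refine h4.congr_of_eventuallyEq (Eventually.of_forall fun p => ?_)
    change Φ p.1 p.2 = Φ (p.1 - r) (Φ r p.2)
    rw [← hΦ.add hK, sub_add_cancel]
  have hT : T = univ := IsClopen.eq_univ ⟨hTc, hTo⟩
    ⟨0, hΦ.contDiffAt_zero hV hC x n (Nat.succ_ne_zero m)⟩
  exact (hT ▸ mem_univ t : t ∈ T)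

/-- A bounded Lipschitz vector field of class `C^∞` on a Banach space has a global flow of class
`C^∞`. -/
theorem exists_contDiff_flow [CompleteSpace E] (hV : ContDiff ℝ ∞ V) (hK : LipschitzWith K V)
    (hC : ∀ x, ‖V x‖ ≤ C) :
    ∃ Φ : ℝ → E → E, IsFlowOf V Φ ∧ ContDiff ℝ ∞ (fun p : ℝ × E => Φ p.1 p.2) := by
  choose γ h0 h1 using exists_integralCurve hK hC
  have hΦ : IsFlowOf V fun t x => γ x t := ⟨h0, fun t x => h1 x t⟩
  exact ⟨_, hΦ, hΦ.contDiff hV hK hC⟩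

end GlobalFlow

/-! ### Exterior derivatives and `1`-forms in charts. -/

section Curl

variable {E E' : Type*} [NormedAddCommGroup E] [NormedSpace ℝ E]
  [NormedAddCommGroup E'] [NormedSpace ℝ E']

/-- The exterior derivative of a `1`-form on a normed space, as a bilinear map. -/
def curl (a : E → E →L[ℝ] ℝ) (y : E) : E →L[ℝ] E →L[ℝ] ℝ :=
  fderiv ℝ a y - (fderiv ℝ a y).flip

theorem curl_apply (a : E → E →L[ℝ] ℝ) (y v w : E) :
    curl a y v w = fderiv ℝ a y v w - fderiv ℝ a y w v := rfl

theorem curl_swap (a : E → E →L[ℝ] ℝ) (y v w : E) : curl a y v w = -curl a y w v := by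
  simp [curl_apply]

theorem curl_self (a : E → E →L[ℝ] ℝ) (y v : E) : curl a y v v = 0 := by
  simp [curl_apply]

theorem curl_congr {a b : E → E →L[ℝ] ℝ} {y : E} (h : a =ᶠ[nhds y] b) : curl a y = curl b y := by
  rw [curl, curl, h.fderiv_eq]

theorem hasFDerivAt_pullback {g : E → E'} {a : E' → E' →L[ℝ] ℝ} {y : E}
    (hg : ContDiffAt ℝ 2 g y) (ha : DifferentiableAt ℝ a (g y)) (v w : E) :
    fderiv ℝ (fun x => (a (g x)).comp (fderiv ℝ g x)) y v w
      = fderiv ℝ a (g y) (fderiv ℝ g y v) (fderiv ℝ g y w)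
        + a (g y) (fderiv ℝ (fderiv ℝ g) y v w) := by
  have h1 : HasFDerivAt (fun x => a (g x)) ((fderiv ℝ a (g y)).comp (fderiv ℝ g y)) y :=
    ha.hasFDerivAt.comp y (hg.differentiableAt (by simp)).hasFDerivAt
  have h2 : HasFDerivAt (fderiv ℝ g) (fderiv ℝ (fderiv ℝ g) y) y :=
    ((hg.fderiv_right (m := 1) (by norm_num)).differentiableAt (by simp)).hasFDerivAt
  rw [(h1.clm_comp h2).fderiv]
  simp [add_comm]

/-- The second derivative of `g` is symmetric, so its contribution cancels in the
antisymmetrisation. -/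
theorem curl_pullback {g : E → E'} {a : E' → E' →L[ℝ] ℝ} {y : E}
    (hg : ContDiffAt ℝ 2 g y) (ha : DifferentiableAt ℝ a (g y)) (v w : E) :
    curl (fun x => (a (g x)).comp (fderiv ℝ g x)) y v w
      = curl a (g y) (fderiv ℝ g y v) (fderiv ℝ g y w) := by
  have hsymm : fderiv ℝ (fderiv ℝ g) y v w = fderiv ℝ (fderiv ℝ g) y w v :=
    (hg.isSymmSndFDerivAt (by simp)) v w
  rw [curl_apply, curl_apply, hasFDerivAt_pullback hg ha, hasFDerivAt_pullback hg ha, hsymm]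
  ring

theorem contDiffAt_curl {a : E → E →L[ℝ] ℝ} {y : E} (ha : ContDiffAt ℝ ∞ a y) :
    ContDiffAt ℝ ∞ (curl a) y := by
  have h1 : ContDiffAt ℝ ∞ (fderiv ℝ a) y := ha.fderiv_right (by simp)
  let L : (E →L[ℝ] E →L[ℝ] ℝ) →L[ℝ] (E →L[ℝ] E →L[ℝ] ℝ) :=
    (ContinuousLinearMap.flipₗᵢ ℝ E E ℝ).toContinuousLinearEquiv.toContinuousLinearMap
  have h2 : ContDiff ℝ ∞ L := by fun_prop
  exact h1.sub (h2.contDiffAt.comp y h1)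

end Curl

section Charts

variable {E : Type*} [NormedAddCommGroup E] [NormedSpace ℝ E]
  {H : Type*} [TopologicalSpace H] {I : ModelWithCorners ℝ E H}
  {X : Type*} [TopologicalSpace X] [ChartedSpace H X]
  {E' : Type*} [NormedAddCommGroup E'] [NormedSpace ℝ E']
  {H' : Type*} [TopologicalSpace H'] {I' : ModelWithCorners ℝ E' H'}
  {Y : Type*} [TopologicalSpace Y] [ChartedSpace H' Y]

theorem fderiv_eq_of_hasMFDerivAt {f : E → E'} {y : E} {D : E →L[ℝ] E'}
    (h : HasMFDerivAt 𝓘(ℝ, E) 𝓘(ℝ, E') f y D) : fderiv ℝ f y = D := by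
  have h' : HasFDerivAt f D y := h.hasFDerivAt
  exact h'.fderiv

/-- The pullback of a `1`-form. -/
def OneForm.pull (g : X → Y) (α : OneForm I' Y) : OneForm I X :=
  fun m => (α (g m)).comp (mfderiv I I' g m)

/-- A map between manifolds written in the preferred charts at two given points. -/
def chartRep (I : ModelWithCorners ℝ E H) (I' : ModelWithCorners ℝ E' H') (x₀ : X) (y₀ : Y)
    (g : X → Y) : E → E' :=
  extChartAt I' y₀ ∘ g ∘ (extChartAt I x₀).symm

theorem chartRep_extChartAt {g : X → Y} {x₀ : X} {y₀ : Y} {m : X}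
    (hm : m ∈ (extChartAt I x₀).source) :
    chartRep I I' x₀ y₀ g (extChartAt I x₀ m) = extChartAt I' y₀ (g m) := by
  simp only [chartRep, Function.comp_apply, (extChartAt I x₀).left_inv hm]

variable [I.Boundaryless] [IsManifold I ∞ X]

theorem mfderiv_extChartAt_symm_apply (x₀ : X) {y : E} (hy : y ∈ (extChartAt I x₀).target) (w : E) :
    mfderiv I 𝓘(ℝ, E) (extChartAt I x₀) ((extChartAt I x₀).symm y)
      (mfderiv 𝓘(ℝ, E) I (extChartAt I x₀).symm y w) = w := by
  have := mfderiv_extChartAt_comp_mfderivWithin_extChartAt_symm (I := I) hy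
  rw [I.range_eq_univ, mfderivWithin_univ] at this
  exact DFunLike.congr_fun this w

theorem mfderiv_symm_extChartAt_apply {x₀ m : X} (hm : m ∈ (extChartAt I x₀).source)
    (v : TangentSpace I m) :
    mfderiv 𝓘(ℝ, E) I (extChartAt I x₀).symm (extChartAt I x₀ m)
      (mfderiv I 𝓘(ℝ, E) (extChartAt I x₀) m v) = v := by
  have := mfderivWithin_extChartAt_symm_comp_mfderiv_extChartAt' (I := I) hm
  rw [I.range_eq_univ, mfderivWithin_univ] at this
  exact DFunLike.congr_fun this v

theorem mfderiv_extChartAt_injective {x₀ m : X} (hm : m ∈ (extChartAt I x₀).source) :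
    Function.Injective (mfderiv I 𝓘(ℝ, E) (extChartAt I x₀) m) := fun v w h => by
  rw [← mfderiv_symm_extChartAt_apply hm v, h, mfderiv_symm_extChartAt_apply hm w]

theorem mfderiv_extChartAt_surjective {x₀ m : X} (hm : m ∈ (extChartAt I x₀).source) :
    Function.Surjective (mfderiv I 𝓘(ℝ, E) (extChartAt I x₀) m) :=
  (isInvertible_mfderiv_extChartAt hm).bijective.surjective

theorem mdifferentiableAt_extChartAt_symm {x₀ : X} {y : E} (hy : y ∈ (extChartAt I x₀).target) :
    MDifferentiableAt 𝓘(ℝ, E) I (extChartAt I x₀).symm y := by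
  have := mdifferentiableWithinAt_extChartAt_symm (I := I) hy
  rwa [I.range_eq_univ, mdifferentiableWithinAt_univ] at this

theorem OneForm.inChart_apply_mfderiv (α : OneForm I X) {x₀ m : X}
    (hm : m ∈ (extChartAt I x₀).source) (v : TangentSpace I m) :
    α.inChart x₀ (extChartAt I x₀ m) (mfderiv I 𝓘(ℝ, E) (extChartAt I x₀) m v) = α m v := by
  -- The chart followed by its inverse gives a base point equal to `m` only propositionally.
  -- Replacing it by a variable allows the substitution in the dependent type.
  have h : ∀ (m' : X) (_ : m' = m) (T : E →L[ℝ] E) (v' : E), T v' = v →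
      (α m').comp T v' = α m v := by
    rintro m' rfl T v' hT
    rw [← hT]
    rfl
  exact h _ ((extChartAt I x₀).left_inv hm) _ _ (mfderiv_symm_extChartAt_apply hm v)

theorem OneForm.ext_inChart {α β : OneForm I X} {x₀ m : X} (hm : m ∈ (extChartAt I x₀).source)
    (h : α.inChart x₀ (extChartAt I x₀ m) = β.inChart x₀ (extChartAt I x₀ m)) : α m = β m := by
  ext v
  rw [← α.inChart_apply_mfderiv hm, h, β.inChart_apply_mfderiv hm]

variable [I'.Boundaryless] [IsManifold I' ∞ Y]

theorem fderiv_chartRep_apply {g : X → Y} {x₀ : X} {y₀ : Y} {y : E}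
    (hy : y ∈ (extChartAt I x₀).target)
    (hgy : g ((extChartAt I x₀).symm y) ∈ (extChartAt I' y₀).source)
    (hg : MDifferentiableAt I I' g ((extChartAt I x₀).symm y)) (w : E) :
    fderiv ℝ (chartRep I I' x₀ y₀ g) y w
      = mfderiv I' 𝓘(ℝ, E') (extChartAt I' y₀) (g ((extChartAt I x₀).symm y))
          (mfderiv I I' g ((extChartAt I x₀).symm y)
            (mfderiv 𝓘(ℝ, E) I (extChartAt I x₀).symm y w)) := by
  have h3 : MDifferentiableAt I' 𝓘(ℝ, E') (extChartAt I' y₀) (g ((extChartAt I x₀).symm y)) :=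
    mdifferentiableAt_extChartAt (I := I') (by simpa using hgy)
  have h4 := h3.hasMFDerivAt.comp y
    (hg.hasMFDerivAt.comp y (mdifferentiableAt_extChartAt_symm hy).hasMFDerivAt)
  exact DFunLike.congr_fun (fderiv_eq_of_hasMFDerivAt h4) w

theorem fderiv_chartRep {g : X → Y} {x₀ : X} {y₀ : Y} {m : X}
    (hm : m ∈ (extChartAt I x₀).source) (hgm : g m ∈ (extChartAt I' y₀).source)
    (hg : MDifferentiableAt I I' g m) (v : TangentSpace I m) :
    fderiv ℝ (chartRep I I' x₀ y₀ g) (extChartAt I x₀ m)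
      (mfderiv I 𝓘(ℝ, E) (extChartAt I x₀) m v)
      = mfderiv I' 𝓘(ℝ, E') (extChartAt I' y₀) (g m) (mfderiv I I' g m v) := by
  obtain ⟨y, hy, rfl⟩ : ∃ y ∈ (extChartAt I x₀).target, (extChartAt I x₀).symm y = m :=
    ⟨_, (extChartAt I x₀).map_source hm, (extChartAt I x₀).left_inv hm⟩
  have h1 := fderiv_chartRep_apply hy hgm hg
    (mfderiv I 𝓘(ℝ, E) (extChartAt I x₀) ((extChartAt I x₀).symm y) v)
  have h2 := mfderiv_symm_extChartAt_apply hm v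
  rw [(extChartAt I x₀).right_inv hy] at h2 ⊢
  exact h1.trans (congrArg (fun u => mfderiv I' 𝓘(ℝ, E') (extChartAt I' y₀) _
    (mfderiv I I' g ((extChartAt I x₀).symm y) u)) h2)

theorem OneForm.inChart_pull (α : OneForm I' Y) {g : X → Y} {x₀ : X} {y₀ : Y} {y : E}
    (hy : y ∈ (extChartAt I x₀).target)
    (hgy : g ((extChartAt I x₀).symm y) ∈ (extChartAt I' y₀).source)
    (hg : MDifferentiableAt I I' g ((extChartAt I x₀).symm y)) :
    (α.pull (I := I) g).inChart x₀ y
      = (α.inChart y₀ (chartRep I I' x₀ y₀ g y)).comp (fderiv ℝ (chartRep I I' x₀ y₀ g) y) := by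
  ext w
  have h1 := α.inChart_apply_mfderiv hgy
    (mfderiv I I' g ((extChartAt I x₀).symm y) (mfderiv 𝓘(ℝ, E) I (extChartAt I x₀).symm y w))
  rw [← fderiv_chartRep_apply hy hgy hg] at h1
  exact h1.symm

end Charts

section Smooth

variable {E : Type*} [NormedAddCommGroup E] [NormedSpace ℝ E]
  {H : Type*} [TopologicalSpace H] {I : ModelWithCorners ℝ E H} [I.Boundaryless]
  {X : Type*} [TopologicalSpace X] [ChartedSpace H X] [IsManifold I ∞ X]

theorem contMDiffAt_extChartAt_symm {x₀ : X} {y : E} (hy : y ∈ (extChartAt I x₀).target) :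
    ContMDiffAt 𝓘(ℝ, E) I ∞ (extChartAt I x₀).symm y :=
  (contMDiffOn_extChartAt_symm x₀).contMDiffAt ((isOpen_extChartAt_target x₀).mem_nhds hy)

/-- A `1`-form is smooth at a point if it is so as a section of the cotangent bundle. -/
def OneForm.IsSmoothAt (α : OneForm I X) (x : X) : Prop :=
  ContMDiffAt I (I.prod 𝓘(ℝ, E →L[ℝ] ℝ)) ∞ (fun x : X => (⟨x, α x⟩ : CotangentBundle I X)) x

theorem inCoordinates_covector {x₀ x : X} (hx : x ∈ (chartAt H x₀).source)
    (p : TangentSpace I x →L[ℝ] ℝ) :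
    ContinuousLinearMap.inCoordinates E (TangentSpace I : X → Type _) ℝ (Bundle.Trivial X ℝ)
      x₀ x x₀ x p = p.comp (mfderiv 𝓘(ℝ, E) I (extChartAt I x₀).symm (extChartAt I x₀ x)) := by
  have := TangentBundle.symmL_trivializationAt (I := I) (𝕜 := ℝ) hx
  rw [I.range_eq_univ, mfderivWithin_univ] at this
  have h2 : (trivializationAt ℝ (Bundle.Trivial X ℝ) x₀).continuousLinearMapAt ℝ x
      = ContinuousLinearMap.id ℝ ℝ := Bundle.Trivial.continuousLinearMapAt_trivialization ℝ X ℝ x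
  rw [ContinuousLinearMap.inCoordinates, this]
  ext v
  exact DFunLike.congr_fun h2 _

theorem OneForm.IsSmooth.contDiffAt_inChart {α : OneForm I X} (hα : α.IsSmooth) (x₀ : X) {y : E}
    (hy : y ∈ (extChartAt I x₀).target) : ContDiffAt ℝ ∞ (α.inChart x₀) y := by
  have hx : (extChartAt I x₀).symm y ∈ (extChartAt I x₀).source := (extChartAt I x₀).map_target hy
  have hx' : (extChartAt I x₀).symm y ∈ (chartAt H x₀).source := by simpa using hx
  let e := trivializationAt (E →L[ℝ] ℝ) (fun x : X => TangentSpace I x →L[ℝ] ℝ) x₀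
  have he : ∀ x, x ∈ e.baseSet ↔ x ∈ (chartAt H x₀).source := fun x => by
    simp [e, hom_trivializationAt_baseSet]
  have h1 : ContMDiffAt I 𝓘(ℝ, E →L[ℝ] ℝ) ∞ (fun x => (e ⟨x, α x⟩).2) ((extChartAt I x₀).symm y) :=
    (e.contMDiffAt_section_iff ((he _).2 hx')).1 (hα _)
  have h2 := h1.comp y (contMDiffAt_extChartAt_symm hy)
  refine h2.contDiffAt.congr_of_eventuallyEq ?_
  filter_upwards [(isOpen_extChartAt_target (I := I) x₀).mem_nhds hy] with z hz
  have hz' : (extChartAt I x₀).symm z ∈ (chartAt H x₀).source := by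
    simpa using (extChartAt I x₀).map_target hz
  have h3 := inCoordinates_covector hz' (α ((extChartAt I x₀).symm z))
  rw [(extChartAt I x₀).right_inv hz] at h3
  exact h3.symm

/-- The definition uses the preferred chart at `x` itself. Expressing that chart form as a pullback
by the transition map and applying `curl_pullback` shows independence of the chart, so that one
chart at `x₀` serves for all nearby points. -/
theorem OneForm.extDeriv_eq {α : OneForm I X} (hα : α.IsSmooth) {x₀ x : X}
    (hx : x ∈ (extChartAt I x₀).source) (v w : TangentSpace I x) :
    α.extDeriv x v w = curl (α.inChart x₀) (extChartAt I x₀ x)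
      (mfderiv I 𝓘(ℝ, E) (extChartAt I x₀) x v) (mfderiv I 𝓘(ℝ, E) (extChartAt I x₀) x w) := by
  have h0 : α.extDeriv x v w = curl (α.inChart x) (extChartAt I x x)
      (mfderiv I 𝓘(ℝ, E) (extChartAt I x) x v) (mfderiv I 𝓘(ℝ, E) (extChartAt I x) x w) := rfl
  have hxx := mem_extChartAt_source (I := I) x
  have hev : α.inChart x =ᶠ[nhds (extChartAt I x x)] fun y =>
      (α.inChart x₀ (chartRep I I x x₀ id y)).comp (fderiv ℝ (chartRep I I x x₀ id) y) := by
    have h1 : (extChartAt I x).target ∈ nhds (extChartAt I x x) := extChartAt_target_mem_nhds x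
    have h2 : (extChartAt I x).symm ⁻¹' (extChartAt I x₀).source ∈ nhds (extChartAt I x x) := by
      refine (continuousAt_extChartAt_symm x).preimage_mem_nhds ?_
      rw [extChartAt_to_inv]
      exact (isOpen_extChartAt_source x₀).mem_nhds hx
    filter_upwards [h1, h2] with y hy1 hy2
    rw [← α.inChart_pull hy1 hy2 mdifferentiableAt_id]
    have : α.pull (I := I) id = α := by
      funext m
      rw [OneForm.pull, mfderiv_id]
      rfl
    rw [this]
  have hrep : chartRep I I x x₀ id (extChartAt I x x) = extChartAt I x₀ x :=
    chartRep_extChartAt hxx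
  have hsm : ContDiffAt ℝ 2 (chartRep I I x x₀ id) (extChartAt I x x) := by
    have h1 : ContMDiffAt I 𝓘(ℝ, E) ∞ (extChartAt I x₀) ((extChartAt I x).symm (extChartAt I x x)) := by
      rw [extChartAt_to_inv]
      exact contMDiffAt_extChartAt' (by simpa using hx)
    exact ((h1.comp _ (contMDiffAt_extChartAt_symm
      ((extChartAt I x).map_source hxx))).contDiffAt).of_le (by norm_cast)
  have hd : DifferentiableAt ℝ (α.inChart x₀) (chartRep I I x x₀ id (extChartAt I x x)) := by
    rw [hrep]
    exact (hα.contDiffAt_inChart x₀ ((extChartAt I x₀).map_source hx)).differentiableAt (by simp)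
  have key : ∀ V W : E, curl (α.inChart x) (extChartAt I x x) V W
      = curl (α.inChart x₀) (extChartAt I x₀ x)
        (fderiv ℝ (chartRep I I x x₀ id) (extChartAt I x x) V)
        (fderiv ℝ (chartRep I I x x₀ id) (extChartAt I x x) W) := fun V W => by
    rw [curl_congr hev, curl_pullback hsm hd, hrep]
  have hD : ∀ u : TangentSpace I x, fderiv ℝ (chartRep I I x x₀ id) (extChartAt I x x)
      (mfderiv I 𝓘(ℝ, E) (extChartAt I x) x u) = mfderiv I 𝓘(ℝ, E) (extChartAt I x₀) x u :=
    fun u => (fderiv_chartRep hxx hx mdifferentiableAt_id u).trans (by rw [mfderiv_id]; rfl)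
  exact h0.trans ((key _ _).trans
    (congrArg₂ (fun a b : E => curl (α.inChart x₀) (extChartAt I x₀ x) a b) (hD v) (hD w)))

end Smooth

/-! ### Cutoff functions and flows of compactly supported fields. -/

section CutOff

open Topology Filter

variable {E : Type*} [NormedAddCommGroup E] [NormedSpace ℝ E]

/-- A smooth function with compact support in a given neighborhood of a compact set, equal to `1`
near that set. -/
theorem exists_contDiff_cutoff [FiniteDimensional ℝ E] {K U : Set E} (hK : IsCompact K) (hU : IsOpen U) (hKU : K ⊆ U) :
    ∃ χ : E → ℝ, ContDiff ℝ ∞ χ ∧ HasCompactSupport χ ∧ tsupport χ ⊆ U ∧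
      ∀ y ∈ K, ∀ᶠ z in 𝓝 y, χ z = 1 := by
  obtain ⟨L, hL, hKL, hLU⟩ := exists_compact_between hK hU hKU
  obtain ⟨χ, h1, h0, -⟩ := exists_contMDiffMap_one_nhds_of_subset_interior (n := ⊤) 𝓘(ℝ, E)
    hK.isClosed hKL
  have hsupp : tsupport χ ⊆ L :=
    closure_minimal (fun x hx => by_contra fun h => hx (h0 x h)) hL.isClosed
  refine ⟨χ, χ.contMDiff.contDiff, hL.of_isClosed_subset (isClosed_tsupport _) hsupp,
    hsupp.trans hLU, fun y hy => ?_⟩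
  exact h1.filter_mono (nhds_le_nhdsSet hy)

theorem contDiff_smul_of_tsupport {F : Type*} [NormedAddCommGroup F] [NormedSpace ℝ F]
    {χ : E → ℝ} {f : E → F} (hχ : ContDiff ℝ ∞ χ)
    (hf : ∀ y ∈ tsupport χ, ContDiffAt ℝ ∞ f y) : ContDiff ℝ ∞ fun y => χ y • f y := by
  rw [contDiff_iff_contDiffAt]
  intro y
  by_cases hy : y ∈ tsupport χ
  · exact hχ.contDiffAt.smul (hf y hy)
  · refine (contDiffAt_const (c := (0 : F))).congr_of_eventuallyEq ?_
    filter_upwards [notMem_tsupport_iff_eventuallyEq.1 hy] with z hz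
    simp [hz]

/-- The flow of a constant vector plus a smooth vector field of compact support. -/
theorem exists_flow_const_add [FiniteDimensional ℝ E] {V : E → E} (v₀ : E) (hV : ContDiff ℝ ∞ V)
    (hc : HasCompactSupport V) :
    ∃ (K : NNReal) (Φ : ℝ → E → E), LipschitzWith K (fun y => v₀ + V y) ∧
      IsFlowOf (fun y => v₀ + V y) Φ ∧ ContDiff ℝ ∞ (fun p : ℝ × E => Φ p.1 p.2) := by
  obtain ⟨K, hK⟩ := hV.lipschitzWith_of_hasCompactSupport hc (by simp)
  obtain ⟨C, hC⟩ := hc.exists_bound_of_continuous hV.continuous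
  have hK' : LipschitzWith K (fun y => v₀ + V y) := LipschitzWith.of_dist_le_mul fun x y => by
    simpa using hK.dist_le_mul x y
  have hC' : ∀ x, ‖v₀ + V x‖ ≤ (‖v₀‖ + max C 0).toNNReal := fun x => by
    rw [Real.coe_toNNReal _ (by positivity)]
    exact (norm_add_le _ _).trans (by gcongr; exact (hC x).trans (le_max_left _ _))
  obtain ⟨Φ, hΦ, hs⟩ := exists_contDiff_flow (contDiff_const.add hV) hK' hC'
  exact ⟨K, Φ, hK', hΦ, hs⟩

end CutOff

/-! ### Contact forms on a vector space: Reeb fields, Cartan's formula and Moser's argument. -/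

section ContactAlgebra

open Topology Filter

variable {E : Type*} [NormedAddCommGroup E] [NormedSpace ℝ E]

/-- The map `v ↦ da (v, ·) + a(v) a` from vectors to covectors, which is bijective at the points
where the `1`-form `a` is a contact form. -/
def contactMap (a : E → E →L[ℝ] ℝ) (y : E) : E →L[ℝ] E →L[ℝ] ℝ :=
  curl a y + (a y).smulRight (a y)

theorem contactMap_apply (a : E → E →L[ℝ] ℝ) (y v w : E) :
    contactMap a y v w = curl a y v w + a y v * a y w := by
  simp [contactMap]

theorem contDiffAt_contactMap {a : E → E →L[ℝ] ℝ} {y : E} (ha : ContDiffAt ℝ ∞ a y) :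
    ContDiffAt ℝ ∞ (contactMap a) y :=
  (contDiffAt_curl ha).add (ha.smulRight ha)

/-- The contact condition for a `1`-form on a normed space at a point. -/
def IsContactAt (a : E → E →L[ℝ] ℝ) (y : E) : Prop :=
  ∀ v, a y v = 0 → (∀ w, a y w = 0 → curl a y v w = 0) → v = 0

/-- If `da (v, ·) + a(v) a` vanishes, evaluation at `v` gives `a(v)^2 = 0`; then `v` lies in the
kernel of `da` on `ker a`, hence is zero. Equality of dimensions does the rest. -/
theorem IsContactAt.isInvertible [FiniteDimensional ℝ E] {a : E → E →L[ℝ] ℝ} {y : E}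
    (h : IsContactAt a y) : (contactMap a y).IsInvertible := by
  have hinj : Function.Injective (contactMap a y) := by
    rw [injective_iff_map_eq_zero]
    intro v hv
    have hv' : ∀ w, curl a y v w + a y v * a y w = 0 := fun w => by
      rw [← contactMap_apply, hv]; rfl
    have h0 : a y v = 0 := by
      have := hv' v
      rw [curl_self, zero_add] at this
      exact mul_self_eq_zero.1 this
    exact h v h0 fun w _ => by simpa [h0] using hv' w
  have hdim : Module.finrank ℝ E = Module.finrank ℝ (E →L[ℝ] ℝ) := by
    rw [← (LinearMap.toContinuousLinearMap (𝕜 := ℝ) (E := E) (F' := ℝ)).finrank_eq]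
    exact (Subspace.dual_finrank_eq).symm
  let e := LinearEquiv.ofInjectiveOfFinrankEq (contactMap a y : E →ₗ[ℝ] E →L[ℝ] ℝ) hinj hdim
  exact ⟨e.toContinuousLinearEquiv, by ext; rfl⟩

theorem contDiffAt_contactMap_inverse [CompleteSpace E] {a : E → E →L[ℝ] ℝ} {y : E}
    (ha : ContDiffAt ℝ ∞ a y) (h : (contactMap a y).IsInvertible) :
    ContDiffAt ℝ ∞ (fun z => (contactMap a z).inverse) y :=
  h.contDiffAt_map_inverse.comp y (contDiffAt_contactMap ha)

theorem contactMap_inverse_apply {a : E → E →L[ℝ] ℝ} {y : E}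
    (h : (contactMap a y).IsInvertible) (p : E →L[ℝ] ℝ) (w : E) :
    curl a y ((contactMap a y).inverse p) w + a y ((contactMap a y).inverse p) * a y w = p w := by
  rw [← contactMap_apply, h.self_apply_inverse]

end ContactAlgebra

section LieDerivative

variable {E : Type*} [NormedAddCommGroup E] [NormedSpace ℝ E]

/-- Cartan's formula along a flow. -/
theorem hasDerivAt_flow_pullback {V : E → E} {Φ : ℝ → E → E} (hΦ : IsFlowOf V Φ)
    (hs : ContDiff ℝ ∞ (fun p : ℝ × E => Φ p.1 p.2)) (hV : Differentiable ℝ V)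
    {a : E → E →L[ℝ] ℝ} {s : ℝ} {z : E} (ha : DifferentiableAt ℝ a (Φ s z)) (w : E) :
    HasDerivAt (fun t => a (Φ t z) (fderiv ℝ (Φ t) z w))
      (curl a (Φ s z) (V (Φ s z)) (fderiv ℝ (Φ s) z w)
        + fderiv ℝ (fun q => a q (V q)) (Φ s z) (fderiv ℝ (Φ s) z w)) s := by
  set Ψ : ℝ × E → E := fun p => Φ p.1 p.2
  have hd : Differentiable ℝ Ψ := hs.differentiable (by simp)
  have hd2 : Differentiable ℝ (fderiv ℝ Ψ) :=
    (hs.fderiv_right (m := 1) (by norm_cast)).differentiable (by simp)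
  have hslice : ∀ t, fderiv ℝ (Φ t) z w = fderiv ℝ Ψ (t, z) (0, w) := fun t => by
    have h1 : HasFDerivAt (fun y : E => ((t, y) : ℝ × E)) (ContinuousLinearMap.inr ℝ ℝ E) z :=
      hasFDerivAt_prodMk_right t z
    have h2 : HasFDerivAt (Φ t) ((fderiv ℝ Ψ (t, z)).comp (ContinuousLinearMap.inr ℝ ℝ E)) z :=
      (hd (t, z)).hasFDerivAt.comp z h1
    rw [h2.fderiv]; rfl
  have htime : ∀ p : ℝ × E, fderiv ℝ Ψ p (1, 0) = V (Ψ p) := fun p => by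
    have h1 : HasFDerivAt (fun t : ℝ => ((t, p.2) : ℝ × E)) (ContinuousLinearMap.inl ℝ ℝ E) p.1 :=
      hasFDerivAt_prodMk_left p.1 p.2
    have h2 : HasFDerivAt (fun t => Φ t p.2)
        ((fderiv ℝ Ψ p).comp (ContinuousLinearMap.inl ℝ ℝ E)) p.1 :=
      HasFDerivAt.comp (g := Ψ) p.1 (hd p).hasFDerivAt h1
    have h3 := h2.hasDerivAt.unique (hΦ.hasDerivAt p.1 p.2)
    simpa using h3
  -- Symmetry of the second derivative of the joint flow exchanges the time and space derivatives.
  -- This is the linearised flow equation.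
  have hsymm : fderiv ℝ (fderiv ℝ Ψ) (s, z) (1, 0) (0, w)
      = fderiv ℝ V (Φ s z) (fderiv ℝ Ψ (s, z) (0, w)) := by
    have h1 : fderiv ℝ (fderiv ℝ Ψ) (s, z) (1, 0) (0, w)
        = fderiv ℝ (fderiv ℝ Ψ) (s, z) (0, w) (1, 0) :=
      (hs.contDiffAt.isSymmSndFDerivAt (n := ∞) (by simp; norm_cast)) _ _
    have h2 : HasFDerivAt (fun p => fderiv ℝ Ψ p (1, 0))
        ((fderiv ℝ (fderiv ℝ Ψ) (s, z)).flip (1, 0)) (s, z) := by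
      have := (hd2 (s, z)).hasFDerivAt.clm_apply (hasFDerivAt_const ((1, 0) : ℝ × E) (s, z))
      simpa using this
    have h3 : HasFDerivAt (fun p => V (Ψ p))
        ((fderiv ℝ V (Φ s z)).comp (fderiv ℝ Ψ (s, z))) (s, z) :=
      (hV (Ψ (s, z))).hasFDerivAt.comp (s, z) (hd (s, z)).hasFDerivAt
    rw [funext htime] at h2
    have h4 := DFunLike.congr_fun (h2.unique h3) (0, w)
    rw [h1]
    exact h4
  have hline : HasDerivAt (fun t : ℝ => ((t, z) : ℝ × E)) (1, 0) s :=
    (hasDerivAt_id s).prodMk (hasDerivAt_const s z)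
  have hD : HasDerivAt (fun t => fderiv ℝ (Φ t) z w)
      (fderiv ℝ V (Φ s z) (fderiv ℝ (Φ s) z w)) s := by
    rw [funext hslice, hslice, ← hsymm]
    have h1 : HasDerivAt (fun t => fderiv ℝ Ψ (t, z)) (fderiv ℝ (fderiv ℝ Ψ) (s, z) (1, 0)) s :=
      (hd2 (s, z)).hasFDerivAt.comp_hasDerivAt s hline
    simpa using h1.clm_apply (hasDerivAt_const s ((0, w) : ℝ × E))
  have hA : HasDerivAt (fun t => a (Φ t z)) (fderiv ℝ a (Φ s z) (V (Φ s z))) s :=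
    ha.hasFDerivAt.comp_hasDerivAt s (hΦ.hasDerivAt s z)
  have hAV : fderiv ℝ (fun q => a q (V q)) (Φ s z) (fderiv ℝ (Φ s) z w)
      = fderiv ℝ a (Φ s z) (fderiv ℝ (Φ s) z w) (V (Φ s z))
        + a (Φ s z) (fderiv ℝ V (Φ s z) (fderiv ℝ (Φ s) z w)) := by
    rw [(ha.hasFDerivAt.clm_apply (hV (Φ s z)).hasFDerivAt).fderiv]
    simp [add_comm]
  refine (hA.clm_apply hD).congr_deriv ?_
  rw [curl_apply, hAV]
  ring

end LieDerivative

section Reeb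

open Topology Filter

variable {E : Type*} [NormedAddCommGroup E] [NormedSpace ℝ E] [FiniteDimensional ℝ E]

/-- The Reeb vector field of a contact form on a normed space. -/
def reebField (a : E → E →L[ℝ] ℝ) (y : E) : E := (contactMap a y).inverse (a y)

/-- Pairing the defining equation with the vector `R` itself gives `a(R)^2 = a(R)`. The value `0`
would put `R` into the kernel of `da` on `ker a`, so that `R = 0` and then `a y = 0`. -/
theorem IsContactAt.apply_reebField {a : E → E →L[ℝ] ℝ} {y : E} (h : IsContactAt a y)
    (h0 : a y ≠ 0) : a y (reebField a y) = 1 := by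
  have hR : ∀ w, curl a y (reebField a y) w + a y (reebField a y) * a y w = a y w :=
    contactMap_inverse_apply h.isInvertible (a y)
  have h1 := hR (reebField a y)
  rw [curl_self, zero_add] at h1
  by_contra hne
  have h2 : a y (reebField a y) = 0 := by
    by_contra h3
    exact hne (mul_left_cancel₀ h3 (by rw [h1, mul_one]))
  have h3 : reebField a y = 0 := h _ h2 fun w hw => by simpa [hw] using hR w
  refine h0 (ContinuousLinearMap.ext fun w => ?_)
  rw [← hR w, h3]
  simp

theorem IsContactAt.curl_reebField {a : E → E →L[ℝ] ℝ} {y : E} (h : IsContactAt a y)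
    (h0 : a y ≠ 0) (w : E) : curl a y (reebField a y) w = 0 := by
  have hR := contactMap_inverse_apply h.isInvertible (a y) w
  have h1 := h.apply_reebField h0
  unfold reebField at h1 ⊢
  rw [h1] at hR
  linarith

theorem contDiffAt_reebField {a : E → E →L[ℝ] ℝ} {y : E} (ha : ContDiffAt ℝ ∞ a y)
    (h : IsContactAt a y) : ContDiffAt ℝ ∞ (reebField a) y :=
  (contDiffAt_contactMap_inverse ha h.isInvertible).clm_apply ha

/-- A local flow of the Reeb vector field, which preserves the contact form. -/
theorem exists_reebFlow {a : E → E →L[ℝ] ℝ} {y₀ : E}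
    (ha : ∀ᶠ z in 𝓝 y₀, ContDiffAt ℝ ∞ a z) (hc : ∀ᶠ z in 𝓝 y₀, IsContactAt a z ∧ a z ≠ 0) :
    ∃ Φ : ℝ → E → E, ContDiff ℝ ∞ (fun p : ℝ × E => Φ p.1 p.2) ∧ (∀ z, Φ 0 z = z) ∧
      ∀ᶠ p : ℝ × E in 𝓝 (0, y₀),
        HasDerivAt (fun s => Φ s p.2) (reebField a (Φ p.1 p.2)) p.1 ∧
        ∀ w, a (Φ p.1 p.2) (fderiv ℝ (Φ p.1) p.2 w) = a p.2 w := by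
  obtain ⟨U, hUsub, hUo, hyU⟩ := mem_nhds_iff.1 (ha.and hc)
  obtain ⟨χ, hχ, hχc, hχU, hχ1⟩ := exists_contDiff_cutoff (isCompact_singleton (x := y₀)) hUo
    (singleton_subset_iff.2 hyU)
  have hV : ContDiff ℝ ∞ fun y => χ y • reebField a y := contDiff_smul_of_tsupport hχ fun y hy =>
    contDiffAt_reebField (hUsub (hχU hy)).1 (hUsub (hχU hy)).2.1
  have hVc : HasCompactSupport fun y => χ y • reebField a y := hχc.smul_right
  obtain ⟨K, Φ, -, hΦ, hs⟩ := exists_flow_const_add 0 hV hVc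
  simp only [zero_add] at hΦ
  refine ⟨Φ, hs, hΦ.zero, ?_⟩
  have hev : ∀ᶠ q in 𝓝 y₀, (∀ᶠ p in 𝓝 q, χ p = 1) ∧ q ∈ U :=
    (hχ1 y₀ rfl).eventually_nhds.and (hUo.mem_nhds hyU)
  have hcont : Tendsto (fun p : ℝ × E => Φ p.1 p.2) (𝓝 (0, y₀)) (𝓝 y₀) := by
    simpa [hΦ.zero] using hs.continuous.tendsto (0, y₀)
  obtain ⟨ε, hε, hball⟩ := Metric.eventually_nhds_iff_ball.1 (hcont.eventually hev)
  filter_upwards [Metric.ball_mem_nhds _ hε] with p hp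
  rw [← ball_prod_same] at hp
  have hbox : ∀ s ∈ Metric.ball (0 : ℝ) ε,
      (∀ᶠ q in 𝓝 (Φ s p.2), χ q = 1) ∧ Φ s p.2 ∈ U := fun s hs' => by
    refine hball (s, p.2) ?_
    rw [← ball_prod_same]
    exact ⟨hs', hp.2⟩
  have hVR : ∀ s ∈ Metric.ball (0 : ℝ) ε,
      (fun y => χ y • reebField a y) =ᶠ[𝓝 (Φ s p.2)] reebField a := fun s hs' => by
    filter_upwards [(hbox s hs').1] with q hq
    rw [hq, one_smul]
  refine ⟨?_, fun w => ?_⟩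
  · have := hΦ.hasDerivAt p.1 p.2
    rwa [show χ (Φ p.1 p.2) • reebField a (Φ p.1 p.2) = reebField a (Φ p.1 p.2) from
      (hVR p.1 hp.1).self_of_nhds] at this
  -- Both terms of Cartan's formula vanish: `da (R, ·) = 0`, and `a(R)` is locally the constant `1`.
  · have hderiv : ∀ s ∈ Metric.ball (0 : ℝ) ε,
        HasDerivAt (fun t => a (Φ t p.2) (fderiv ℝ (Φ t) p.2 w)) 0 s := fun s hs' => by
      have hU := (hbox s hs').2
      refine (hasDerivAt_flow_pullback hΦ hs (hV.differentiable (by simp))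
        ((hUsub hU).1.differentiableAt (by simp)) w).congr_deriv ?_
      have h1 : (fun q => a q (χ q • reebField a q)) =ᶠ[𝓝 (Φ s p.2)] fun _ => (1 : ℝ) := by
        filter_upwards [hVR s hs', hUo.mem_nhds hU] with q hq hqU
        rw [hq]
        exact (hUsub hqU).2.1.apply_reebField (hUsub hqU).2.2
      rw [h1.fderiv_eq, show χ (Φ s p.2) • reebField a (Φ s p.2) = reebField a (Φ s p.2) from
        (hVR s hs').self_of_nhds, (hUsub hU).2.1.curl_reebField (hUsub hU).2.2]
      simp
    have hpre : IsPreconnected (Metric.ball (0 : ℝ) ε) := (convex_ball _ _).isPreconnected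
    have := Metric.isOpen_ball.is_const_of_deriv_eq_zero hpre
      (fun s hs' => (hderiv s hs').differentiableAt.differentiableWithinAt)
      (fun s hs' => (hderiv s hs').deriv) hp.1 (Metric.mem_ball_self hε)
    refine this.trans ?_
    have h0 : Φ 0 = id := funext hΦ.zero
    simp [h0]

end Reeb

section Moser

open Topology Filter

variable {E : Type*} [NormedAddCommGroup E] [NormedSpace ℝ E] [FiniteDimensional ℝ E]

/-- Moser's deformation argument for contact forms with a common Reeb vector field `e`. -/
theorem exists_moser {a b : E → E →L[ℝ] ℝ} {e : E} {K : Set E} (hK : IsCompact K)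
    (ha : ∀ y ∈ K, ∀ᶠ z in 𝓝 y, ContDiffAt ℝ ∞ a z ∧ a z e = 1 ∧ curl a z e = 0)
    (hb : ∀ y ∈ K, ∀ᶠ z in 𝓝 y, ContDiffAt ℝ ∞ b z ∧ b z e = 0 ∧ curl b z e = 0)
    (hb0 : ∀ y ∈ K, b y = 0)
    (hc : ∀ y ∈ K, ∀ t ∈ Icc (0 : ℝ) 1, IsContactAt (fun z => a z + t • b z) y) :
    ∃ φ : E → E, ContDiff ℝ ∞ φ ∧ (∀ y, b y = 0 → φ y = y) ∧
      ∀ y ∈ K, ∀ᶠ z in 𝓝 y, (a (φ z) + b (φ z)).comp (fderiv ℝ φ z) = a z := by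
  -- This is `contactMap` of `a + t b`, with `t` as a variable so that smoothness and invertibility
  -- can be treated jointly in `(t, z)`.
  let C : ℝ × E → E →L[ℝ] E →L[ℝ] ℝ := fun p =>
    curl a p.2 + p.1 • curl b p.2 + (a p.2 + p.1 • b p.2).smulRight (a p.2 + p.1 • b p.2)
  have hCeq : ∀ (t : ℝ) (z : E), ContDiffAt ℝ ∞ a z → ContDiffAt ℝ ∞ b z →
      contactMap (fun z => a z + t • b z) z = C (t, z) := fun t z h1 h2 => by
    have h1' := h1.differentiableAt (by simp)
    have h2' := h2.differentiableAt (by simp)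
    have : curl (fun z => a z + t • b z) z = curl a z + t • curl b z := by
      ext v w
      have h := (h1'.hasFDerivAt.fun_add (h2'.hasFDerivAt.fun_const_smul t)).fderiv
      simp only [curl_apply, h, add_apply, smul_apply,
        smul_eq_mul]
      ring
    rw [contactMap, this]
  have hCs : ∀ p : ℝ × E, ContDiffAt ℝ ∞ a p.2 → ContDiffAt ℝ ∞ b p.2 → ContDiffAt ℝ ∞ C p := by
    intro p h1 h2
    have h1' : ContDiffAt ℝ ∞ (fun p : ℝ × E => a p.2) p := h1.comp p contDiffAt_snd
    have h2' : ContDiffAt ℝ ∞ (fun p : ℝ × E => b p.2) p := h2.comp p contDiffAt_snd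
    have h3 : ContDiffAt ℝ ∞ (fun p : ℝ × E => curl a p.2) p :=
      (contDiffAt_curl h1).comp p contDiffAt_snd
    have h4 : ContDiffAt ℝ ∞ (fun p : ℝ × E => curl b p.2) p :=
      (contDiffAt_curl h2).comp p contDiffAt_snd
    have h5 := h1'.add (contDiffAt_fst.smul h2')
    have h6 : ContDiffAt ℝ ∞ (fun p : ℝ × E => p.1 • curl b p.2) p := by
      have h7 : ContDiffAt ℝ ∞ (fun p : ℝ × E => p.1 • ContinuousLinearMap.id ℝ E) p :=
        contDiffAt_fst.smul contDiffAt_const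
      refine (h4.clm_comp h7).congr_of_eventuallyEq (Eventually.of_forall fun q => ?_)
      ext v w
      simp [-curl_apply]
    exact (h3.add h6).add (h5.smulRight h5)
  let G : Set (ℝ × E) := {p | (ContDiffAt ℝ ∞ a p.2 ∧ a p.2 e = 1 ∧ curl a p.2 e = 0) ∧
    (ContDiffAt ℝ ∞ b p.2 ∧ b p.2 e = 0 ∧ curl b p.2 e = 0) ∧ (C p).IsInvertible}
  have hKG : Icc (0 : ℝ) 1 ×ˢ K ⊆ interior G := by
    rintro ⟨t, y⟩ ⟨ht, hy⟩
    rw [mem_interior_iff_mem_nhds]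
    have hsnd : Tendsto (fun p : ℝ × E => p.2) (𝓝 (t, y)) (𝓝 y) := continuous_snd.tendsto _
    have hay := (ha y hy).self_of_nhds.1
    have hby := (hb y hy).self_of_nhds.1
    have hinv : ∀ᶠ p in 𝓝 (t, y), (C p).IsInvertible := by
      obtain ⟨f, hf⟩ : (C (t, y)).IsInvertible := hCeq t y hay hby ▸ (hc y hy t ht).isInvertible
      have h1 := (hCs (t, y) hay hby).continuousAt.eventually (hf ▸ ContinuousLinearEquiv.nhds f)
      exact h1
    exact (hsnd.eventually (ha y hy)).and ((hsnd.eventually (hb y hy)).and hinv)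
  obtain ⟨χ, hχ, hχc, hχG, hχ1⟩ := exists_contDiff_cutoff (isCompact_Icc.prod hK)
    isOpen_interior hKG
  -- Moser's field. It vanishes wherever `b` does, so such points stay fixed.
  let X : ℝ × E → E := fun p => -((C p).inverse (b p.2))
  have hXs : ContDiff ℝ ∞ fun p => χ p • X p := contDiff_smul_of_tsupport hχ fun p hp => by
    obtain ⟨h1, h2, h3⟩ := interior_subset (hχG hp)
    exact ((h3.contDiffAt_map_inverse.comp p (hCs p h1.1 h2.1)).clm_apply
      (h2.1.comp p contDiffAt_snd)).neg
  -- The time-dependent field becomes autonomous on `ℝ × E`; the constant drift `(1, 0)` in the time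
  -- direction is added when the flow is formed.
  let V₀ : ℝ × E → ℝ × E := fun p => (0, χ p • X p)
  have hV₀ : ContDiff ℝ ∞ V₀ := contDiff_const.prodMk hXs
  have hV₀c : HasCompactSupport V₀ := by
    refine hχc.mono fun p hp => ?_
    rw [Function.mem_support] at hp ⊢
    intro h0
    exact hp (by simp [V₀, h0])
  obtain ⟨L, Φ, hL, hΦ, hs⟩ := exists_flow_const_add ((1, 0) : ℝ × E) hV₀ hV₀c
  set V : ℝ × E → ℝ × E := fun p => (1, 0) + V₀ p
  have hVs : ContDiff ℝ ∞ V := contDiff_const.add hV₀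
  have hfst : ∀ s p, (Φ s p).1 = p.1 + s := fun s p => by
    have hd : ∀ s, HasDerivAt (fun s => (Φ s p).1 - s) 0 s := fun s => by
      have h1 : HasDerivAt (fun s => (Φ s p).1) 1 s := by
        have := (hasFDerivAt_fst (p := Φ s p)).comp_hasDerivAt s (hΦ.hasDerivAt s p)
        exact this.congr_deriv (by simp [V, V₀])
      exact (h1.fun_sub (hasDerivAt_id' s)).congr_deriv (by simp)
    have := is_const_of_deriv_eq_zero (fun s => (hd s).differentiableAt)
      (fun s => (hd s).deriv) s 0
    simp only [hΦ.zero] at this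
    linarith
  have hfix : ∀ y, b y = 0 → ∀ s t, Φ s (t, y) = (t + s, y) := fun y hy s t => by
    have hd : ∀ s : ℝ, HasDerivAt (fun s : ℝ => (t + s, y)) (V (t + s, y)) s := fun s => by
      have h1 : V (t + s, y) = (1, 0) := by simp [V, V₀, X, hy]
      rw [h1]
      exact ((hasDerivAt_id s).const_add t).prodMk (hasDerivAt_const s y)
    exact congrFun (integralCurve_unique hL (fun s => hΦ.hasDerivAt s (t, y)) hd 0
      (by simp [hΦ.zero])) s
  let φ : E → E := fun z => (Φ 1 (0, z)).2
  have hφ : ContDiff ℝ ∞ φ := contDiff_snd.comp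
    (hs.comp (contDiff_const.prodMk (contDiff_const.prodMk contDiff_id)))
  refine ⟨φ, hφ, fun y hy => by simp [φ, hfix y hy], fun y hy => ?_⟩
  -- Points of `K` do not move, and the time interval is compact. Trajectories starting near `K`
  -- therefore stay up to time `1` where the cutoff is invisible.
  have hO : ∀ᶠ z in 𝓝 y, ∀ s ∈ Icc (0 : ℝ) 1, ∀ᶠ p in 𝓝 (Φ s (0, z)), χ p = 1 := by
    refine isCompact_Icc.eventually_forall_of_forall_eventually fun s hs' => ?_
    have h1 : Tendsto (fun q : E × ℝ => Φ q.2 (0, q.1)) (𝓝 (y, s)) (𝓝 (s, y)) := by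
      have h2 : Continuous (fun q : E × ℝ => Φ q.2 (0, q.1)) :=
        hs.continuous.comp (by fun_prop : Continuous fun q : E × ℝ => (q.2, ((0 : ℝ), q.1)))
      have h3 := h2.tendsto (y, s)
      simp only [hfix y (hb0 y hy), zero_add] at h3
      exact h3
    exact h1.eventually (hχ1 (s, y) ⟨hs', hy⟩).eventually_nhds
  filter_upwards [hO] with z hz
  ext w
  let A : ℝ × E → ℝ × E →L[ℝ] ℝ := fun p =>
    (a p.2 + p.1 • b p.2).comp (ContinuousLinearMap.snd ℝ ℝ E)
  have hderiv : ∀ s ∈ Icc (0 : ℝ) 1,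
      HasDerivAt (fun t => A (Φ t (0, z)) (fderiv ℝ (Φ t) (0, z) (0, w))) 0 s := by
    intro s hs'
    set p := Φ s (0, z)
    have hp1 := hz s hs'
    have hpG : p ∈ interior G := hχG (subset_tsupport _ (by
      rw [Function.mem_support, hp1.self_of_nhds]; exact one_ne_zero))
    have hVX : ∀ᶠ q in 𝓝 p, V q = (1, X q) := by
      filter_upwards [hp1] with q hq
      simp [V, V₀, hq]
    have hG : ∀ᶠ q in 𝓝 p, q ∈ G := mem_interior_iff_mem_nhds.1 hpG
    have hCX : ∀ q ∈ G, ∀ v, curl a q.2 (X q) v + q.1 * curl b q.2 (X q) v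
        + (a q.2 + q.1 • b q.2) (X q) * (a q.2 + q.1 • b q.2) v = -b q.2 v := fun q hq v => by
      have h1 : C q (X q) = -b q.2 := by
        rw [map_neg, hq.2.2.self_apply_inverse]
      have h2 := DFunLike.congr_fun h1 v
      exact h2
    -- Evaluation of the equation for `X` at the common Reeb vector `e` leaves `a_t(X) = -b(e) = 0`,
    -- where `a_t = a + t b`. The equation then reads `da_t (X, ·) = -b`, with no multiple of `a_t`
    -- left over.
    have haX : ∀ q ∈ G, (a q.2 + q.1 • b q.2) (X q) = 0 := fun q hq => by
      have h1 := hCX q hq e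
      rw [curl_swap, hq.1.2.2, curl_swap b, hq.2.1.2.2] at h1
      simpa [hq.1.2.1, hq.2.1.2.1] using h1
    have hau := (interior_subset hpG).1.1
    have hbu := (interior_subset hpG).2.1.1
    have hA : HasFDerivAt A ((ContinuousLinearMap.compL ℝ (ℝ × E) E ℝ).flip
        (ContinuousLinearMap.snd ℝ ℝ E) ∘L ((fderiv ℝ a p.2).comp (ContinuousLinearMap.snd ℝ ℝ E)
          + (p.1 • (fderiv ℝ b p.2).comp (ContinuousLinearMap.snd ℝ ℝ E)
            + (ContinuousLinearMap.fst ℝ ℝ E).smulRight (b p.2)))) p := by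
      have h1 : HasFDerivAt (fun p : ℝ × E => a p.2) _ p :=
        (hau.differentiableAt (by simp)).hasFDerivAt.comp p hasFDerivAt_snd
      have h2 : HasFDerivAt (fun p : ℝ × E => b p.2) _ p :=
        (hbu.differentiableAt (by simp)).hasFDerivAt.comp p hasFDerivAt_snd
      exact ((ContinuousLinearMap.compL ℝ (ℝ × E) E ℝ).flip
        (ContinuousLinearMap.snd ℝ ℝ E)).hasFDerivAt.comp p (h1.add (hasFDerivAt_fst.smul h2))
    refine (hasDerivAt_flow_pullback hΦ hs (hVs.differentiable (by simp))
      hA.differentiableAt ((0, w) : ℝ × E)).congr_deriv ?_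
    have hu : (fderiv ℝ (Φ s) (0, z) (0, w)).1 = 0 := by
      have h1 : HasFDerivAt (Φ s) (fderiv ℝ (Φ s) (0, z)) (0, z) := by
        have : ContDiff ℝ ∞ (Φ s) := hs.comp (contDiff_const.prodMk contDiff_id)
        exact (this.differentiable (by simp) _).hasFDerivAt
      have h2 : HasFDerivAt (fun q => (Φ s q).1)
          ((ContinuousLinearMap.fst ℝ ℝ E).comp (fderiv ℝ (Φ s) (0, z))) (0, z) := h1.fst
      rw [funext (hfst s)] at h2
      have h3 := DFunLike.congr_fun (h2.unique (hasFDerivAt_fst.add_const s)) ((0 : ℝ), w)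
      exact h3
    set u := fderiv ℝ (Φ s) (0, z) (0, w)
    have hAV : (fun q => A q (V q)) =ᶠ[𝓝 p] fun _ => (0 : ℝ) := by
      filter_upwards [hVX, hG] with q hq hqG
      rw [hq]
      exact haX q hqG
    -- As `u` has no time component, Cartan's formula reduces to `da_t (X, u) + b(u)`, the first
    -- summand from the motion and the second from the explicit dependence on `t`.
    rw [hAV.fderiv_eq, hVX.self_of_nhds, curl_apply, hA.fderiv]
    have h1 := hCX p (interior_subset hpG) u.2
    rw [haX p (interior_subset hpG), curl_apply, curl_apply] at h1
    simp [hu]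
    linarith
  have hconst := constant_of_has_deriv_right_zero
    (fun s hs' => (hderiv s hs').continuousAt.continuousWithinAt)
    (fun s hs' => (hderiv s (Ico_subset_Icc_self hs')).hasDerivWithinAt) 1 (by simp)
  have h0 : Φ 0 = id := funext hΦ.zero
  have h1 : Φ 1 (0, z) = (1, φ z) := Prod.ext (by simp [hfst]) rfl
  have hφd : fderiv ℝ φ z w = (fderiv ℝ (Φ 1) (0, z) (0, w)).2 := by
    have h2 : ContDiff ℝ ∞ (Φ 1) := hs.comp (contDiff_const.prodMk contDiff_id)
    have h3 := ((h2.differentiable (by simp) (0, z)).hasFDerivAt.comp z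
      (hasFDerivAt_prodMk_right (0 : ℝ) z)).snd
    have h4 : HasFDerivAt φ _ z := h3
    rw [h4.fderiv]
    rfl
  simp only [h0, h1, A] at hconst
  simpa [← hφd] using hconst

end Moser

/-! ### The Reeb field and its local flow on a contact manifold. -/

section ReebFlow

open Topology Filter

variable {E : Type*} [NormedAddCommGroup E] [NormedSpace ℝ E] [FiniteDimensional ℝ E]
  {H : Type*} [TopologicalSpace H] {I : ModelWithCorners ℝ E H} [I.Boundaryless]
  {X : Type*} [TopologicalSpace X] [ChartedSpace H X] [IsManifold I ∞ X] {α : OneForm I X}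


theorem IsContactForm.isContactAt_inChart (hα : IsContactForm α) (x₀ : X) {y : E}
    (hy : y ∈ (extChartAt I x₀).target) :
    IsContactAt (α.inChart x₀) y ∧ α.inChart x₀ y ≠ 0 := by
  have hx := (extChartAt I x₀).map_target hy
  obtain ⟨x, hxs, rfl⟩ : ∃ x ∈ (extChartAt I x₀).source, extChartAt I x₀ x = y :=
    ⟨_, hx, (extChartAt I x₀).right_inv hy⟩
  have hsurj := mfderiv_extChartAt_surjective (I := I) hxs
  refine ⟨fun v hv h => ?_, fun h => hα.ne_zero x (ContinuousLinearMap.ext fun v => ?_)⟩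
  · obtain ⟨v, rfl⟩ := hsurj v
    have h0 : v = 0 := hα.nondegenerate x v ((α.inChart_apply_mfderiv hxs v).symm.trans hv)
      fun w hw => (OneForm.extDeriv_eq hα.smooth hxs v w).trans
        (h _ ((α.inChart_apply_mfderiv hxs w).trans hw))
    rw [h0, map_zero]
    rfl
  · have h1 := α.inChart_apply_mfderiv hxs v
    rw [h] at h1
    exact h1.symm

theorem IsContactAt.eq_reebField {a : E → E →L[ℝ] ℝ} {y v : E} (h : IsContactAt a y)
    (hv : a y v = 1) (hw : ∀ w, curl a y v w = 0) : v = reebField a y := by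
  have h1 : contactMap a y v = a y := by
    ext w
    rw [contactMap_apply, hv, hw, zero_add, one_mul]
  rw [reebField, ← h1, h.isInvertible.inverse_apply_eq.2 rfl]

/-- The Reeb vector field of a contact form. -/
def reebVector (α : OneForm I X) (x : X) : TangentSpace I x :=
  let R : E := reebField (α.inChart x) (extChartAt I x x)
  mfderiv 𝓘(ℝ, E) I (extChartAt I x).symm (extChartAt I x x) R

/-- The equations `α(R) = 1` and `dα (R, ·) = 0` do not refer to a chart and determine `R`. The
definition by the chart at `x` therefore agrees with the Reeb field of every other chart. -/
theorem mfderiv_extChartAt_reebVector (hα : IsContactForm α) {x₀ x : X}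
    (hx : x ∈ (extChartAt I x₀).source) :
    mfderiv I 𝓘(ℝ, E) (extChartAt I x₀) x (reebVector α x)
      = reebField (α.inChart x₀) (extChartAt I x₀ x) := by
  have hxx := mem_extChartAt_source (I := I) x
  have hc := hα.isContactAt_inChart x ((extChartAt I x).map_source hxx)
  have h1 : mfderiv I 𝓘(ℝ, E) (extChartAt I x) x (reebVector α x)
      = reebField (α.inChart x) (extChartAt I x x) := by
    have := mfderiv_extChartAt_symm_apply (I := I) x ((extChartAt I x).map_source hxx)
      (reebField (α.inChart x) (extChartAt I x x))
    rw [extChartAt_to_inv] at this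
    exact this
  have h2 : α x (reebVector α x) = 1 :=
    (α.inChart_apply_mfderiv hxx _).symm.trans
      ((congrArg (α.inChart x (extChartAt I x x)) h1).trans (hc.1.apply_reebField hc.2))
  have h3 : ∀ w, α.extDeriv x (reebVector α x) w = 0 := fun w =>
    (OneForm.extDeriv_eq hα.smooth hxx _ w).trans
      ((congrArg (fun v : E => curl (α.inChart x) (extChartAt I x x) v _) h1).trans
        (hc.1.curl_reebField hc.2 _))
  refine (hα.isContactAt_inChart x₀ ((extChartAt I x₀).map_source hx)).1.eq_reebField
    ((α.inChart_apply_mfderiv hx _).trans h2) fun w => ?_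
  obtain ⟨w, rfl⟩ := mfderiv_extChartAt_surjective (I := I) hx w
  exact (OneForm.extDeriv_eq hα.smooth hx _ w).symm.trans (h3 w)

theorem contMDiff_reebVector (hα : IsContactForm α) :
    ContMDiff I I.tangent ∞ (fun x => (⟨x, reebVector α x⟩ : TangentBundle I X)) := fun x₀ => by
  refine (Bundle.contMDiffAt_section (F := E) x₀).2 ?_
  have h1 : ContMDiffAt I 𝓘(ℝ, E) ∞
      (fun x => reebField (α.inChart x₀) (extChartAt I x₀ x)) x₀ := by
    have hy := mem_extChartAt_target (I := I) x₀
    exact (contDiffAt_reebField (hα.smooth.contDiffAt_inChart x₀ hy)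
      (hα.isContactAt_inChart x₀ hy).1).contMDiffAt.comp x₀ contMDiffAt_extChartAt
  refine h1.congr_of_eventuallyEq ?_
  filter_upwards [extChartAt_source_mem_nhds (I := I) x₀] with x hx
  have hx' : x ∈ (chartAt H x₀).source := by simpa using hx
  have h2 := TangentBundle.continuousLinearMapAt_trivializationAt (I := I) (𝕜 := ℝ) hx'
  have h3 := DFunLike.congr_fun h2 (reebVector α x)
  rw [← mfderiv_extChartAt_reebVector hα hx]
  refine Eq.trans ?_ h3
  rw [Bundle.Trivialization.continuousLinearMapAt_apply,
    Bundle.Trivialization.linearMapAt_apply, if_pos]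
  simpa using hx'

/-- The flow of the Reeb vector field, where it is defined. -/
def reebFlow (α : OneForm I X) (t : ℝ) (x : X) : X :=
  open Classical in
  if h : ∃ γ : ℝ → X, γ 0 = x ∧ ∃ ε, |t| < ε ∧ IsMIntegralCurveOn γ (reebVector α) (Ioo (-ε) ε)
  then h.choose t else x

/-- Integral curves in a Hausdorff manifold are unique, so the choice in `reebFlow` does not matter.
The comparison takes place on the smaller of the two intervals, which still contains `t`. -/
theorem reebFlow_eq [T2Space X] (hα : IsContactForm α) {γ : ℝ → X} {ε t : ℝ} (ht : |t| < ε)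
    (hγ : IsMIntegralCurveOn γ (reebVector α) (Ioo (-ε) ε)) : reebFlow α t (γ 0) = γ t := by
  have h : ∃ γ' : ℝ → X, γ' 0 = γ 0 ∧
      ∃ ε, |t| < ε ∧ IsMIntegralCurveOn γ' (reebVector α) (Ioo (-ε) ε) := ⟨γ, rfl, ε, ht, hγ⟩
  rw [reebFlow, dif_pos h]
  obtain ⟨h0, ε', ht', hγ'⟩ := h.choose_spec
  have hmin : |t| < min ε ε' := lt_min ht ht'
  have hpos : 0 < min ε ε' := (abs_nonneg t).trans_lt hmin
  exact isMIntegralCurveOn_Ioo_eqOn_of_contMDiff_boundaryless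
    (t₀ := 0) (a := -min ε ε') (b := min ε ε') ⟨by simpa using hpos, hpos⟩
    ((contMDiff_reebVector hα).of_le (by simp))
    (hγ'.mono (Ioo_subset_Ioo (neg_le_neg (min_le_right _ _)) (min_le_right _ _)))
    (hγ.mono (Ioo_subset_Ioo (neg_le_neg (min_le_left _ _)) (min_le_left _ _)))
    h0 (abs_lt.1 hmin)

/-- In a chart, the Reeb flow is a smooth flow which preserves the contact form. -/
theorem exists_reebFlow_inChart [T2Space X] (hα : IsContactForm α) (x₀ : X) :
    ∃ Φ : ℝ → E → E, ContDiff ℝ ∞ (fun p : ℝ × E => Φ p.1 p.2) ∧ (∀ z, Φ 0 z = z) ∧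
      (∀ᶠ p : ℝ × E in 𝓝 (0, extChartAt I x₀ x₀),
        HasDerivAt (fun s => Φ s p.2) (reebField (α.inChart x₀) (Φ p.1 p.2)) p.1 ∧
        ∀ w, α.inChart x₀ (Φ p.1 p.2) (fderiv ℝ (Φ p.1) p.2 w) = α.inChart x₀ p.2 w) ∧
      ∀ᶠ p : ℝ × X in 𝓝 (0, x₀),
        reebFlow α p.1 p.2 = (extChartAt I x₀).symm (Φ p.1 (extChartAt I x₀ p.2)) := by
  have htgt : ∀ᶠ z in 𝓝 (extChartAt I x₀ x₀), z ∈ (extChartAt I x₀).target :=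
    extChartAt_target_mem_nhds x₀
  obtain ⟨Φ, hs, h0, hΦ⟩ := exists_reebFlow (a := α.inChart x₀)
    (htgt.mono fun z hz => hα.smooth.contDiffAt_inChart x₀ hz)
    (htgt.mono fun z hz => hα.isContactAt_inChart x₀ hz)
  refine ⟨Φ, hs, h0, hΦ, ?_⟩
  have hcont : Tendsto (fun p : ℝ × E => Φ p.1 p.2) (𝓝 (0, extChartAt I x₀ x₀))
      (𝓝 (extChartAt I x₀ x₀)) := by
    simpa [h0] using hs.continuous.tendsto (0, extChartAt I x₀ x₀)
  obtain ⟨ε, hε, hball⟩ := Metric.eventually_nhds_iff_ball.1 (hΦ.and (hcont.eventually htgt))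
  have hκ : ∀ᶠ x in 𝓝 x₀, extChartAt I x₀ x ∈ Metric.ball (extChartAt I x₀ x₀) ε ∧
      x ∈ (extChartAt I x₀).source :=
    ((continuousAt_extChartAt x₀).eventually (Metric.ball_mem_nhds _ hε)).and
      (extChartAt_source_mem_nhds x₀)
  have hev : ∀ᶠ p : ℝ × X in 𝓝 (0, x₀), p.1 ∈ Metric.ball (0 : ℝ) ε ∧
      extChartAt I x₀ p.2 ∈ Metric.ball (extChartAt I x₀ x₀) ε ∧
      p.2 ∈ (extChartAt I x₀).source :=
    (continuous_fst.tendsto (0, x₀)).eventually (Metric.ball_mem_nhds _ hε) |>.and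
      ((continuous_snd.tendsto ((0 : ℝ), x₀)).eventually hκ)
  filter_upwards [hev] with p ⟨hp1, hp2, hp3⟩
  set z := extChartAt I x₀ p.2
  have hγ : IsMIntegralCurveOn (fun s => (extChartAt I x₀).symm (Φ s z)) (reebVector α)
      (Ioo (-ε) ε) := fun s hs' => by
    have hs'' : (s, z) ∈ Metric.ball ((0 : ℝ), extChartAt I x₀ x₀) ε := by
      rw [← ball_prod_same]
      exact ⟨by simpa [Real.ball_eq_Ioo] using hs', hp2⟩
    obtain ⟨⟨hd, -⟩, ht⟩ := hball _ hs''
    have h1 : HasMFDerivAt 𝓘(ℝ, ℝ) I (fun s => (extChartAt I x₀).symm (Φ s z)) s _ :=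
      (mdifferentiableAt_extChartAt_symm ht).hasMFDerivAt.comp s hd.hasFDerivAt.hasMFDerivAt
    refine (h1.congr_mfderiv ?_).hasMFDerivWithinAt
    refine ContinuousLinearMap.ext_ring ?_
    have hsrc := (extChartAt I x₀).map_target ht
    have h2 := mfderiv_symm_extChartAt_apply hsrc (reebVector α _)
    rw [mfderiv_extChartAt_reebVector hα hsrc, (extChartAt I x₀).right_inv ht] at h2
    exact (congrArg (mfderiv 𝓘(ℝ, E) I (extChartAt I x₀).symm (Φ s z)) (one_smul ℝ _)).trans
      (h2.trans (one_smul ℝ _).symm)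
  have := reebFlow_eq hα (t := p.1) (by simpa using hp1) hγ
  simp only [h0, z, (extChartAt I x₀).left_inv hp3] at this
  exact this

end ReebFlow

section Line

theorem hasDerivAt_apply_line {E : Type*} [NormedAddCommGroup E] [NormedSpace ℝ E]
    {a : E → E →L[ℝ] ℝ} {y : E} (h : DifferentiableAt ℝ a y) (V W : E) :
    HasDerivAt (fun t : ℝ => a (y + t • V) W) (fderiv ℝ a y V W) 0 := by
  have h1 : HasFDerivAt (fun z => a z W)
      ((ContinuousLinearMap.apply ℝ ℝ W).comp (fderiv ℝ a y)) y :=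
    (ContinuousLinearMap.apply ℝ ℝ W).hasFDerivAt.comp y h.hasFDerivAt
  exact h1.hasLineDerivAt V

end Line

/-! ### Coordinates on the model space and its contact form. -/

section ModelCharts

open Topology Filter

/-- The model vector space of `Model`. -/
abbrev ModelVec (k : ℕ) : Type :=
  EuclideanSpace ℝ (Fin 3) × (EuclideanSpace ℝ (Fin k) × (EuclideanSpace ℝ (Fin k) →L[ℝ] ℝ))

variable {k : ℕ} {S : Type*} [TopologicalSpace S] [ChartedSpace (EuclideanSpace ℝ (Fin k)) S]
  [IsManifold (𝓡 k) ∞ S]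

/-- The point of `{0} × S` in the model space given by a point of `S`. -/
def zeroPoint (s : S) : Model (k := k) S := (0, ⟨s, 0⟩)

/-- The coordinates of the model space given by the preferred chart of `S` at a point. -/
abbrev modelChart (s₀ : S) : PartialEquiv (Model (k := k) S) (ModelVec k) :=
  extChartAt (modelI k) (zeroPoint s₀)

theorem modelChart_apply_fst (s₀ : S) (m : Model (k := k) S) : (modelChart s₀ m).1 = m.1 := rfl

theorem modelChart_apply_snd_fst (s₀ : S) (m : Model (k := k) S) :
    (modelChart s₀ m).2.1 = extChartAt (𝓡 k) s₀ m.2.1 := rfl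

theorem mem_modelChart_source {s₀ : S} {m : Model (k := k) S} :
    m ∈ (modelChart s₀).source ↔ m.2.1 ∈ (extChartAt (𝓡 k) s₀).source := by
  simp only [modelChart, zeroPoint, FiberBundle.chartedSpace_chartAt, mfld_simps]
  exact ⟨fun h => h.2.1.1, fun h => ⟨mem_univ _, ⟨h, mem_univ _⟩, h⟩⟩

theorem mem_modelChart_target {s₀ : S} {y : ModelVec k} :
    y ∈ (modelChart s₀).target ↔ y.2.1 ∈ (extChartAt (𝓡 k) s₀).target := by
  constructor
  · intro hy
    have h1 := mem_modelChart_source.1 ((modelChart s₀).map_target hy)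
    have h2 := (extChartAt (𝓡 k) s₀).map_source h1
    rw [← modelChart_apply_snd_fst, (modelChart s₀).right_inv hy] at h2
    exact h2
  · intro hy
    have h1 : y.2.1 ∈ (chartAt (EuclideanSpace ℝ (Fin k)) s₀).target := by simpa using hy
    have h2 := (chartAt (EuclideanSpace ℝ (Fin k)) s₀).map_target h1
    simp only [modelChart, zeroPoint, FiberBundle.chartedSpace_chartAt, mfld_simps]
    exact ⟨mem_univ _, ⟨h1, mem_univ _⟩, ⟨h2, mem_univ _⟩, mem_univ _⟩

theorem modelChart_symm_fst {s₀ : S} {y : ModelVec k} (hy : y ∈ (modelChart s₀).target) :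
    ((modelChart s₀).symm y).1 = y.1 := by
  rw [← modelChart_apply_fst s₀, (modelChart s₀).right_inv hy]

theorem modelChart_symm_snd_fst {s₀ : S} {y : ModelVec k} (hy : y ∈ (modelChart s₀).target) :
    ((modelChart s₀).symm y).2.1 = (extChartAt (𝓡 k) s₀).symm y.2.1 := by
  have h1 := mem_modelChart_source.1 ((modelChart s₀).map_target hy)
  rw [← (extChartAt (𝓡 k) s₀).left_inv h1, ← modelChart_apply_snd_fst,
    (modelChart s₀).right_inv hy]

/-- The fibre coordinate is the covector expressed in the chart of `S`. This invariance turns the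
canonical form into `-p dq` in every such chart. -/
theorem modelChart_apply_snd_snd {s₀ : S} {m : Model (k := k) S} (hm : m ∈ (modelChart s₀).source)
    (w : TangentSpace (𝓡 k) m.2.1) :
    (modelChart s₀ m).2.2 (mfderiv (𝓡 k) 𝓘(ℝ, EuclideanSpace ℝ (Fin k)) (extChartAt (𝓡 k) s₀)
      m.2.1 w) = m.2.2 w := by
  have h1 := mem_modelChart_source.1 hm
  have h2 := inCoordinates_covector (I := 𝓡 k) (x₀ := s₀) (by simpa using h1) m.2.2
  have h3 : (modelChart s₀ m).2.2 = m.2.2.comp (mfderiv 𝓘(ℝ, EuclideanSpace ℝ (Fin k)) (𝓡 k)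
    (extChartAt (𝓡 k) s₀).symm (extChartAt (𝓡 k) s₀ m.2.1)) := h2
  rw [h3]
  exact congrArg m.2.2 (mfderiv_symm_extChartAt_apply h1 w)

theorem mfderiv_modelChart_fst {s₀ : S} {m : Model (k := k) S} (hm : m ∈ (modelChart s₀).source)
    (v : TangentSpace (modelI k) m) :
    (mfderiv (modelI k) 𝓘(ℝ, ModelVec k) (modelChart s₀) m v).1 = v.1 := by
  have h1 : MDifferentiableAt (modelI k) 𝓘(ℝ, ModelVec k) (modelChart s₀) m :=
    mdifferentiableAt_extChartAt (by simpa using hm)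
  have h2 : HasMFDerivAt (modelI k) 𝓘(ℝ, EuclideanSpace ℝ (Fin 3)) (fun m => (modelChart s₀ m).1)
      m _ := (hasFDerivAt_fst.hasMFDerivAt).comp m h1.hasMFDerivAt
  have h3 : HasMFDerivAt (modelI k) 𝓘(ℝ, EuclideanSpace ℝ (Fin 3))
    (fun m : Model (k := k) S => m.1) m _ := hasMFDerivAt_fst m
  exact DFunLike.congr_fun (hasMFDerivAt_unique h2 h3) v

theorem mdifferentiableAt_proj (ξ : CotangentBundle (𝓡 k) S) :
    MDifferentiableAt ((𝓡 k).prod 𝓘(ℝ, EuclideanSpace ℝ (Fin k) →L[ℝ] ℝ)) (𝓡 k)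
      (fun η : CotangentBundle (𝓡 k) S => η.1) ξ :=
  (Bundle.contMDiff_proj (n := ∞) (fun x : S => TangentSpace (𝓡 k) x →L[ℝ] ℝ)).mdifferentiableAt
    (by simp)

theorem mfderiv_modelChart_snd_fst {s₀ : S} {m : Model (k := k) S}
    (hm : m ∈ (modelChart s₀).source) (v : TangentSpace (modelI k) m) :
    (mfderiv (modelI k) 𝓘(ℝ, ModelVec k) (modelChart s₀) m v).2.1
      = mfderiv (𝓡 k) 𝓘(ℝ, EuclideanSpace ℝ (Fin k)) (extChartAt (𝓡 k) s₀) m.2.1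
        (mfderiv ((𝓡 k).prod 𝓘(ℝ, EuclideanSpace ℝ (Fin k) →L[ℝ] ℝ)) (𝓡 k)
          (fun η : CotangentBundle (𝓡 k) S => η.1) m.2 v.2) := by
  have h1 : MDifferentiableAt (modelI k) 𝓘(ℝ, ModelVec k) (modelChart s₀) m :=
    mdifferentiableAt_extChartAt (by simpa using hm)
  have h2 : HasMFDerivAt (modelI k) 𝓘(ℝ, EuclideanSpace ℝ (Fin k))
      (fun m => (modelChart s₀ m).2.1) m _ :=
    ((hasFDerivAt_fst.comp _ hasFDerivAt_snd).hasMFDerivAt).comp m h1.hasMFDerivAt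
  have h3 : HasMFDerivAt (modelI k) 𝓘(ℝ, EuclideanSpace ℝ (Fin k))
      (fun m : Model (k := k) S => extChartAt (𝓡 k) s₀ m.2.1) m _ :=
    (mdifferentiableAt_extChartAt (I := 𝓡 k)
      (by simpa using mem_modelChart_source.1 hm)).hasMFDerivAt.comp m
      ((mdifferentiableAt_proj m.2).hasMFDerivAt.comp m (hasMFDerivAt_snd m))
  exact DFunLike.congr_fun (hasMFDerivAt_unique h2 h3) v

/-- The form `dz + (x dy - y dx) / 2 - p dq` on a vector space. -/
def standardForm (k : ℕ) (y : ModelVec k) : ModelVec k →L[ℝ] ℝ :=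
  let dx (i : Fin 3) : EuclideanSpace ℝ (Fin 3) →L[ℝ] ℝ := EuclideanSpace.proj i
  ContinuousLinearMap.coprod (dx 2 + (1 / 2 : ℝ) • (y.1 0 • dx 1 - y.1 1 • dx 0))
    (-(y.2.2.comp (ContinuousLinearMap.fst ℝ (EuclideanSpace ℝ (Fin k)) (EuclideanSpace ℝ (Fin k) →L[ℝ] ℝ))))

theorem standardForm_apply (y V : ModelVec k) :
    standardForm k y V
      = V.1 2 + 1 / 2 * (y.1 0 * V.1 1 - y.1 1 * V.1 0) - y.2.2 V.2.1 := by
  simp [standardForm]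
  ring

theorem modelForm_apply {s₀ : S} {m : Model (k := k) S} (hm : m ∈ (modelChart s₀).source)
    (v : TangentSpace (modelI k) m) :
    modelForm (k := k) S m v = standardForm k (modelChart s₀ m)
      (mfderiv (modelI k) 𝓘(ℝ, ModelVec k) (modelChart s₀) m v) := by
  have h1 : modelForm (k := k) S m v = v.1 2 + 1 / 2 * (m.1 0 * v.1 1 - m.1 1 * v.1 0)
      - m.2.2 (mfderiv ((𝓡 k).prod 𝓘(ℝ, EuclideanSpace ℝ (Fin k) →L[ℝ] ℝ)) (𝓡 k)
          (fun η : CotangentBundle (𝓡 k) S => η.1) m.2 v.2) := by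
    rw [sub_eq_add_neg]
    rfl
  refine h1.trans (Eq.trans ?_ (standardForm_apply _ _).symm)
  rw [mfderiv_modelChart_fst hm]
  refine congrArg₂ (· - ·) rfl ?_
  exact (modelChart_apply_snd_snd hm _).symm.trans
    (congrArg (modelChart s₀ m).2.2 (mfderiv_modelChart_snd_fst hm v).symm)

theorem modelForm_inChart {s₀ : S} {y : ModelVec k} (hy : y ∈ (modelChart s₀).target) :
    (modelForm (k := k) S).inChart (zeroPoint s₀) y = standardForm k y := by
  refine ContinuousLinearMap.ext fun V => ?_
  have h1 := modelForm_apply ((modelChart s₀).map_target hy)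
    (mfderiv 𝓘(ℝ, ModelVec k) (modelI k) (modelChart s₀).symm y V)
  rw [(modelChart s₀).right_inv hy] at h1
  exact h1.trans (congrArg (standardForm k y) (mfderiv_extChartAt_symm_apply _ hy V))

theorem contDiff_standardForm : ContDiff ℝ ∞ (standardForm k) := by
  let dx (i : Fin 3) : EuclideanSpace ℝ (Fin 3) →L[ℝ] ℝ := EuclideanSpace.proj i
  have h : ∀ i, ContDiff ℝ ∞ fun y : ModelVec k => y.1 i := fun i =>
    (dx i).contDiff.comp contDiff_fst
  have h1 : ContDiff ℝ ∞ fun y : ModelVec k =>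
      dx 2 + (1 / 2 : ℝ) • (y.1 0 • dx 1 - y.1 1 • dx 0) := by
    have h0 := h 0
    have h1 := h 1
    fun_prop
  have h2 : ContDiff ℝ ∞ fun y : ModelVec k => -(y.2.2.comp (ContinuousLinearMap.fst ℝ
      (EuclideanSpace ℝ (Fin k)) (EuclideanSpace ℝ (Fin k) →L[ℝ] ℝ))) :=
    ((contDiff_snd.comp contDiff_snd).clm_comp contDiff_const).neg
  have h3 : standardForm k = fun y => (dx 2 + (1 / 2 : ℝ) • (y.1 0 • dx 1 - y.1 1 • dx 0)).comp
      (ContinuousLinearMap.fst ℝ _ _) + (-(y.2.2.comp (ContinuousLinearMap.fst ℝ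
      (EuclideanSpace ℝ (Fin k)) (EuclideanSpace ℝ (Fin k) →L[ℝ] ℝ)))).comp
      (ContinuousLinearMap.snd ℝ _ _) := by
    funext y
    refine ContinuousLinearMap.ext fun V => ?_
    simp [standardForm, dx]
  rw [h3]
  exact (h1.clm_comp contDiff_const).add (h2.clm_comp contDiff_const)

theorem curl_standardForm (y V W : ModelVec k) :
    curl (standardForm k) y V W
      = V.1 0 * W.1 1 - V.1 1 * W.1 0 - V.2.2 W.2.1 + W.2.2 V.2.1 := by
  have hd : ∀ V W : ModelVec k, fderiv ℝ (standardForm k) y V W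
      = 1 / 2 * (V.1 0 * W.1 1 - V.1 1 * W.1 0) - V.2.2 W.2.1 := fun V W => by
    have h2 := hasDerivAt_apply_line ((contDiff_standardForm (k := k)).differentiable (by simp) y) V W
    have h5 : HasDerivAt (fun t : ℝ => standardForm k y W
        + t * (1 / 2 * (V.1 0 * W.1 1 - V.1 1 * W.1 0) - V.2.2 W.2.1))
        (1 / 2 * (V.1 0 * W.1 1 - V.1 1 * W.1 0) - V.2.2 W.2.1) 0 := by
      simpa using ((hasDerivAt_id (0 : ℝ)).mul_const
        (1 / 2 * (V.1 0 * W.1 1 - V.1 1 * W.1 0) - V.2.2 W.2.1)).const_add (standardForm k y W)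
    refine h2.unique (h5.congr_of_eventuallyEq (Eventually.of_forall fun t => ?_))
    simp only [standardForm_apply]
    simp
    ring
  rw [curl_apply, hd, hd]
  ring

end ModelCharts

section SmoothForms

open Topology Filter

variable {E : Type*} [NormedAddCommGroup E] [NormedSpace ℝ E]
  {H : Type*} [TopologicalSpace H] {I : ModelWithCorners ℝ E H} [I.Boundaryless]
  {X : Type*} [TopologicalSpace X] [ChartedSpace H X] [IsManifold I ∞ X]

theorem OneForm.isSmoothAt_of_contDiffAt_inChart {α : OneForm I X} {x₀ : X}
    (h : ContDiffAt ℝ ∞ (α.inChart x₀) (extChartAt I x₀ x₀)) : α.IsSmoothAt x₀ := by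
  refine (Bundle.contMDiffAt_section (F := E →L[ℝ] ℝ) x₀).2 ?_
  have h1 : ContMDiffAt I 𝓘(ℝ, E →L[ℝ] ℝ) ∞
      (fun x => α.inChart x₀ (extChartAt I x₀ x)) x₀ :=
    h.contMDiffAt.comp x₀ contMDiffAt_extChartAt
  refine h1.congr_of_eventuallyEq ?_
  filter_upwards [extChartAt_source_mem_nhds (I := I) x₀] with x hx
  have h3 := inCoordinates_covector (by simpa using hx) (α x)
  refine Eq.trans ?_ (h3.trans ?_)
  · rfl
  · refine ContinuousLinearMap.ext fun w => ?_
    have h4 := α.inChart_apply_mfderiv hx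
      (mfderiv 𝓘(ℝ, E) I (extChartAt I x₀).symm (extChartAt I x₀ x) w)
    have h5 := mfderiv_extChartAt_symm_apply (I := I) x₀ ((extChartAt I x₀).map_source hx) w
    have h6 : ∀ (m : X) (_ : m = x) (T : E →L[ℝ] E) (_ : T = mfderiv I 𝓘(ℝ, E) (extChartAt I x₀) m)
        (v : E), T v = w → mfderiv I 𝓘(ℝ, E) (extChartAt I x₀) x v = w := by
      rintro m rfl T rfl v hv
      exact hv
    exact h4.symm.trans (congrArg (α.inChart x₀ (extChartAt I x₀ x))
      (h6 _ ((extChartAt I x₀).left_inv hx) _ rfl _ h5))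

end SmoothForms

section ModelMaps

open Topology Filter

variable {k : ℕ} {S : Type*} [TopologicalSpace S] [ChartedSpace (EuclideanSpace ℝ (Fin k)) S]
  [IsManifold (𝓡 k) ∞ S]

theorem modelForm_isSmooth : (modelForm (k := k) S).IsSmooth := fun m => by
  refine OneForm.isSmoothAt_of_contDiffAt_inChart ?_
  have h1 : (modelForm (k := k) S).inChart m
      =ᶠ[𝓝 (extChartAt (modelI k) m m)] standardForm k := by
    filter_upwards [extChartAt_target_mem_nhds (I := modelI k) m] with y hy
    -- The preferred chart at `m` depends only on the base point `m.2.1`, so it is by definition the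
    -- chart at the corresponding zero point.
    exact modelForm_inChart (s₀ := m.2.1) hy
  exact contDiff_standardForm.contDiffAt.congr_of_eventuallyEq h1

/-- The inclusion of the plane `z = 0` in `3`-space. -/
def planeIncl : EuclideanSpace ℝ (Fin 2) →L[ℝ] EuclideanSpace ℝ (Fin 3) :=
  (EuclideanSpace.proj 0).smulRight (EuclideanSpace.single 0 1)
    + (EuclideanSpace.proj 1).smulRight (EuclideanSpace.single 1 1)

/-- The projection of `3`-space to the `(x, y)`-plane. -/
def planeProj : EuclideanSpace ℝ (Fin 3) →L[ℝ] EuclideanSpace ℝ (Fin 2) :=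
  (EuclideanSpace.proj 0).smulRight (EuclideanSpace.single 0 1)
    + (EuclideanSpace.proj 1).smulRight (EuclideanSpace.single 1 1)

@[simp] theorem planeIncl_apply_zero (x : EuclideanSpace ℝ (Fin 2)) : planeIncl x 0 = x 0 := by
  simp [planeIncl]

@[simp] theorem planeIncl_apply_one (x : EuclideanSpace ℝ (Fin 2)) : planeIncl x 1 = x 1 := by
  simp [planeIncl]

@[simp] theorem planeIncl_apply_two (x : EuclideanSpace ℝ (Fin 2)) : planeIncl x 2 = 0 := by
  simp [planeIncl]

@[simp] theorem planeProj_apply_zero (X : EuclideanSpace ℝ (Fin 3)) : planeProj X 0 = X 0 := by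
  simp [planeProj]

@[simp] theorem planeProj_apply_one (X : EuclideanSpace ℝ (Fin 3)) : planeProj X 1 = X 1 := by
  simp [planeProj]

@[simp] theorem planeProj_planeIncl (x : EuclideanSpace ℝ (Fin 2)) :
    planeProj (planeIncl x) = x := by
  ext i
  fin_cases i <;> simp

theorem planeIncl_planeProj (X : EuclideanSpace ℝ (Fin 3)) :
    planeIncl (planeProj X) = X - X 2 • EuclideanSpace.single 2 1 := by
  ext i
  fin_cases i <;> simp

/-- The inclusion of the product of the `(x, y)`-plane and the zero section in the model space. -/
def modelIncl (n : EuclideanSpace ℝ (Fin 2) × S) : Model (k := k) S := (planeIncl n.1, ⟨n.2, 0⟩)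

/-- The projection of the model space to the product of the `(x, y)`-plane and `S`. -/
def modelProj (m : Model (k := k) S) : EuclideanSpace ℝ (Fin 2) × S := (planeProj m.1, m.2.1)

@[simp] theorem modelProj_modelIncl (n : EuclideanSpace ℝ (Fin 2) × S) :
    modelProj (modelIncl (k := k) n) = n := by
  simp [modelProj, modelIncl]

theorem modelIncl_zero (s : S) : modelIncl (k := k) (0, s) = zeroPoint s := by
  simp [modelIncl, zeroPoint]

theorem contMDiff_modelIncl :
    ContMDiff ((𝓡 2).prod (𝓡 k)) (modelI k) ∞ (modelIncl (k := k) (S := S)) :=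
  (planeIncl.contDiff.contMDiff.comp contMDiff_fst).prodMk
    ((Bundle.contMDiff_zeroSection ℝ (fun x : S => TangentSpace (𝓡 k) x →L[ℝ] ℝ)).comp
      contMDiff_snd)

theorem contMDiff_modelProj :
    ContMDiff (modelI k) ((𝓡 2).prod (𝓡 k)) ∞ (modelProj (k := k) (S := S)) :=
  (planeProj.contDiff.contMDiff.comp contMDiff_fst).prodMk
    ((Bundle.contMDiff_proj (fun x : S => TangentSpace (𝓡 k) x →L[ℝ] ℝ)).comp contMDiff_snd)

theorem contMDiff_zeroPoint :
    ContMDiff (𝓡 k) (modelI k) ∞ (zeroPoint (k := k) (S := S)) :=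
  contMDiff_const.prodMk (Bundle.contMDiff_zeroSection ℝ (fun x : S => TangentSpace (𝓡 k) x →L[ℝ] ℝ))

theorem modelIncl_mem_source {s₀ : S} {n : EuclideanSpace ℝ (Fin 2) × S} :
    modelIncl (k := k) n ∈ (modelChart s₀).source ↔ n.2 ∈ (extChartAt (𝓡 k) s₀).source :=
  mem_modelChart_source

theorem zeroPoint_mem_source {s₀ s : S} :
    zeroPoint (k := k) s ∈ (modelChart s₀).source ↔ s ∈ (extChartAt (𝓡 k) s₀).source :=
  mem_modelChart_source

theorem modelChart_snd_snd_eq_zero {s₀ : S} {m : Model (k := k) S} (hm : m ∈ (modelChart s₀).source)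
    (h : m.2.2 = 0) : (modelChart s₀ m).2.2 = 0 := by
  refine ContinuousLinearMap.ext fun w => ?_
  obtain ⟨w, rfl⟩ := mfderiv_extChartAt_surjective (I := 𝓡 k) (mem_modelChart_source.1 hm) w
  rw [modelChart_apply_snd_snd hm, h]
  rfl

theorem modelChart_modelIncl {s₀ : S} {n : EuclideanSpace ℝ (Fin 2) × S}
    (hn : n.2 ∈ (extChartAt (𝓡 k) s₀).source) :
    modelChart s₀ (modelIncl (k := k) n) = (planeIncl n.1, (extChartAt (𝓡 k) s₀ n.2, 0)) :=
  Prod.ext rfl (Prod.ext rfl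
    (modelChart_snd_snd_eq_zero (modelIncl_mem_source.2 hn) rfl))

theorem modelChart_zeroPoint {s₀ s : S} (hs : s ∈ (extChartAt (𝓡 k) s₀).source) :
    modelChart s₀ (zeroPoint (k := k) s) = (0, (extChartAt (𝓡 k) s₀ s, 0)) :=
  Prod.ext rfl (Prod.ext rfl
    (modelChart_snd_snd_eq_zero (zeroPoint_mem_source.2 hs) rfl))

theorem mfderiv_modelChart_zeroPoint {s₀ s : S} (hs : s ∈ (extChartAt (𝓡 k) s₀).source)
    (τ : TangentSpace (𝓡 k) s) :
    mfderiv (modelI k) 𝓘(ℝ, ModelVec k) (modelChart s₀) (zeroPoint s)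
      (mfderiv (𝓡 k) (modelI k) (zeroPoint (k := k)) s τ)
      = (0, (mfderiv (𝓡 k) 𝓘(ℝ, EuclideanSpace ℝ (Fin k)) (extChartAt (𝓡 k) s₀) s τ, 0)) := by
  have h1 : MDifferentiableAt (modelI k) 𝓘(ℝ, ModelVec k) (modelChart s₀) (zeroPoint (k := k) s) :=
    mdifferentiableAt_extChartAt (by simpa using zeroPoint_mem_source.2 hs)
  have h2 := h1.hasMFDerivAt.comp s
    ((contMDiff_zeroPoint (k := k) (S := S)).mdifferentiableAt (by simp)).hasMFDerivAt
  have h3 : MDifferentiableAt (𝓡 k) 𝓘(ℝ, EuclideanSpace ℝ (Fin k)) (extChartAt (𝓡 k) s₀) s :=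
    mdifferentiableAt_extChartAt (by simpa using hs)
  let L : EuclideanSpace ℝ (Fin k) →L[ℝ] ModelVec k :=
    (ContinuousLinearMap.inr ℝ _ _).comp (ContinuousLinearMap.inl ℝ _ _)
  have h4 := (L.hasFDerivAt.hasMFDerivAt).comp s h3.hasMFDerivAt
  have h5 : modelChart s₀ ∘ zeroPoint (k := k) =ᶠ[𝓝 s] L ∘ extChartAt (𝓡 k) s₀ := by
    filter_upwards [(isOpen_extChartAt_source (I := 𝓡 k) s₀).mem_nhds hs] with s' hs'
    exact modelChart_zeroPoint hs'
  exact DFunLike.congr_fun (hasMFDerivAt_unique h2 (h4.congr_of_eventuallyEq h5)) τ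

end ModelMaps

/-! ### Gluing along a partition of unity. -/

section Patching

variable {k : ℕ} {S : Type*} [TopologicalSpace S] [ChartedSpace (EuclideanSpace ℝ (Fin k)) S]
  [IsManifold (𝓡 k) ∞ S] [CompactSpace S] [T2Space S]

/-- Induction on smooth functions by adding functions with small supports. -/
theorem patching_induction {P : (S → ℝ) → Prop} (zero : P 0)
    (step : ∀ s₀ : S, ∃ O : Set S, IsOpen O ∧ s₀ ∈ O ∧ ∀ σ ρ : S → ℝ,
      ContMDiff (𝓡 k) 𝓘(ℝ, ℝ) ∞ σ → ContMDiff (𝓡 k) 𝓘(ℝ, ℝ) ∞ ρ → tsupport ρ ⊆ O →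
      P σ → P (σ + ρ)) : P 1 := by
  choose O hO hsO hP using step
  obtain ⟨t, ht⟩ := isCompact_univ.elim_finite_subcover O hO
    (fun s _ => mem_iUnion.2 ⟨s, hsO s⟩)
  obtain ⟨f, hf⟩ := SmoothPartitionOfUnity.exists_isSubordinate (𝓡 k) isClosed_univ
    (fun s : t => O s) (fun s => hO s) (by
      intro s hs
      obtain ⟨s', hs', h⟩ := mem_iUnion₂.1 (ht hs)
      exact mem_iUnion.2 ⟨⟨s', hs'⟩, h⟩)
  -- The partial sums of a finite subordinate partition of unity lead from `0` to `1` in admissible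
  -- steps.
  have key : ∀ u : Finset t, P (∑ i ∈ u, ⇑(f i)) := fun u => by
    classical
    induction u using Finset.induction_on with
    | empty => simpa using zero
    | insert i u hi ih =>
      rw [Finset.sum_insert hi, add_comm]
      refine hP i _ _ ?_ (f i).contMDiff (hf i) ih
      have : (∑ i ∈ u, ⇑(f i)) = fun x => ∑ i ∈ u, f i x := by ext; simp
      rw [this]
      exact contMDiff_finsetSum fun i _ => (f i).contMDiff
  have h1 : (∑ i ∈ Finset.univ, ⇑(f i)) = 1 := by
    ext s
    have := f.sum_eq_one (mem_univ s)
    rw [finsum_eq_sum_of_fintype] at this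
    simpa using this
  rw [← h1]
  exact key _

end Patching

/-! ### Directions dual to a family of vectors under the symplectic form. -/

section NormalDirections

open Topology Filter

variable {Y : Type*} [NormedAddCommGroup Y] [NormedSpace ℝ Y]
  {E : Type*} [NormedAddCommGroup E] [NormedSpace ℝ E] [FiniteDimensional ℝ E]
  {Q : Type*} [NormedAddCommGroup Q] [NormedSpace ℝ Q] [FiniteDimensional ℝ Q]

/-- Along a map `F`, vectors tangent to the contact structure with prescribed symplectic pairings
with a family of vectors which is independent of the Reeb vector field. -/
theorem exists_normal_directions {a : E → E →L[ℝ] ℝ} {F : Y → E} {D : Y → Q →L[ℝ] E} {y₀ : Y}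
    (ha : ∀ᶠ z in 𝓝 (F y₀), ContDiffAt ℝ ∞ a z ∧ IsContactAt a z ∧ a z ≠ 0)
    (hF : ∀ᶠ y in 𝓝 y₀, ContDiffAt ℝ ∞ F y) (hD : ∀ᶠ y in 𝓝 y₀, ContDiffAt ℝ ∞ D y)
    (hinj : Function.Injective fun p : ℝ × Q => p.1 • reebField a (F y₀) + D y₀ p.2) :
    ∃ W : Y → (Q →L[ℝ] ℝ) →L[ℝ] E, ∀ᶠ y in 𝓝 y₀, ContDiffAt ℝ ∞ W y ∧
      ∀ p, a (F y) (W y p) = 0 ∧ ∀ τ, curl a (F y) (W y p) (D y τ) = -p τ := by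
  let A : Y → ℝ × Q →L[ℝ] E := fun y =>
    (ContinuousLinearMap.fst ℝ ℝ Q).smulRight (reebField a (F y))
      + (D y).comp (ContinuousLinearMap.snd ℝ ℝ Q)
  have hA : Function.Injective (A y₀) := fun p q h => hinj h
  obtain ⟨L₁, hL₁⟩ := LinearMap.exists_leftInverse_of_injective (A y₀ : ℝ × Q →ₗ[ℝ] E)
    (LinearMap.ker_eq_bot.2 hA)
  let L₁' : E →L[ℝ] ℝ × Q := LinearMap.toContinuousLinearMap L₁
  let B : Y → ℝ × Q →L[ℝ] ℝ × Q := fun y => L₁'.comp (A y)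
  have hB₀ : B y₀ = ContinuousLinearMap.id ℝ (ℝ × Q) :=
    ContinuousLinearMap.ext fun p => DFunLike.congr_fun hL₁ p
  -- The left inverse chosen at `y₀` is corrected by the inverse of `B y`, which makes it a left
  -- inverse of `A y` for nearby `y`. Its second component `L y` kills the Reeb vector and sends `D
  -- y τ` to `τ`.
  let L : Y → E →L[ℝ] Q := fun y =>
    (ContinuousLinearMap.snd ℝ ℝ Q).comp ((B y).inverse.comp L₁')
  -- The vector `W y p` solves `da (W, ·) + a(W) a = -p ∘ L`. Pairing with the Reeb vector gives
  -- `a(W) = 0`, and then pairing with `D y τ` gives `-p τ`.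
  let W : Y → (Q →L[ℝ] ℝ) →L[ℝ] E := fun y =>
    -((contactMap a (F y)).inverse.comp ((ContinuousLinearMap.compL ℝ E Q ℝ).flip (L y)))
  have haF : ∀ᶠ y in 𝓝 y₀, ContDiffAt ℝ ∞ a (F y) ∧ IsContactAt a (F y) ∧ a (F y) ≠ 0 :=
    hF.self_of_nhds.continuousAt.eventually ha
  have hAs : ∀ᶠ y in 𝓝 y₀, ContDiffAt ℝ ∞ A y := by
    filter_upwards [haF, hF, hD] with y h1 h2 h3
    exact (contDiffAt_const.smulRight ((contDiffAt_reebField h1.1 h1.2.1).comp y h2)).add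
      (h3.clm_comp contDiffAt_const)
  have hBs : ∀ᶠ y in 𝓝 y₀, ContDiffAt ℝ ∞ B y := hAs.mono fun y h => contDiffAt_const.clm_comp h
  have hBi : ∀ᶠ y in 𝓝 y₀, (B y).IsInvertible := by
    have h1 : ∀ᶠ T : ℝ × Q →L[ℝ] ℝ × Q in 𝓝 (B y₀), T.IsInvertible := by
      rw [hB₀]
      exact ContinuousLinearEquiv.nhds (ContinuousLinearEquiv.refl ℝ (ℝ × Q))
    exact hBs.self_of_nhds.continuousAt.eventually h1
  refine ⟨W, ?_⟩
  filter_upwards [haF, hF, hBs, hBi] with y h1 h2 h3 h4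
  refine ⟨?_, fun p => ?_⟩
  · have h5 : ContDiffAt ℝ ∞ L y :=
      contDiffAt_const.clm_comp ((h4.contDiffAt_map_inverse.comp y h3).clm_comp contDiffAt_const)
    have h6 : ContDiffAt ℝ ∞ (fun y => (contactMap a (F y)).inverse) y :=
      ContDiffAt.comp (g := fun z => (contactMap a z).inverse) y
        (contDiffAt_contactMap_inverse h1.1 h1.2.1.isInvertible) h2
    let L₂ : (E →L[ℝ] Q) →L[ℝ] (Q →L[ℝ] ℝ) →L[ℝ] E →L[ℝ] ℝ :=
      (ContinuousLinearMap.compL ℝ E Q ℝ).flip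
    have h8 : ContDiff ℝ ∞ L₂ := by fun_prop
    have h7 : ContDiffAt ℝ ∞ (fun y => L₂ (L y)) y := h8.contDiffAt.comp y h5
    exact (h6.clm_comp h7).neg
  · have hT : ∀ w, curl a (F y) (W y p) w + a (F y) (W y p) * a (F y) w = -p (L y w) := fun w => by
      have h5 := contactMap_inverse_apply h1.2.1.isInvertible (p.comp (L y)) w
      have h6 : W y p = -((contactMap a (F y)).inverse (p.comp (L y))) := rfl
      rw [h6, map_neg, map_neg, neg_apply, neg_mul, ← neg_add, h5]
      rfl
    have hL : ∀ q : ℝ × Q, L y (A y q) = q.2 := fun q => by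
      have h5 : (B y).inverse (B y q) = q := h4.inverse_apply_self q
      exact congrArg Prod.snd h5
    have hR : L y (reebField a (F y)) = 0 := by
      have := hL (1, 0)
      simpa [A] using this
    have hDτ : ∀ τ, L y (D y τ) = τ := fun τ => by
      have := hL (0, τ)
      simpa [A] using this
    have hW : a (F y) (W y p) = 0 := by
      have h5 := hT (reebField a (F y))
      rw [hR, curl_swap, h1.2.1.curl_reebField h1.2.2, h1.2.1.apply_reebField h1.2.2] at h5
      simpa using h5
    refine ⟨hW, fun τ => ?_⟩
    have h5 := hT (D y τ)
    rwa [hW, hDτ, zero_mul, add_zero] at h5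

end NormalDirections

/-! ### Pullbacks of forms in charts and the rotation form. -/

section PullbackCharts

open Topology Filter

variable {E : Type*} [NormedAddCommGroup E] [NormedSpace ℝ E]
  {H : Type*} [TopologicalSpace H] {I : ModelWithCorners ℝ E H}
  {X : Type*} [TopologicalSpace X] [ChartedSpace H X]
  {E' : Type*} [NormedAddCommGroup E'] [NormedSpace ℝ E']
  {H' : Type*} [TopologicalSpace H'] {I' : ModelWithCorners ℝ E' H'}
  {Y : Type*} [TopologicalSpace Y] [ChartedSpace H' Y]

/-- The pullback of the exterior derivative of a `1`-form. -/
def OneForm.pullExtDeriv (g : X → Y) (α : OneForm I' Y) (m : X) (v w : TangentSpace I m) : ℝ :=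
  α.extDeriv (g m) (mfderiv I I' g m v) (mfderiv I I' g m w)

theorem OneForm.pull_congr (α : OneForm I' Y) {g g' : X → Y} {m : X} (h : g =ᶠ[𝓝 m] g') :
    α.pull (I := I) g m = α.pull g' m :=
  let a : Y → E' →L[ℝ] ℝ := α
  congrArg₂ (fun (a : E' →L[ℝ] ℝ) (T : E →L[ℝ] E') => a.comp T)
    (congrArg a h.eq_of_nhds) h.mfderiv_eq

theorem OneForm.pullExtDeriv_congr (α : OneForm I' Y) {g g' : X → Y} {m : X}
    (h : g =ᶠ[𝓝 m] g') (v w : TangentSpace I m) :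
    α.pullExtDeriv g m v w = α.pullExtDeriv g' m v w :=
  let a : Y → E' → E' → ℝ := α.extDeriv
  congrArg₂ (fun (a : E' → E' → ℝ) (T : E →L[ℝ] E') => a (T v) (T w))
    (congrArg a h.eq_of_nhds) h.mfderiv_eq

variable [I.Boundaryless] [IsManifold I ∞ X] [I'.Boundaryless] [IsManifold I' ∞ Y]

theorem OneForm.pull_apply_chartRep (α : OneForm I' Y) {g : X → Y} {x₀ m : X} {y₀ : Y}
    (hm : m ∈ (extChartAt I x₀).source) (hgm : g m ∈ (extChartAt I' y₀).source)
    (hg : MDifferentiableAt I I' g m) (v : TangentSpace I m) :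
    α.pull g m v = α.inChart y₀ (chartRep I I' x₀ y₀ g (extChartAt I x₀ m))
      (fderiv ℝ (chartRep I I' x₀ y₀ g) (extChartAt I x₀ m)
        (mfderiv I 𝓘(ℝ, E) (extChartAt I x₀) m v)) := by
  rw [chartRep_extChartAt hm]
  exact (α.inChart_apply_mfderiv hgm _).symm.trans
    (congrArg (α.inChart y₀ (extChartAt I' y₀ (g m))) (fderiv_chartRep hm hgm hg v).symm)

theorem OneForm.pullExtDeriv_chartRep {α : OneForm I' Y} (hα : α.IsSmooth) {g : X → Y}
    {x₀ m : X} {y₀ : Y}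
    (hm : m ∈ (extChartAt I x₀).source) (hgm : g m ∈ (extChartAt I' y₀).source)
    (hg : MDifferentiableAt I I' g m) (v w : TangentSpace I m) :
    α.pullExtDeriv g m v w = curl (α.inChart y₀) (chartRep I I' x₀ y₀ g (extChartAt I x₀ m))
      (fderiv ℝ (chartRep I I' x₀ y₀ g) (extChartAt I x₀ m)
        (mfderiv I 𝓘(ℝ, E) (extChartAt I x₀) m v))
      (fderiv ℝ (chartRep I I' x₀ y₀ g) (extChartAt I x₀ m)
        (mfderiv I 𝓘(ℝ, E) (extChartAt I x₀) m w)) := by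
  rw [chartRep_extChartAt hm]
  exact (OneForm.extDeriv_eq hα hgm _ _).trans
    (congrArg₂ (fun a b : E' => curl (α.inChart y₀) (extChartAt I' y₀ (g m)) a b)
      (fderiv_chartRep hm hgm hg v).symm (fderiv_chartRep hm hgm hg w).symm)

theorem contDiffAt_chartRep {g : X → Y} {x₀ : X} {y₀ : Y} {y : E}
    (hy : y ∈ (extChartAt I x₀).target)
    (hgy : g ((extChartAt I x₀).symm y) ∈ (extChartAt I' y₀).source)
    (hg : ContMDiffAt I I' ∞ g ((extChartAt I x₀).symm y)) :
    ContDiffAt ℝ ∞ (chartRep I I' x₀ y₀ g) y :=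
  ((contMDiffAt_extChartAt' (by simpa using hgy)).comp y
    (hg.comp y (contMDiffAt_extChartAt_symm hy))).contDiffAt

end PullbackCharts

section Rotation

/-- The form `(x dy - y dx) / 2`. -/
def rotationForm (k : ℕ) (y : ModelVec k) : ModelVec k →L[ℝ] ℝ :=
  let dx (i : Fin 3) : EuclideanSpace ℝ (Fin 3) →L[ℝ] ℝ := EuclideanSpace.proj i
  ((1 / 2 : ℝ) • (y.1 0 • dx 1 - y.1 1 • dx 0)).comp (ContinuousLinearMap.fst ℝ _ _)

theorem rotationForm_apply {k : ℕ} (y V : ModelVec k) :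
    rotationForm k y V = 1 / 2 * (y.1 0 * V.1 1 - y.1 1 * V.1 0) := by
  simp [rotationForm]

theorem contDiff_rotationForm {k : ℕ} : ContDiff ℝ ∞ (rotationForm k) := by
  let dx (i : Fin 3) : EuclideanSpace ℝ (Fin 3) →L[ℝ] ℝ := EuclideanSpace.proj i
  have h : ∀ i, ContDiff ℝ ∞ fun y : ModelVec k => y.1 i := fun i =>
    (dx i).contDiff.comp contDiff_fst
  have h1 : ContDiff ℝ ∞ fun y : ModelVec k =>
      (1 / 2 : ℝ) • (y.1 0 • dx 1 - y.1 1 • dx 0) := by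
    have h0 := h 0
    have h1 := h 1
    fun_prop
  exact h1.clm_comp contDiff_const

theorem curl_rotationForm_eq_zero {k : ℕ} (y V : ModelVec k) {W : ModelVec k} (hW : W.1 = 0) :
    curl (rotationForm k) y V W = 0 := by
  have hd := (contDiff_rotationForm (k := k)).differentiable (by simp) y
  have h1 := (hasDerivAt_apply_line hd V W).unique
    ((hasDerivAt_const (0 : ℝ) (0 : ℝ)).congr_of_eventuallyEq
      (Filter.Eventually.of_forall fun t => by simp [rotationForm_apply, hW]))
  have h2 := (hasDerivAt_apply_line hd W V).unique
    ((hasDerivAt_const (0 : ℝ) (rotationForm k y V)).congr_of_eventuallyEq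
      (Filter.Eventually.of_forall fun t => by simp [rotationForm_apply, hW]))
  rw [curl_apply, h1, h2, sub_zero]

end Rotation

/-! ### Transversal extension of the elliptic disk. -/

section Adapted

open Topology Filter

variable {k : ℕ} {S : Type*} [TopologicalSpace S] [ChartedSpace (EuclideanSpace ℝ (Fin k)) S]
  [IsManifold (𝓡 k) ∞ S]
  {E : Type*} [NormedAddCommGroup E] [NormedSpace ℝ E] [FiniteDimensional ℝ E]
  {H : Type*} [TopologicalSpace H] {I : ModelWithCorners ℝ E H}
  {M : Type*} [TopologicalSpace M] [ChartedSpace H M]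

/-- `f` is, near `0 × S`, an immersion of the product of the plane and `S` which pulls back the
form `α` to `(x dy - y dx) / 2`. -/
structure IsEllipticDisk (α : OneForm I M) (f : EuclideanSpace ℝ (Fin 2) × S → M) : Prop where
  smooth : ∀ s : S, ∀ᶠ n in 𝓝 ((0, s) : EuclideanSpace ℝ (Fin 2) × S),
    ContMDiffAt ((𝓡 2).prod (𝓡 k)) I ∞ f n
  form : ∀ s : S, ∀ᶠ n in 𝓝 ((0, s) : EuclideanSpace ℝ (Fin 2) × S),
    ∀ v : TangentSpace ((𝓡 2).prod (𝓡 k)) n,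
      α.pull f n v = 1 / 2 * (n.1 0 * v.1 1 - n.1 1 * v.1 0)
  injective : ∀ s : S, Function.Injective (mfderiv ((𝓡 2).prod (𝓡 k)) I f (0, s))

/-- `G` extends `f` to a neighborhood of the zero section, has the right first derivative and,
up to the factor `σ`, the right symplectic pairings along `S`. -/
structure IsAdapted (α : OneForm I M) (f : EuclideanSpace ℝ (Fin 2) × S → M) (σ : S → ℝ)
    (G : Model (k := k) S → M) : Prop where
  smooth : ∀ s : S, ∀ᶠ m in 𝓝 (zeroPoint (k := k) s), ContMDiffAt (modelI k) I ∞ G m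
  apply_incl : ∀ s : S, ∀ᶠ n in 𝓝 ((0, s) : EuclideanSpace ℝ (Fin 2) × S),
    G (modelIncl n) = f n
  form : ∀ s : S, ∀ᶠ n in 𝓝 ((0, s) : EuclideanSpace ℝ (Fin 2) × S),
    ∀ v : TangentSpace (modelI k) (modelIncl (k := k) n),
      α.pull G (modelIncl n) v = modelForm (k := k) S (modelIncl n) v - v.1 2
  extDeriv : ∀ (s : S) (v : TangentSpace (modelI k) (zeroPoint (k := k) s))
    (τ : TangentSpace (𝓡 k) s),
    α.pullExtDeriv G (zeroPoint s) v (mfderiv (𝓡 k) (modelI k) (zeroPoint (k := k)) s τ)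
      = σ s * (modelForm (k := k) S).extDeriv (zeroPoint s) v
        (mfderiv (𝓡 k) (modelI k) (zeroPoint (k := k)) s τ)

theorem tendsto_modelIncl (s : S) :
    Tendsto (modelIncl (k := k) (S := S)) (𝓝 (0, s)) (𝓝 (zeroPoint s)) := by
  rw [← modelIncl_zero]
  exact contMDiff_modelIncl.continuous.tendsto _

theorem tendsto_modelProj (s : S) :
    Tendsto (modelProj (k := k) (S := S)) (𝓝 (zeroPoint s)) (𝓝 (0, s)) := by
  have : modelProj (k := k) (zeroPoint s) = (0, s) := by simp [← modelIncl_zero]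
  rw [← this]
  exact contMDiff_modelProj.continuous.tendsto _

theorem mfderiv_modelProj_fst (m : Model (k := k) S) (v : TangentSpace (modelI k) m) :
    (mfderiv (modelI k) ((𝓡 2).prod (𝓡 k)) modelProj m v).1 = planeProj v.1 := by
  have h1 := (hasMFDerivAt_fst (I := 𝓡 2) (I' := 𝓡 k) (modelProj m)).comp m
    ((contMDiff_modelProj (k := k) (S := S)).mdifferentiableAt (by simp)).hasMFDerivAt
  have h2 := (planeProj.hasFDerivAt (x := m.1)).hasMFDerivAt.comp m
    (hasMFDerivAt_fst (I := 𝓡 3)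
      (I' := (𝓡 k).prod 𝓘(ℝ, EuclideanSpace ℝ (Fin k) →L[ℝ] ℝ)) m)
  exact DFunLike.congr_fun (hasMFDerivAt_unique h1 h2) v

theorem modelForm_apply' (m : Model (k := k) S) (v : TangentSpace (modelI k) m) :
    modelForm (k := k) S m v = v.1 2 + 1 / 2 * (m.1 0 * v.1 1 - m.1 1 * v.1 0)
      - m.2.2 (mfderiv ((𝓡 k).prod 𝓘(ℝ, EuclideanSpace ℝ (Fin k) →L[ℝ] ℝ)) (𝓡 k)
          (fun η : CotangentBundle (𝓡 k) S => η.1) m.2 v.2) := by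
  rw [sub_eq_add_neg]
  rfl

theorem modelForm_modelIncl (n : EuclideanSpace ℝ (Fin 2) × S)
    (v : TangentSpace (modelI k) (modelIncl (k := k) n)) :
    modelForm (k := k) S (modelIncl n) v
      = v.1 2 + 1 / 2 * (n.1 0 * v.1 1 - n.1 1 * v.1 0) := by
  refine (modelForm_apply' _ v).trans ?_
  have h1 : ∀ w, (modelIncl (k := k) n).2.2 w = 0 := fun w => rfl
  rw [h1]
  simp [modelIncl]

theorem modelForm_extDeriv_zeroPoint {s₀ s : S} (hs : s ∈ (extChartAt (𝓡 k) s₀).source)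
    (v : TangentSpace (modelI k) (zeroPoint (k := k) s)) (τ : TangentSpace (𝓡 k) s) :
    (modelForm (k := k) S).extDeriv (zeroPoint s) v
        (mfderiv (𝓡 k) (modelI k) (zeroPoint (k := k)) s τ)
      = -(mfderiv (modelI k) 𝓘(ℝ, ModelVec k) (modelChart s₀) (zeroPoint s) v).2.2
        (mfderiv (𝓡 k) 𝓘(ℝ, EuclideanSpace ℝ (Fin k)) (extChartAt (𝓡 k) s₀) s τ) := by
  have hz := zeroPoint_mem_source.2 hs
  have h0 := OneForm.extDeriv_eq (modelForm_isSmooth (k := k) (S := S)) hz v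
    (mfderiv (𝓡 k) (modelI k) (zeroPoint (k := k)) s τ)
  have h1 : (modelForm (k := k) S).inChart (zeroPoint s₀)
      =ᶠ[𝓝 (modelChart s₀ (zeroPoint s))] standardForm k := by
    filter_upwards [(isOpen_extChartAt_target (I := modelI k) (zeroPoint s₀)).mem_nhds
      ((modelChart s₀).map_source hz)] with y hy
    exact modelForm_inChart hy
  have key : ∀ V W : ModelVec k, ∀ τ', W = (0, (τ', 0)) →
      curl ((modelForm (k := k) S).inChart (zeroPoint s₀)) (modelChart s₀ (zeroPoint s)) V W
        = -V.2.2 τ' := by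
    rintro V W τ' rfl
    rw [curl_congr h1, curl_standardForm]
    simp
  exact h0.trans (key _ _ _ (mfderiv_modelChart_zeroPoint hs τ))

variable [I.Boundaryless] [IsManifold I ∞ M] {α : OneForm I M}
  {f : EuclideanSpace ℝ (Fin 2) × S → M}

theorem IsEllipticDisk.smooth_comp_modelProj (hf : IsEllipticDisk (k := k) α f) (s : S) :
    ∀ᶠ m in 𝓝 (zeroPoint (k := k) s), ContMDiffAt (modelI k) I ∞ (f ∘ modelProj) m := by
  filter_upwards [(tendsto_modelProj s).eventually (hf.smooth s)] with m hm
  exact hm.comp m contMDiff_modelProj.contMDiffAt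

theorem IsEllipticDisk.form_comp_modelProj (hf : IsEllipticDisk (k := k) α f) (s : S) :
    ∀ᶠ m in 𝓝 (zeroPoint (k := k) s), ∀ v : TangentSpace (modelI k) m,
      α.pull (f ∘ modelProj) m v = 1 / 2 * (m.1 0 * v.1 1 - m.1 1 * v.1 0) := by
  filter_upwards [(tendsto_modelProj s).eventually ((hf.smooth s).and (hf.form s))] with m hm v
  have h1 := mfderiv_comp (I := modelI k) (I' := (𝓡 2).prod (𝓡 k)) (I'' := I) m
    (hm.1.mdifferentiableAt (by simp))
    ((contMDiff_modelProj (k := k) (S := S)).mdifferentiableAt (by simp))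
  have h2 : α.pull (f ∘ modelProj) m v
      = α.pull f (modelProj m) (mfderiv (modelI k) ((𝓡 2).prod (𝓡 k)) modelProj m v) :=
    congrArg (α (f (modelProj m))) (DFunLike.congr_fun h1 v)
  rw [h2, hm.2, mfderiv_modelProj_fst]
  simp [modelProj]

/-- The pullback under `f ∘ modelProj` is the rotation form on a whole neighborhood, so its exterior
derivative is known too. This does not pair with vectors tangent to `S`, which accounts for the
factor `0`. -/
theorem IsEllipticDisk.isAdapted_zero (hα : α.IsSmooth) (hf : IsEllipticDisk (k := k) α f) :
    IsAdapted α f 0 (f ∘ modelProj (k := k)) where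
  smooth := hf.smooth_comp_modelProj
  apply_incl s := Eventually.of_forall fun n => by simp
  form s := by
    filter_upwards [(tendsto_modelIncl s).eventually (hf.form_comp_modelProj s)] with n hn v
    rw [hn, modelForm_modelIncl]
    simp [modelIncl]
  extDeriv s v τ := by
    have hz : zeroPoint (k := k) s ∈ (modelChart s).source := mem_extChartAt_source _
    have hfz : (f ∘ modelProj) (zeroPoint (k := k) s) = f (0, s) := by simp [← modelIncl_zero]
    have hκ : (f ∘ modelProj) (zeroPoint (k := k) s) ∈ (extChartAt I (f (0, s))).source := by
      rw [hfz]
      exact mem_extChartAt_source _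
    have hd := (hf.smooth_comp_modelProj s).self_of_nhds
    have h1 : (fun y => (α.inChart (f (0, s)) (chartRep (modelI k) I (zeroPoint (k := k) s) (f (0, s))
          (f ∘ modelProj) y)).comp (fderiv ℝ (chartRep (modelI k) I (zeroPoint (k := k) s) (f (0, s))
          (f ∘ modelProj)) y)) =ᶠ[𝓝 (modelChart s (zeroPoint s))] rotationForm k := by
      have hsymm := (continuousAt_extChartAt_symm (I := modelI k) (zeroPoint (k := k) s)).tendsto
      rw [extChartAt_to_inv] at hsymm
      filter_upwards [extChartAt_target_mem_nhds (I := modelI k) (zeroPoint (k := k) s),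
        hsymm.eventually ((hf.smooth_comp_modelProj s).and (hf.form_comp_modelProj s)),
        hsymm.eventually (hd.continuousAt.preimage_mem_nhds
          ((isOpen_extChartAt_source (I := I) (f (0, s))).mem_nhds hκ))] with y hy h2 h3
      refine ContinuousLinearMap.ext fun V => ?_
      rw [← α.inChart_pull hy h3 (h2.1.mdifferentiableAt (by simp)), rotationForm_apply]
      have h4 := h2.2 (mfderiv 𝓘(ℝ, ModelVec k) (modelI k) (modelChart s).symm y V)
      have h5 := mfderiv_modelChart_fst ((modelChart s).map_target hy)
        (mfderiv 𝓘(ℝ, ModelVec k) (modelI k) (modelChart s).symm y V)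
      have h6 : V.1 = (mfderiv 𝓘(ℝ, ModelVec k) (modelI k) (modelChart s).symm y V).1 :=
        (congrArg Prod.fst (mfderiv_extChartAt_symm_apply _ hy V).symm).trans h5
      rw [h6, ← modelChart_symm_fst hy]
      exact h4
    have hFs := contDiffAt_chartRep (I := modelI k) (I' := I) (x₀ := zeroPoint (k := k) s)
      (y₀ := f (0, s)) (g := f ∘ modelProj) ((modelChart s).map_source hz)
      (by rwa [(modelChart s).left_inv hz]) (by rwa [(modelChart s).left_inv hz])
    have ha : DifferentiableAt ℝ (α.inChart (f (0, s))) (chartRep (modelI k) I (zeroPoint (k := k) s)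
        (f (0, s)) (f ∘ modelProj) (modelChart s (zeroPoint s))) := by
      rw [chartRep_extChartAt hz]
      exact (hα.contDiffAt_inChart _ ((extChartAt I _).map_source hκ)).differentiableAt (by simp)
    have key : ∀ V W : ModelVec k, W.1 = 0 → curl (α.inChart (f (0, s)))
        (chartRep (modelI k) I (zeroPoint (k := k) s) (f (0, s)) (f ∘ modelProj)
          (modelChart s (zeroPoint s)))
        (fderiv ℝ (chartRep (modelI k) I (zeroPoint (k := k) s) (f (0, s)) (f ∘ modelProj))
          (modelChart s (zeroPoint s)) V)
        (fderiv ℝ (chartRep (modelI k) I (zeroPoint (k := k) s) (f (0, s)) (f ∘ modelProj))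
          (modelChart s (zeroPoint s)) W) = 0 := fun V W hW => by
      rw [← curl_pullback (hFs.of_le (by norm_cast)) ha, curl_congr h1,
        curl_rotationForm_eq_zero _ _ hW]
    rw [OneForm.pullExtDeriv_chartRep hα hz hκ (hd.mdifferentiableAt (by simp)), Pi.zero_apply,
      zero_mul]
    exact key _ _ (congrArg Prod.fst
      (mfderiv_modelChart_zeroPoint (mem_extChartAt_source (I := 𝓡 k) s) τ))

end Adapted

section ChartRepGerms

open Topology Filter

variable {E : Type*} [NormedAddCommGroup E] [NormedSpace ℝ E]
  {H : Type*} [TopologicalSpace H] {I : ModelWithCorners ℝ E H}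
  {X : Type*} [TopologicalSpace X] [ChartedSpace H X]
  {E' : Type*} [NormedAddCommGroup E'] [NormedSpace ℝ E']
  {H' : Type*} [TopologicalSpace H'] {I' : ModelWithCorners ℝ E' H'}
  {Y : Type*} [TopologicalSpace Y] [ChartedSpace H' Y]

theorem tendsto_extChartAt_symm {x₀ m : X} (hm : m ∈ (extChartAt I x₀).source) :
    Tendsto (extChartAt I x₀).symm (𝓝 (extChartAt I x₀ m)) (𝓝 m) := by
  have h := (continuousAt_extChartAt_symm' hm).tendsto
  rwa [(extChartAt I x₀).left_inv hm] at h

theorem tendsto_extChartAt {x₀ m : X} (hm : m ∈ (extChartAt I x₀).source) :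
    Tendsto (extChartAt I x₀) (𝓝 m) (𝓝 (extChartAt I x₀ m)) :=
  continuousAt_extChartAt' hm

variable [I.Boundaryless] [IsManifold I ∞ X] [IsManifold I' ∞ Y]

theorem eventually_mem_target {x₀ m : X} (hm : m ∈ (extChartAt I x₀).source) :
    ∀ᶠ y in 𝓝 (extChartAt I x₀ m), y ∈ (extChartAt I x₀).target :=
  (isOpen_extChartAt_target x₀).mem_nhds ((extChartAt I x₀).map_source hm)

theorem eventually_contDiffAt_chartRep {g : X → Y} {x₀ m : X} {y₀ : Y}
    (hm : m ∈ (extChartAt I x₀).source) (hgm : g m ∈ (extChartAt I' y₀).source)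
    (hg : ∀ᶠ m' in 𝓝 m, ContMDiffAt I I' ∞ g m') :
    ∀ᶠ y in 𝓝 (extChartAt I x₀ m), ContDiffAt ℝ ∞ (chartRep I I' x₀ y₀ g) y := by
  have h1 : ∀ᶠ m' in 𝓝 m, g m' ∈ (extChartAt I' y₀).source :=
    hg.self_of_nhds.continuousAt.eventually ((isOpen_extChartAt_source y₀).mem_nhds hgm)
  filter_upwards [eventually_mem_target hm, (tendsto_extChartAt_symm hm).eventually (hg.and h1)]
    with y hy h2
  exact ((contMDiffAt_extChartAt' (by simpa using h2.2)).comp y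
    (h2.1.comp y (contMDiffAt_extChartAt_symm hy))).contDiffAt

end ChartRepGerms

section AdaptedStep

open Topology Filter

variable {k : ℕ} {S : Type*} [TopologicalSpace S] [ChartedSpace (EuclideanSpace ℝ (Fin k)) S]
  [IsManifold (𝓡 k) ∞ S]
  {E : Type*} [NormedAddCommGroup E] [NormedSpace ℝ E] [FiniteDimensional ℝ E]
  {H : Type*} [TopologicalSpace H] {I : ModelWithCorners ℝ E H} [I.Boundaryless]
  {M : Type*} [TopologicalSpace M] [ChartedSpace H M] [IsManifold I ∞ M] {α : OneForm I M}
  {f : EuclideanSpace ℝ (Fin 2) × S → M}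

theorem modelProj_zeroPoint (s : S) : modelProj (zeroPoint (k := k) s) = (0, s) := by
  simp [← modelIncl_zero]

theorem mfderiv_zeroPoint_apply {G : Model (k := k) S → M} {s : S}
    (hG : MDifferentiableAt (modelI k) I G (zeroPoint s))
    (hf : MDifferentiableAt ((𝓡 2).prod (𝓡 k)) I f (0, s))
    (h : ∀ᶠ s' in 𝓝 s, G (zeroPoint s') = f (0, s')) (τ : TangentSpace (𝓡 k) s) :
    mfderiv (modelI k) I G (zeroPoint s)
        (mfderiv (𝓡 k) (modelI k) (zeroPoint (k := k)) s τ)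
      = mfderiv ((𝓡 2).prod (𝓡 k)) I f (0, s) (0, τ) := by
  have h1 := hG.hasMFDerivAt.comp s
    ((contMDiff_zeroPoint (k := k) (S := S)).mdifferentiableAt (by simp)).hasMFDerivAt
  have h2 : HasMFDerivAt (𝓡 k) ((𝓡 2).prod (𝓡 k))
      (fun s : S => ((0 : EuclideanSpace ℝ (Fin 2)), s)) s _ :=
    (hasMFDerivAt_const (0 : EuclideanSpace ℝ (Fin 2)) s).prodMk (hasMFDerivAt_id s)
  have h3 := (hf.hasMFDerivAt.comp s h2).congr_of_eventuallyEq h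
  exact DFunLike.congr_fun (hasMFDerivAt_unique h1 h3) τ

/-- A map from the model space in the preferred charts at `(0, s₀)` and `f (0, s₀)`. -/
abbrev modelRep (I : ModelWithCorners ℝ E H) (f : EuclideanSpace ℝ (Fin 2) × S → M) (s₀ : S)
    (G : Model (k := k) S → M) : ModelVec k → E :=
  chartRep (modelI k) I (zeroPoint (k := k) s₀) (f (0, s₀)) G

/-- `exists_normal_directions` applies because the Reeb vector is independent of the images of
vectors tangent to `S`: `α` is `1` on the former and `0` on the latter, and `f` has injective
derivative along `0 × S`. -/
theorem IsEllipticDisk.exists_local_directions (hα : IsContactForm α)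
    (hf : IsEllipticDisk (k := k) α f) (s₀ : S) :
    ∃ W : ModelVec k → (EuclideanSpace ℝ (Fin k) →L[ℝ] ℝ) →L[ℝ] E,
      ∀ᶠ y in 𝓝 (modelChart s₀ (zeroPoint (k := k) s₀)), ContDiffAt ℝ ∞ W y ∧ ∀ p,
        α.inChart (f (0, s₀)) (modelRep I f s₀ (f ∘ modelProj) y) (W y p) = 0 ∧
        ∀ τ, curl (α.inChart (f (0, s₀))) (modelRep I f s₀ (f ∘ modelProj) y) (W y p)
          (fderiv ℝ (modelRep I f s₀ (f ∘ modelProj)) y (0, (τ, 0))) = -p τ := by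
  have hz : zeroPoint (k := k) s₀ ∈ (modelChart s₀).source := mem_extChartAt_source _
  have hfz : (f ∘ modelProj) (zeroPoint (k := k) s₀) = f (0, s₀) := by
    simp [modelProj_zeroPoint]
  have hκ : (f ∘ modelProj) (zeroPoint (k := k) s₀) ∈ (extChartAt I (f (0, s₀))).source := by
    rw [hfz]
    exact mem_extChartAt_source _
  have hsm := hf.smooth_comp_modelProj s₀
  have hd := hsm.self_of_nhds.mdifferentiableAt (by simp)
  have hF := eventually_contDiffAt_chartRep (I := modelI k) hz hκ hsm
  have hF₀ : modelRep I f s₀ (f ∘ modelProj) (modelChart s₀ (zeroPoint (k := k) s₀))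
      = extChartAt I (f (0, s₀)) (f (0, s₀)) := by
    rw [← hfz]
    exact (chartRep_extChartAt hz).trans (by rw [hfz])
  let L : EuclideanSpace ℝ (Fin k) →L[ℝ] ModelVec k :=
    (ContinuousLinearMap.inr ℝ _ _).comp (ContinuousLinearMap.inl ℝ _ _)
  refine exists_normal_directions (a := α.inChart (f (0, s₀)))
    (F := modelRep I f s₀ (f ∘ modelProj))
    (D := fun y => (fderiv ℝ (modelRep I f s₀ (f ∘ modelProj)) y).comp L) ?_ hF ?_ ?_
  · rw [hF₀]
    filter_upwards [extChartAt_target_mem_nhds (I := I) (f (0, s₀))] with z hz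
    exact ⟨hα.smooth.contDiffAt_inChart _ hz, hα.isContactAt_inChart _ hz⟩
  · filter_upwards [hF] with y hy
    exact (hy.fderiv_right (by simp)).clm_comp contDiffAt_const
  · have hc := hα.isContactAt_inChart (f (0, s₀)) (mem_extChartAt_target (I := I) (f (0, s₀)))
    have hform := (hf.form_comp_modelProj s₀).self_of_nhds
    have hker : ∀ (t : ℝ) (τ : EuclideanSpace ℝ (Fin k)),
        t • reebField (α.inChart (f (0, s₀)))
          (modelRep I f s₀ (f ∘ modelProj) (modelChart s₀ (zeroPoint (k := k) s₀)))
        + fderiv ℝ (modelRep I f s₀ (f ∘ modelProj)) (modelChart s₀ (zeroPoint (k := k) s₀)) (L τ)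
          = 0 → t = 0 ∧ τ = 0 := by
      intro t τ h
      obtain ⟨τ, rfl⟩ := mfderiv_extChartAt_surjective (I := 𝓡 k)
        (mem_extChartAt_source (I := 𝓡 k) s₀) τ
      let v : TangentSpace (modelI k) (zeroPoint (k := k) s₀) :=
        mfderiv (𝓡 k) (modelI k) (zeroPoint (k := k)) s₀ τ
      have hv : mfderiv (modelI k) 𝓘(ℝ, ModelVec k) (modelChart s₀) (zeroPoint (k := k) s₀) v
          = L (mfderiv (𝓡 k) 𝓘(ℝ, EuclideanSpace ℝ (Fin k)) (extChartAt (𝓡 k) s₀) s₀ τ) :=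
        mfderiv_modelChart_zeroPoint (mem_extChartAt_source (I := 𝓡 k) s₀) τ
      have h1 := hform v
      rw [OneForm.pull_apply_chartRep α hz hκ hd] at h1
      have h2 : α.inChart (f (0, s₀))
          (modelRep I f s₀ (f ∘ modelProj) (modelChart s₀ (zeroPoint (k := k) s₀)))
          (fderiv ℝ (modelRep I f s₀ (f ∘ modelProj)) (modelChart s₀ (zeroPoint (k := k) s₀))
            (L (mfderiv (𝓡 k) 𝓘(ℝ, EuclideanSpace ℝ (Fin k)) (extChartAt (𝓡 k) s₀) s₀ τ))) = 0 := by
        refine Eq.trans ?_ (h1.trans (by simp [zeroPoint]))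
        exact congrArg (fun V : ModelVec k => α.inChart (f (0, s₀))
          (modelRep I f s₀ (f ∘ modelProj) (modelChart s₀ (zeroPoint (k := k) s₀)))
          (fderiv ℝ (modelRep I f s₀ (f ∘ modelProj)) (modelChart s₀ (zeroPoint (k := k) s₀)) V))
          hv.symm
      have h3 := congrArg (α.inChart (f (0, s₀))
        (modelRep I f s₀ (f ∘ modelProj) (modelChart s₀ (zeroPoint (k := k) s₀)))) h
      rw [map_add, map_smul, map_zero, h2, hF₀, hc.1.apply_reebField hc.2] at h3
      have ht : t = 0 := by simpa using h3
      rw [ht, zero_smul, zero_add] at h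
      refine ⟨ht, ?_⟩
      have h4 := fderiv_chartRep hz hκ hd v
      have h5 : mfderiv (modelI k) I (f ∘ modelProj) (zeroPoint (k := k) s₀) v = 0 := by
        refine mfderiv_extChartAt_injective hκ (h4.symm.trans ?_)
        rw [map_zero]
        refine Eq.trans ?_ h
        exact congrArg (fun V : ModelVec k => fderiv ℝ (modelRep I f s₀ (f ∘ modelProj))
          (modelChart s₀ (zeroPoint (k := k) s₀)) V) hv
      have h6 : mfderiv (modelI k) I (f ∘ modelProj) (zeroPoint (k := k) s₀) v
          = mfderiv ((𝓡 2).prod (𝓡 k)) I f (0, s₀) (0, τ) :=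
        mfderiv_zeroPoint_apply hd ((hf.smooth s₀).self_of_nhds.mdifferentiableAt (by simp))
          (Eventually.of_forall fun s => by simp [modelProj_zeroPoint]) τ
      have h7 : ((0, τ) : TangentSpace ((𝓡 2).prod (𝓡 k)) ((0, s₀) : EuclideanSpace ℝ (Fin 2) × S))
          = 0 := hf.injective s₀ ((h6.symm.trans h5).trans (map_zero _).symm)
      have h8 : τ = 0 := congrArg Prod.snd h7
      rw [h8]
      exact map_zero _
    intro p q hpq
    have h := hker (p.1 - q.1) (p.2 - q.2) (by
      rw [sub_smul, map_sub, map_sub]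
      rw [← sub_eq_zero] at hpq
      rw [← hpq]
      simp only [ContinuousLinearMap.comp_apply]
      abel)
    exact Prod.ext (sub_eq_zero.1 h.1) (sub_eq_zero.1 h.2)

end AdaptedStep

section Perturbation

variable {E : Type*} [NormedAddCommGroup E] [NormedSpace ℝ E]
  {E' : Type*} [NormedAddCommGroup E'] [NormedSpace ℝ E']
  {P : Type*} [NormedAddCommGroup P] [NormedSpace ℝ P]

/-- Where `π y = 0`, the derivatives of `c` and `W` are multiplied by zero, and only `π` is
differentiated. -/
theorem fderiv_add_smul_clm_apply {h : E → E'} {c : E → ℝ} {W : E → P →L[ℝ] E'} (π : E →L[ℝ] P)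
    {y : E} (hh : DifferentiableAt ℝ h y) (hc : DifferentiableAt ℝ c y)
    (hW : DifferentiableAt ℝ W y) (hy : π y = 0) (V : E) :
    fderiv ℝ (fun z => h z + c z • W z (π z)) y V = fderiv ℝ h y V + c y • W y (π V) := by
  have h1 : HasFDerivAt (fun z => W z (π z)) _ y := hW.hasFDerivAt.clm_apply π.hasFDerivAt
  have h2 := hh.hasFDerivAt.fun_add (hc.hasFDerivAt.fun_smul h1)
  rw [h2.fderiv]
  simp [hy]

end Perturbation

section AdaptedStep

open Topology Filter

variable {k : ℕ} {S : Type*} [TopologicalSpace S] [ChartedSpace (EuclideanSpace ℝ (Fin k)) S]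
  [IsManifold (𝓡 k) ∞ S]
  {E : Type*} [NormedAddCommGroup E] [NormedSpace ℝ E] [FiniteDimensional ℝ E]
  {H : Type*} [TopologicalSpace H] {I : ModelWithCorners ℝ E H} [I.Boundaryless]
  {M : Type*} [TopologicalSpace M] [ChartedSpace H M] [IsManifold I ∞ M] {α : OneForm I M}
  {f : EuclideanSpace ℝ (Fin 2) × S → M}

/-- A perturbation of the map `G` in charts. -/
def perturbedRep (I : ModelWithCorners ℝ E H) (f : EuclideanSpace ℝ (Fin 2) × S → M) (s₀ : S)
    (W : ModelVec k → (EuclideanSpace ℝ (Fin k) →L[ℝ] ℝ) →L[ℝ] E) (ρ : S → ℝ)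
    (G : Model (k := k) S → M) (y : ModelVec k) : E :=
  modelRep I f s₀ G y + ρ ((extChartAt (𝓡 k) s₀).symm y.2.1) • W y y.2.2

theorem contDiffAt_comp_chart_symm {ρ : S → ℝ} (hρ : ContMDiff (𝓡 k) 𝓘(ℝ, ℝ) ∞ ρ) {s₀ : S}
    {y : ModelVec k} (hy : y.2.1 ∈ (extChartAt (𝓡 k) s₀).target) :
    ContDiffAt ℝ ∞ (fun y : ModelVec k => ρ ((extChartAt (𝓡 k) s₀).symm y.2.1)) y := by
  have h1 : ContDiffAt ℝ ∞ (fun q => ρ ((extChartAt (𝓡 k) s₀).symm q)) y.2.1 :=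
    (ContMDiffAt.comp (I' := 𝓡 k) y.2.1 hρ.contMDiffAt
      (contMDiffAt_extChartAt_symm hy)).contDiffAt
  have h2 : ContDiffAt ℝ ∞ (fun y : ModelVec k => y.2.1) y := contDiffAt_fst.comp y contDiffAt_snd
  exact ContDiffAt.comp (g := fun q => ρ ((extChartAt (𝓡 k) s₀).symm q)) y h1 h2

set_option maxHeartbeats 800000 in
-- On `p = 0` the perturbation changes no values, and it adds `ρ W(dp)` to the derivative. The
-- condition on the form survives because `α(W) = 0`. The added term vanishes on vectors tangent to
-- `S`, and its pairing with them is `ρ` times that of `dα₀`, so the pairings add up to the factor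
-- `σ + ρ`.
theorem IsAdapted.perturb (hα : IsContactForm α) (hf : IsEllipticDisk (k := k) α f)
    {σ ρ : S → ℝ} (hρ : ContMDiff (𝓡 k) 𝓘(ℝ, ℝ) ∞ ρ) {G G' : Model (k := k) S → M}
    (hG : IsAdapted α f σ G) {s₀ s : S} (hs : s ∈ (extChartAt (𝓡 k) s₀).source)
    (hfs : f (0, s) ∈ (extChartAt I (f (0, s₀))).source)
    {W : ModelVec k → (EuclideanSpace ℝ (Fin k) →L[ℝ] ℝ) →L[ℝ] E}
    (hW : ∀ᶠ y in 𝓝 (modelChart s₀ (zeroPoint (k := k) s)), ContDiffAt ℝ ∞ W y ∧ ∀ p,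
        α.inChart (f (0, s₀)) (modelRep I f s₀ (f ∘ modelProj) y) (W y p) = 0 ∧
        ∀ τ, curl (α.inChart (f (0, s₀))) (modelRep I f s₀ (f ∘ modelProj) y) (W y p)
          (fderiv ℝ (modelRep I f s₀ (f ∘ modelProj)) y (0, (τ, 0))) = -p τ)
    (hG' : G' =ᶠ[𝓝 (zeroPoint s)] fun m =>
      (extChartAt I (f (0, s₀))).symm (perturbedRep I f s₀ W ρ G (modelChart s₀ m))) :
    (∀ᶠ m in 𝓝 (zeroPoint (k := k) s), ContMDiffAt (modelI k) I ∞ G' m) ∧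
    (∀ᶠ n in 𝓝 ((0, s) : EuclideanSpace ℝ (Fin 2) × S), G' (modelIncl n) = f n) ∧
    (∀ᶠ n in 𝓝 ((0, s) : EuclideanSpace ℝ (Fin 2) × S),
      ∀ v : TangentSpace (modelI k) (modelIncl (k := k) n),
        α.pull G' (modelIncl n) v = modelForm (k := k) S (modelIncl n) v - v.1 2) ∧
    ∀ (v : TangentSpace (modelI k) (zeroPoint (k := k) s)) (τ : TangentSpace (𝓡 k) s),
      α.pullExtDeriv G' (zeroPoint s) v (mfderiv (𝓡 k) (modelI k) (zeroPoint (k := k)) s τ)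
        = (σ + ρ) s * (modelForm (k := k) S).extDeriv (zeroPoint s) v
          (mfderiv (𝓡 k) (modelI k) (zeroPoint (k := k)) s τ) := by
  have hz : zeroPoint (k := k) s ∈ (modelChart s₀).source := zeroPoint_mem_source.2 hs
  have hGz : G (zeroPoint s) = f (0, s) := by
    rw [← modelIncl_zero]
    exact (hG.apply_incl s).self_of_nhds
  have hGκ : G (zeroPoint s) ∈ (extChartAt I (f (0, s₀))).source := by rwa [hGz]
  have hGs := eventually_contDiffAt_chartRep (I := modelI k) hz hGκ (hG.smooth s)
  -- the perturbed map in charts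
  have hPs : ∀ᶠ y in 𝓝 (modelChart s₀ (zeroPoint (k := k) s)),
      ContDiffAt ℝ ∞ (perturbedRep I f s₀ W ρ G) y := by
    filter_upwards [hGs, hW, eventually_mem_target (I := modelI k) hz] with y h1 h2 h3
    exact h1.add ((contDiffAt_comp_chart_symm hρ (mem_modelChart_target.1 h3)).smul
      (h2.1.clm_apply (contDiffAt_snd.comp y contDiffAt_snd)))
  have hP₀ : ∀ y : ModelVec k, y.2.2 = 0 → perturbedRep I f s₀ W ρ G y = modelRep I f s₀ G y :=
    fun y hy => by simp [perturbedRep, hy]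
  have hPz : perturbedRep I f s₀ W ρ G (modelChart s₀ (zeroPoint (k := k) s))
      = extChartAt I (f (0, s₀)) (f (0, s)) := by
    rw [hP₀ _ (modelChart_snd_snd_eq_zero hz rfl), ← hGz]
    exact chartRep_extChartAt hz
  have hPt : ∀ᶠ y in 𝓝 (modelChart s₀ (zeroPoint (k := k) s)),
      perturbedRep I f s₀ W ρ G y ∈ (extChartAt I (f (0, s₀))).target := by
    have h1 := hPs.self_of_nhds.continuousAt
    rw [ContinuousAt, hPz] at h1
    exact h1.eventually (eventually_mem_target hfs)
  have hPd : ∀ᶠ y in 𝓝 (modelChart s₀ (zeroPoint (k := k) s)), y.2.2 = 0 → ∀ V : ModelVec k,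
      fderiv ℝ (perturbedRep I f s₀ W ρ G) y V = fderiv ℝ (modelRep I f s₀ G) y V
        + ρ ((extChartAt (𝓡 k) s₀).symm y.2.1) • W y V.2.2 := by
    filter_upwards [hGs, hW, eventually_mem_target (I := modelI k) hz] with y h1 h2 h3 h4 V
    exact fderiv_add_smul_clm_apply (π := (ContinuousLinearMap.snd ℝ (EuclideanSpace ℝ (Fin k))
      (EuclideanSpace ℝ (Fin k) →L[ℝ] ℝ)).comp (ContinuousLinearMap.snd ℝ (EuclideanSpace ℝ (Fin 3))
      (EuclideanSpace ℝ (Fin k) × (EuclideanSpace ℝ (Fin k) →L[ℝ] ℝ)))) (h1.differentiableAt (by simp))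
      ((contDiffAt_comp_chart_symm hρ (mem_modelChart_target.1 h3)).differentiableAt (by simp))
      (h2.1.differentiableAt (by simp)) h4 V
  have hRep : modelRep I f s₀ G' =ᶠ[𝓝 (modelChart s₀ (zeroPoint (k := k) s))]
      perturbedRep I f s₀ W ρ G := by
    filter_upwards [(tendsto_extChartAt_symm (I := modelI k) hz).eventually hG', hPt,
      eventually_mem_target (I := modelI k) hz] with y h1 h2 h3
    have h4 : G' ((modelChart s₀).symm y)
        = (extChartAt I (f (0, s₀))).symm (perturbedRep I f s₀ W ρ G y) := by
      rw [h1, (modelChart s₀).right_inv h3]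
    simp only [modelRep, chartRep, Function.comp_apply, h4, (extChartAt I (f (0, s₀))).right_inv h2]
  have hG's : ∀ᶠ m in 𝓝 (zeroPoint (k := k) s), ContMDiffAt (modelI k) I ∞ G' m := by
    filter_upwards [hG'.eventually_nhds, (tendsto_extChartAt (I := modelI k) hz).eventually
      (hPs.and hPt), (isOpen_extChartAt_source (I := modelI k) _).mem_nhds hz] with m h1 h2 h3
    have h4 : ContMDiffAt (modelI k) I ∞ (fun m =>
        (extChartAt I (f (0, s₀))).symm (perturbedRep I f s₀ W ρ G (modelChart s₀ m))) m :=
      ContMDiffAt.comp m (contMDiffAt_extChartAt_symm h2.2)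
        (h2.1.contMDiffAt.comp m (contMDiffAt_extChartAt' (by simpa using h3)))
    exact h4.congr_of_eventuallyEq h1
  have hG'z : G' (zeroPoint s) = f (0, s) := by
    rw [hG'.self_of_nhds]
    beta_reduce
    rw [hPz, (extChartAt I (f (0, s₀))).left_inv hfs]
  have hG'κ : ∀ᶠ m in 𝓝 (zeroPoint (k := k) s), G' m ∈ (extChartAt I (f (0, s₀))).source :=
    hG's.self_of_nhds.continuousAt.eventually
      ((isOpen_extChartAt_source (f (0, s₀))).mem_nhds (by rwa [hG'z]))
  have hGκ' : ∀ᶠ m in 𝓝 (zeroPoint (k := k) s), G m ∈ (extChartAt I (f (0, s₀))).source :=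
    (hG.smooth s).self_of_nhds.continuousAt.eventually
      ((isOpen_extChartAt_source (f (0, s₀))).mem_nhds hGκ)
  have hsrc : ∀ᶠ m in 𝓝 (zeroPoint (k := k) s), m ∈ (modelChart s₀).source :=
    (isOpen_extChartAt_source (I := modelI k) _).mem_nhds hz
  have hchart := (tendsto_extChartAt (I := modelI k) hz)
  -- The directions `W` were chosen along `f ∘ modelProj`. They can be used for `G` because both
  -- maps agree on the plane times the zero section.
  have hF : ∀ n : EuclideanSpace ℝ (Fin 2) × S, modelIncl (k := k) n ∈ (modelChart s₀).source →
      G (modelIncl n) = f n → modelRep I f s₀ G (modelChart s₀ (modelIncl n))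
        = modelRep I f s₀ (f ∘ modelProj) (modelChart s₀ (modelIncl n)) := fun n h1 h2 => by
    refine (chartRep_extChartAt h1).trans (Eq.trans ?_ (chartRep_extChartAt h1).symm)
    rw [h2]
    simp
  refine ⟨hG's, ?_, ?_, fun v τ => ?_⟩
  · filter_upwards [(tendsto_modelIncl s).eventually (hG'.and (hsrc.and hGκ')), hG.apply_incl s]
      with n ⟨h1, h2, h3⟩ h4
    rw [h1, hP₀ _ (modelChart_snd_snd_eq_zero h2 rfl)]
    refine (congrArg (extChartAt I (f (0, s₀))).symm (chartRep_extChartAt h2)).trans ?_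
    rw [(extChartAt I (f (0, s₀))).left_inv h3, h4]
  · filter_upwards [(tendsto_modelIncl s).eventually ((hG's.and (hG.smooth s)).and
      ((hsrc.and hGκ').and (hG'κ.and (hchart.eventually (hRep.eventually_nhds.and
        (hW.and hPd)))))), hG.apply_incl s, hG.form s]
      with n ⟨⟨h1, h1'⟩, ⟨h2, h2'⟩, h3, h4, h5, h6⟩ h7 h8 v
    have hp : (modelChart s₀ (modelIncl (k := k) n)).2.2 = 0 :=
      modelChart_snd_snd_eq_zero h2 rfl
    rw [← h8, OneForm.pull_apply_chartRep α h2 h3 (h1.mdifferentiableAt (by simp)),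
      OneForm.pull_apply_chartRep α h2 h2' (h1'.mdifferentiableAt (by simp))]
    have h4' : modelRep I f s₀ G' =ᶠ[𝓝 (modelChart s₀ (modelIncl n))]
      perturbedRep I f s₀ W ρ G := h4
    have key : ∀ V : ModelVec k, α.inChart (f (0, s₀))
        (modelRep I f s₀ G' (modelChart s₀ (modelIncl n)))
        (fderiv ℝ (modelRep I f s₀ G') (modelChart s₀ (modelIncl n)) V)
        = α.inChart (f (0, s₀)) (modelRep I f s₀ G (modelChart s₀ (modelIncl n)))
        (fderiv ℝ (modelRep I f s₀ G) (modelChart s₀ (modelIncl n)) V) := fun V => by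
      rw [h4'.fderiv_eq, h4'.self_of_nhds, h6 hp, hP₀ _ hp, map_add, map_smul, hF n h2 h7,
        (h5.2 V.2.2).1, smul_zero, add_zero]
    exact key _
  · have hp : (modelChart s₀ (zeroPoint (k := k) s)).2.2 = 0 :=
      modelChart_snd_snd_eq_zero hz rfl
    have hd' := hG's.self_of_nhds.mdifferentiableAt (by simp)
    have hd := (hG.smooth s).self_of_nhds.mdifferentiableAt (by simp)
    have hFz : modelRep I f s₀ G (modelChart s₀ (zeroPoint (k := k) s))
        = modelRep I f s₀ (f ∘ modelProj) (modelChart s₀ (zeroPoint (k := k) s)) := by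
      have := hF (0, s) (by rwa [modelIncl_zero]) (by rwa [modelIncl_zero])
      rwa [modelIncl_zero] at this
    have hρs : ρ ((extChartAt (𝓡 k) s₀).symm (modelChart s₀ (zeroPoint (k := k) s)).2.1) = ρ s := by
      rw [modelChart_zeroPoint hs, (extChartAt (𝓡 k) s₀).left_inv hs]
    have hfd : MDifferentiableAt (modelI k) I (f ∘ modelProj) (zeroPoint (k := k) s) :=
      (hf.smooth_comp_modelProj s).self_of_nhds.mdifferentiableAt (by simp)
    have hfd' : MDifferentiableAt ((𝓡 2).prod (𝓡 k)) I f (0, s) :=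
      (hf.smooth s).self_of_nhds.mdifferentiableAt (by simp)
    let T : EuclideanSpace ℝ (Fin k) :=
      mfderiv (𝓡 k) 𝓘(ℝ, EuclideanSpace ℝ (Fin k)) (extChartAt (𝓡 k) s₀) s τ
    have hT : mfderiv (modelI k) 𝓘(ℝ, ModelVec k) (modelChart s₀) (zeroPoint (k := k) s)
        (mfderiv (𝓡 k) (modelI k) (zeroPoint (k := k)) s τ) = (0, (T, 0)) :=
      mfderiv_modelChart_zeroPoint hs τ
    have hGT : fderiv ℝ (modelRep I f s₀ G) (modelChart s₀ (zeroPoint (k := k) s)) (0, (T, 0))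
        = fderiv ℝ (modelRep I f s₀ (f ∘ modelProj)) (modelChart s₀ (zeroPoint (k := k) s))
          (0, (T, 0)) := by
      have hfz : (f ∘ modelProj) (zeroPoint (k := k) s) = f (0, s) := by
        simp [modelProj_zeroPoint]
      have h1 := fderiv_chartRep hz hGκ hd (mfderiv (𝓡 k) (modelI k) (zeroPoint (k := k)) s τ)
      have h2 := fderiv_chartRep (y₀ := f (0, s₀)) hz (by rwa [hfz]) hfd
        (mfderiv (𝓡 k) (modelI k) (zeroPoint (k := k)) s τ)
      have h3 := mfderiv_zeroPoint_apply hd hfd' (by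
        have : ∀ᶠ s' in 𝓝 s, G (modelIncl ((0 : EuclideanSpace ℝ (Fin 2)), s')) = f (0, s') :=
          ((continuous_const.prodMk continuous_id).tendsto s).eventually (hG.apply_incl s)
        simpa only [modelIncl_zero] using this) τ
      have h4 := mfderiv_zeroPoint_apply hfd hfd'
        (Eventually.of_forall fun s => by simp [modelProj_zeroPoint]) τ
      have h5 : mfderiv I 𝓘(ℝ, E) (extChartAt I (f (0, s₀))) (G (zeroPoint s))
            (mfderiv (modelI k) I G (zeroPoint s)
              (mfderiv (𝓡 k) (modelI k) (zeroPoint (k := k)) s τ))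
          = mfderiv I 𝓘(ℝ, E) (extChartAt I (f (0, s₀))) ((f ∘ modelProj) (zeroPoint s))
            (mfderiv (modelI k) I (f ∘ modelProj) (zeroPoint s)
              (mfderiv (𝓡 k) (modelI k) (zeroPoint (k := k)) s τ)) :=
        congrArg₂ (fun (p : M) (v : E) =>
          (mfderiv I 𝓘(ℝ, E) (extChartAt I (f (0, s₀))) p : E →L[ℝ] E) v)
          (hGz.trans hfz.symm) (h3.trans h4.symm)
      have key : ∀ T' : ModelVec k, T' = (0, (T, 0)) →
          fderiv ℝ (modelRep I f s₀ G) (modelChart s₀ (zeroPoint (k := k) s)) T'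
          = fderiv ℝ (modelRep I f s₀ (f ∘ modelProj)) (modelChart s₀ (zeroPoint (k := k) s)) T' →
          fderiv ℝ (modelRep I f s₀ G) (modelChart s₀ (zeroPoint (k := k) s)) (0, (T, 0))
          = fderiv ℝ (modelRep I f s₀ (f ∘ modelProj)) (modelChart s₀ (zeroPoint (k := k) s))
            (0, (T, 0)) := by
        rintro T' rfl h
        exact h
      exact key _ hT (h1.trans (h5.trans h2.symm))
    have h1 := hG.extDeriv s v τ
    rw [OneForm.pullExtDeriv_chartRep hα.smooth hz hGκ hd] at h1
    rw [OneForm.pullExtDeriv_chartRep hα.smooth hz hG'κ.self_of_nhds hd', Pi.add_apply, add_mul,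
      ← h1, modelForm_extDeriv_zeroPoint hs]
    have key : ∀ V T' : ModelVec k, T' = (0, (T, 0)) → curl (α.inChart (f (0, s₀)))
        (modelRep I f s₀ G' (modelChart s₀ (zeroPoint (k := k) s)))
        (fderiv ℝ (modelRep I f s₀ G') (modelChart s₀ (zeroPoint (k := k) s)) V)
        (fderiv ℝ (modelRep I f s₀ G') (modelChart s₀ (zeroPoint (k := k) s)) T')
        = curl (α.inChart (f (0, s₀)))
        (modelRep I f s₀ G (modelChart s₀ (zeroPoint (k := k) s)))
        (fderiv ℝ (modelRep I f s₀ G) (modelChart s₀ (zeroPoint (k := k) s)) V)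
        (fderiv ℝ (modelRep I f s₀ G) (modelChart s₀ (zeroPoint (k := k) s)) T')
        + ρ s * -V.2.2 T := by
      rintro V T' rfl
      rw [hRep.fderiv_eq, hRep.self_of_nhds, hPd.self_of_nhds hp, hPd.self_of_nhds hp, hP₀ _ hp,
        hρs, map_zero, smul_zero, add_zero, map_add, map_smul, add_apply, smul_apply, smul_eq_mul,
        ← (hW.self_of_nhds.2 V.2.2).2, hGT, hFz]
    exact key _ _ hT

end AdaptedStep

section AdaptedExists

open Topology Filter

variable {k : ℕ} {S : Type*} [TopologicalSpace S] [ChartedSpace (EuclideanSpace ℝ (Fin k)) S]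
  [IsManifold (𝓡 k) ∞ S] [CompactSpace S] [T2Space S]
  {E : Type*} [NormedAddCommGroup E] [NormedSpace ℝ E] [FiniteDimensional ℝ E]
  {H : Type*} [TopologicalSpace H] {I : ModelWithCorners ℝ E H} [I.Boundaryless]
  {M : Type*} [TopologicalSpace M] [ChartedSpace H M] [IsManifold I ∞ M] {α : OneForm I M}
  {f : EuclideanSpace ℝ (Fin 2) × S → M}

theorem IsEllipticDisk.exists_isAdapted_one (hα : IsContactForm α)
    (hf : IsEllipticDisk (k := k) α f) : ∃ G : Model (k := k) S → M, IsAdapted α f 1 G := by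
  refine patching_induction (k := k) (P := fun σ => ∃ G : Model (k := k) S → M,
    IsAdapted α f σ G) ⟨_, hf.isAdapted_zero hα.smooth⟩ fun s₀ => ?_
  obtain ⟨W, hW⟩ := hf.exists_local_directions hα s₀
  have hs₀ := mem_extChartAt_source (I := 𝓡 k) s₀
  let O' : Set S := {s | s ∈ (extChartAt (𝓡 k) s₀).source ∧
    f (0, s) ∈ (extChartAt I (f (0, s₀))).source ∧
    ∀ᶠ y in 𝓝 (modelChart s₀ (zeroPoint (k := k) s)), ContDiffAt ℝ ∞ W y ∧ ∀ p,
        α.inChart (f (0, s₀)) (modelRep I f s₀ (f ∘ modelProj) y) (W y p) = 0 ∧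
        ∀ τ, curl (α.inChart (f (0, s₀))) (modelRep I f s₀ (f ∘ modelProj) y) (W y p)
          (fderiv ℝ (modelRep I f s₀ (f ∘ modelProj)) y (0, (τ, 0))) = -p τ}
  have hO' : O' ∈ 𝓝 s₀ := by
    have h1 : ContinuousAt (fun s => f ((0 : EuclideanSpace ℝ (Fin 2)), s)) s₀ :=
      ContinuousAt.comp (g := f) (hf.smooth s₀).self_of_nhds.continuousAt
        (continuous_const.prodMk continuous_id).continuousAt
    have h2 : Tendsto (fun s => modelChart s₀ (zeroPoint (k := k) s)) (𝓝 s₀)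
        (𝓝 (modelChart s₀ (zeroPoint (k := k) s₀))) :=
      (tendsto_extChartAt (I := modelI k) (mem_extChartAt_source _)).comp
        (contMDiff_zeroPoint.continuous.tendsto s₀)
    filter_upwards [extChartAt_source_mem_nhds (I := 𝓡 k) s₀,
      h1.eventually (extChartAt_source_mem_nhds (I := I) (f (0, s₀))),
      h2.eventually hW.eventually_nhds] with s h3 h4 h5
    exact ⟨h3, h4, h5⟩
  refine ⟨interior O', isOpen_interior, mem_interior_iff_mem_nhds.2 hO', ?_⟩
  rintro σ ρ - hρ hsupp ⟨G, hG⟩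
  classical
  -- Where `ρ` vanishes the chart formula reduces to `G` as long as the charts apply. The second
  -- formula is thus valid on a full neighborhood of the support of `ρ`, and off the support the
  -- first one is.
  let G' : Model (k := k) S → M := fun m => if ρ m.2.1 = 0 then G m else
    (extChartAt I (f (0, s₀))).symm (perturbedRep I f s₀ W ρ G (modelChart s₀ m))
  refine ⟨G', ?_⟩
  have hin : ∀ s ∈ tsupport ρ, G' =ᶠ[𝓝 (zeroPoint s)] fun m =>
      (extChartAt I (f (0, s₀))).symm (perturbedRep I f s₀ W ρ G (modelChart s₀ m)) := by
    intro s hs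
    obtain ⟨h1, h2, -⟩ := interior_subset (hsupp hs)
    have hGz : G (zeroPoint s) = f (0, s) := by
      rw [← modelIncl_zero]
      exact (hG.apply_incl s).self_of_nhds
    filter_upwards [(isOpen_extChartAt_source (I := modelI k) _).mem_nhds
      (zeroPoint_mem_source.2 h1), (hG.smooth s).self_of_nhds.continuousAt.eventually
      ((isOpen_extChartAt_source (f (0, s₀))).mem_nhds (by rwa [hGz]))] with m hm hGm
    by_cases h : ρ m.2.1 = 0
    · have h4 : modelRep I f s₀ G (modelChart s₀ m) = extChartAt I (f (0, s₀)) (G m) :=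
        chartRep_extChartAt hm
      simp only [G', h, if_true, perturbedRep, modelChart_apply_snd_fst,
        (extChartAt (𝓡 k) s₀).left_inv (mem_modelChart_source.1 hm), zero_smul, add_zero, h4,
        (extChartAt I (f (0, s₀))).left_inv hGm]
    · simp only [G', h, if_false]
  have hout : ∀ s ∉ tsupport ρ, ρ s = 0 ∧ G' =ᶠ[𝓝 (zeroPoint s)] G := by
    intro s hs
    have h1 := notMem_tsupport_iff_eventuallyEq.1 hs
    refine ⟨h1.self_of_nhds, ?_⟩
    have h2 : Tendsto (fun m : Model (k := k) S => m.2.1) (𝓝 (zeroPoint s)) (𝓝 s) :=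
      (continuous_snd.comp contMDiff_modelProj.continuous).tendsto (zeroPoint (k := k) s)
    filter_upwards [h2.eventually h1] with m hm
    have hm' : ρ m.2.1 = 0 := hm
    simp only [G', hm', if_true]
  have hpert := fun s (hs : s ∈ tsupport ρ) =>
    hG.perturb hα hf hρ (interior_subset (hsupp hs)).1 (interior_subset (hsupp hs)).2.1
      (interior_subset (hsupp hs)).2.2 (hin s hs)
  refine ⟨fun s => ?_, fun s => ?_, fun s => ?_, fun s => ?_⟩
  all_goals by_cases hs : s ∈ tsupport ρ
  · exact (hpert s hs).1
  · filter_upwards [(hout s hs).2.eventually_nhds, hG.smooth s] with m h1 h2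
    exact h2.congr_of_eventuallyEq h1
  · exact (hpert s hs).2.1
  · filter_upwards [(tendsto_modelIncl s).eventually (hout s hs).2, hG.apply_incl s] with n h1 h2
    exact h1.trans h2
  · exact (hpert s hs).2.2.1
  · filter_upwards [(tendsto_modelIncl s).eventually (hout s hs).2.eventually_nhds, hG.form s]
      with n h1 h2 v
    rw [α.pull_congr h1, h2]
  · exact (hpert s hs).2.2.2
  · intro v τ
    rw [α.pullExtDeriv_congr (hout s hs).2, hG.extDeriv, Pi.add_apply, (hout s hs).1, add_zero]

end AdaptedExists

/-! ### Extension by the Reeb flow and the remaining error term. -/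

section ReebExtension

open Topology Filter

/-- The projection to the hyperplane `z = 0`. -/
def flatProj (k : ℕ) : ModelVec k →L[ℝ] ModelVec k :=
  (planeIncl.comp planeProj).prodMap (ContinuousLinearMap.id ℝ _)

/-- The coordinate vector field of the coordinate `z`. -/
def zVec (k : ℕ) : ModelVec k := (EuclideanSpace.single 2 1, 0)

theorem flatProj_zVec (k : ℕ) : flatProj k (zVec k) = 0 := by
  refine Prod.ext ?_ rfl
  ext i
  fin_cases i <;> simp [flatProj, zVec]

theorem flatProj_fst_two {k : ℕ} (y : ModelVec k) : (flatProj k y).1 2 = 0 := by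
  simp [flatProj]

theorem flatProj_eq_self {k : ℕ} {y : ModelVec k} (hy : y.1 2 = 0) : flatProj k y = y := by
  refine Prod.ext ?_ rfl
  have : (flatProj k y).1 = planeIncl (planeProj y.1) := rfl
  rw [this, planeIncl_planeProj, hy]
  simp

theorem standardForm_flatProj {k : ℕ} (y V : ModelVec k) :
    standardForm k (flatProj k y) (flatProj k V) = standardForm k y V - V.1 2 := by
  rw [standardForm_apply, standardForm_apply]
  simp [flatProj]
  ring

/-- The `1`-form `b` on the model vector space does not depend on `z` and has no component in the
direction of `z`. Moreover, it vanishes along the plane times the zero section, and to the right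
order along the zero section. -/
def IsFlatAt {k : ℕ} (b : ModelVec k → ModelVec k →L[ℝ] ℝ) (y : ModelVec k) : Prop :=
  ContDiffAt ℝ ∞ b y ∧ b y (zVec k) = 0 ∧ fderiv ℝ b y (zVec k) = 0 ∧
    (y.1 2 = 0 → y.2.2 = 0 → b y = 0) ∧
    (y.1 = 0 → y.2.2 = 0 → ∀ V τ, curl b y V (0, (τ, 0)) = 0)

/-- A `1`-form on the model space which is flat in charts near the zero section. -/
def IsFlatPerturbation {k : ℕ} {S : Type*} [TopologicalSpace S]
    [ChartedSpace (EuclideanSpace ℝ (Fin k)) S] [IsManifold (𝓡 k) ∞ S]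
    (β : OneForm (modelI k) (Model (k := k) S)) : Prop :=
  ∀ s : S, ∀ᶠ y in 𝓝 (modelChart s (zeroPoint (k := k) s)), IsFlatAt (β.inChart (zeroPoint s)) y

end ReebExtension

section FlowPullback

variable {Y : Type*} [NormedAddCommGroup Y] [NormedSpace ℝ Y]
  {E : Type*} [NormedAddCommGroup E] [NormedSpace ℝ E]

/-- The derivative in the time variable is the vector `R`, on which `a` is `1`; this produces `ℓ`.
The derivative in the space variable preserves `a`. -/
theorem flow_extension_pullback {a : E → E →L[ℝ] ℝ} {Φ : ℝ → E → E}
    (hΦ : ContDiff ℝ ∞ fun p : ℝ × E => Φ p.1 p.2) {ℓ : Y →L[ℝ] ℝ} {π : Y →L[ℝ] Y} {g : Y → E}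
    {y : Y} (hg : DifferentiableAt ℝ g (π y)) {R : E}
    (hd : HasDerivAt (fun t => Φ t (g (π y))) R (ℓ y))
    (hR : a (Φ (ℓ y) (g (π y))) R = 1)
    (ha : ∀ w, a (Φ (ℓ y) (g (π y))) (fderiv ℝ (Φ (ℓ y)) (g (π y)) w) = a (g (π y)) w) (V : Y) :
    a (Φ (ℓ y) (g (π y))) (fderiv ℝ (fun y => Φ (ℓ y) (g (π y))) y V)
      = ℓ V + a (g (π y)) (fderiv ℝ g (π y) (π V)) := by
  let D := fderiv ℝ (fun p : ℝ × E => Φ p.1 p.2) (ℓ y, g (π y))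
  have hD : HasFDerivAt (fun p : ℝ × E => Φ p.1 p.2) D (ℓ y, g (π y)) :=
    (hΦ.differentiable (by simp) _).hasFDerivAt
  have h1 : D (1, 0) = R := by
    have h2 := hD.comp_hasDerivAt (ℓ y)
      ((hasDerivAt_id (ℓ y)).prodMk (hasDerivAt_const (ℓ y) (g (π y))))
    exact h2.unique hd
  have h2 : ∀ w, D (0, w) = fderiv ℝ (Φ (ℓ y)) (g (π y)) w := fun w => by
    have h3 := hD.comp (g (π y)) (hasFDerivAt_prodMk_right (ℓ y) (g (π y)))
    have h4 : HasFDerivAt (Φ (ℓ y)) (D.comp (ContinuousLinearMap.inr ℝ ℝ E)) (g (π y)) := h3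
    rw [h4.fderiv]
    rfl
  have h3 : HasFDerivAt (fun y => Φ (ℓ y) (g (π y)))
      (D.comp (ℓ.prod ((fderiv ℝ g (π y)).comp π))) y :=
    HasFDerivAt.comp (g := fun p : ℝ × E => Φ p.1 p.2) (f := fun y => (ℓ y, g (π y))) y hD
      (ℓ.hasFDerivAt.prodMk (hg.hasFDerivAt.comp y π.hasFDerivAt))
  have h4 : D (ℓ V, fderiv ℝ g (π y) (π V))
      = ℓ V • R + fderiv ℝ (Φ (ℓ y)) (g (π y)) (fderiv ℝ g (π y) (π V)) := by
    rw [← h1, ← h2, ← map_smul, ← map_add]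
    simp
  rw [h3.fderiv]
  refine (congrArg _ h4).trans ?_
  rw [map_add, map_smul, hR, ha, smul_eq_mul, mul_one]

end FlowPullback

section FlatPerturbation

open Topology Filter

theorem curl_sub {V : Type*} [NormedAddCommGroup V] [NormedSpace ℝ V] {a b : V → V →L[ℝ] ℝ} {y : V}
    (ha : DifferentiableAt ℝ a y) (hb : DifferentiableAt ℝ b y) (v w : V) :
    curl (fun y => a y - b y) y v w = curl a y v w - curl b y v w := by
  have h := (ha.hasFDerivAt.fun_sub hb.hasFDerivAt).fderiv
  simp only [curl_apply, h, sub_apply]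
  ring

/-- Applied to `flatProj`: a form pulled back by the linear projection is invariant under
translations along its kernel and vanishes on it. -/
theorem comp_linear_facts {Y : Type*} [NormedAddCommGroup Y] [NormedSpace ℝ Y]
    {δ b : Y → Y →L[ℝ] ℝ} {π : Y →L[ℝ] Y} {y : Y} (h2 : ContDiffAt ℝ ∞ δ (π y))
    (h1 : b =ᶠ[𝓝 y] fun y => (δ (π y)).comp π) :
    ContDiffAt ℝ ∞ b y ∧ (∀ e, π e = 0 → b y e = 0 ∧ fderiv ℝ b y e = 0) ∧
      ∀ V W, curl b y V W = curl δ (π y) (π V) (π W) := by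
  have h8 : HasFDerivAt (fun y => δ (π y)) ((fderiv ℝ δ (π y)).comp π) y :=
    (h2.differentiableAt (by simp)).hasFDerivAt.comp y π.hasFDerivAt
  refine ⟨?_, fun e he => ⟨?_, ?_⟩, fun V W => ?_⟩
  · refine ContDiffAt.congr_of_eventuallyEq ?_ h1
    exact (ContDiffAt.comp (g := δ) y h2 π.contDiff.contDiffAt).clm_comp contDiffAt_const
  · rw [h1.self_of_nhds, ContinuousLinearMap.comp_apply, he, map_zero]
  · rw [h1.fderiv_eq, (h8.clm_comp (hasFDerivAt_const π y)).fderiv]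
    refine ContinuousLinearMap.ext fun V => ?_
    simp [he]
  · have h9 : (fun y => (δ (π y)).comp π) = fun y => (δ (π y)).comp (fderiv ℝ π y) := by
      funext y
      rw [ContinuousLinearMap.fderiv]
    rw [curl_congr h1, h9, curl_pullback π.contDiff.contDiffAt
      (h2.differentiableAt (by simp)), ContinuousLinearMap.fderiv]

theorem curl_pullback_sub {Y E : Type*} [NormedAddCommGroup Y] [NormedSpace ℝ Y]
    [NormedAddCommGroup E] [NormedSpace ℝ E] {a : E → E →L[ℝ] ℝ} {g : Y → E}
    {b : Y → Y →L[ℝ] ℝ} {y : Y} (hg : ContDiffAt ℝ ∞ g y) (ha : DifferentiableAt ℝ a (g y))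
    (hγ : DifferentiableAt ℝ (fun y => (a (g y)).comp (fderiv ℝ g y)) y)
    (hb : DifferentiableAt ℝ b y) (V W : Y) :
    curl (fun y => (a (g y)).comp (fderiv ℝ g y) - b y) y V W
      = curl a (g y) (fderiv ℝ g y V) (fderiv ℝ g y W) - curl b y V W := by
  rw [curl_sub hγ hb, curl_pullback (hg.of_le (by norm_cast)) ha]

/-- Pulling back by `flatProj` removes the dependence on `z` and the component `dz`. On `z = 0` the
projection fixes points, so the first order conditions on `g` along the plane and along `S` carry
over to `b`. -/
theorem flatPerturbation_of_rep {k : ℕ} {E : Type*} [NormedAddCommGroup E] [NormedSpace ℝ E]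
    {a : E → E →L[ℝ] ℝ} {g : ModelVec k → E} {y₀ : ModelVec k} {b : ModelVec k → ModelVec k →L[ℝ] ℝ}
    (hγs : ∀ᶠ y in 𝓝 y₀, ContDiffAt ℝ ∞ (fun y => (a (g y)).comp (fderiv ℝ g y)) y)
    (hg : ∀ᶠ y in 𝓝 y₀, ContDiffAt ℝ ∞ g y ∧ DifferentiableAt ℝ a (g y))
    (hflat : Tendsto (flatProj k) (𝓝 y₀) (𝓝 y₀))
    (hγ : ∀ᶠ y in 𝓝 y₀, y.1 2 = 0 → y.2.2 = 0 →
      ∀ V, a (g y) (fderiv ℝ g y V) = standardForm k y V - V.1 2)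
    (hcurl : ∀ᶠ y in 𝓝 y₀, y.1 = 0 → y.2.2 = 0 →
      ∀ V τ, curl a (g y) (fderiv ℝ g y V) (fderiv ℝ g y (0, (τ, 0)))
        = curl (standardForm k) y V (0, (τ, 0)))
    (hb : b =ᶠ[𝓝 y₀] fun y => ((a (g (flatProj k y))).comp (fderiv ℝ g (flatProj k y))
      - standardForm k (flatProj k y)).comp (flatProj k)) :
    ∀ᶠ y in 𝓝 y₀, ContDiffAt ℝ ∞ b y ∧ b y (zVec k) = 0 ∧ fderiv ℝ b y (zVec k) = 0 ∧
      (y.1 2 = 0 → y.2.2 = 0 → b y = 0) ∧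
      (y.1 = 0 → y.2.2 = 0 → ∀ V τ, curl b y V (0, (τ, 0)) = 0) := by
  let δ : ModelVec k → ModelVec k →L[ℝ] ℝ := fun y =>
    (a (g y)).comp (fderiv ℝ g y) - standardForm k y
  filter_upwards [hb.eventually_nhds, hflat.eventually (hγs.and hg), hγ, hcurl]
    with y h1 ⟨h3, h4, h5⟩ h6 h7
  have h2 : ContDiffAt ℝ ∞ δ (flatProj k y) := h3.sub contDiff_standardForm.contDiffAt
  have h1' : b =ᶠ[𝓝 y] fun y => (δ (flatProj k y)).comp (flatProj k) := h1
  obtain ⟨h8, h9, h10⟩ := comp_linear_facts h2 h1'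
  refine ⟨h8, (h9 _ (flatProj_zVec k)).1, (h9 _ (flatProj_zVec k)).2, fun hy1 hy2 => ?_,
    fun hy1 hy2 V τ => ?_⟩
  · rw [h1'.self_of_nhds]
    refine ContinuousLinearMap.ext fun V => ?_
    simp only [flatProj_eq_self hy1, δ, ContinuousLinearMap.comp_apply, sub_apply]
    rw [h6 hy1 hy2, flatProj_fst_two]
    simp
  · have hy : flatProj k y = y := flatProj_eq_self (by rw [hy1]; rfl)
    have hτ : flatProj k ((0, (τ, 0)) : ModelVec k) = (0, (τ, 0)) := flatProj_eq_self rfl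
    rw [h10, hτ]
    rw [hy] at h3 h4 h5 ⊢
    exact (curl_pullback_sub h4 h5 (h3.differentiableAt (by simp))
      ((contDiff_standardForm (k := k)).differentiable (by simp) y) _ _).trans
      (sub_eq_zero.2 (h7 hy1 hy2 _ _))

end FlatPerturbation

section ReebExtension

open Topology Filter

variable {k : ℕ} {S : Type*} [TopologicalSpace S] [ChartedSpace (EuclideanSpace ℝ (Fin k)) S]
  [IsManifold (𝓡 k) ∞ S]
  {E : Type*} [NormedAddCommGroup E] [NormedSpace ℝ E] [FiniteDimensional ℝ E]
  {H : Type*} [TopologicalSpace H] {I : ModelWithCorners ℝ E H} [I.Boundaryless]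
  {M : Type*} [TopologicalSpace M] [T2Space M] [ChartedSpace H M] [IsManifold I ∞ M]
  {α : OneForm I M} {f : EuclideanSpace ℝ (Fin 2) × S → M}

/-- The projection of the model space to the hypersurface `z = 0`. -/
def modelFlat (m : Model (k := k) S) : Model (k := k) S := (planeIncl (planeProj m.1), m.2)

theorem contMDiff_modelFlat : ContMDiff (modelI k) (modelI k) ∞ (modelFlat (k := k) (S := S)) :=
  ((planeIncl.comp planeProj).contDiff.contMDiff.comp contMDiff_fst).prodMk contMDiff_snd

theorem modelChart_modelFlat (s₀ : S) (m : Model (k := k) S) :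
    modelChart s₀ (modelFlat m) = flatProj k (modelChart s₀ m) := rfl

theorem modelFlat_modelIncl (n : EuclideanSpace ℝ (Fin 2) × S) :
    modelFlat (modelIncl (k := k) n) = modelIncl n := by
  simp [modelFlat, modelIncl]

theorem modelFlat_zeroPoint (s : S) : modelFlat (zeroPoint (k := k) s) = zeroPoint s := by
  rw [← modelIncl_zero, modelFlat_modelIncl]

/-- The map `G` on the hypersurface `z = 0`, extended by the Reeb flow. -/
def reebExtension (α : OneForm I M) (G : Model (k := k) S → M) (m : Model (k := k) S) : M :=
  reebFlow α (m.1 2) (G (modelFlat m))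

theorem IsAdapted.exists_reebExtension_eq (hα : IsContactForm α) {σ : S → ℝ}
    {G : Model (k := k) S → M} (hG : IsAdapted α f σ G) (s : S) :
    ∃ Φ : ℝ → E → E, ContDiff ℝ ∞ (fun p : ℝ × E => Φ p.1 p.2) ∧ (∀ z, Φ 0 z = z) ∧
      (∀ᶠ p : ℝ × E in 𝓝 (0, extChartAt I (f (0, s)) (f (0, s))),
        HasDerivAt (fun t => Φ t p.2) (reebField (α.inChart (f (0, s))) (Φ p.1 p.2)) p.1 ∧
        ∀ w, α.inChart (f (0, s)) (Φ p.1 p.2) (fderiv ℝ (Φ p.1) p.2 w)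
          = α.inChart (f (0, s)) p.2 w) ∧
      ∀ᶠ m in 𝓝 (zeroPoint (k := k) s), reebExtension α G m = (extChartAt I (f (0, s))).symm
        (Φ (m.1 2) (modelRep I f s G (flatProj k (modelChart s m)))) := by
  obtain ⟨Φ, h1, h2, h3, h4⟩ := exists_reebFlow_inChart hα (f (0, s))
  refine ⟨Φ, h1, h2, h3, ?_⟩
  have hGz : G (zeroPoint s) = f (0, s) := by
    rw [← modelIncl_zero]
    exact (hG.apply_incl s).self_of_nhds
  have hflat : Tendsto (modelFlat (k := k) (S := S)) (𝓝 (zeroPoint s)) (𝓝 (zeroPoint s)) := by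
    simpa [modelFlat_zeroPoint] using (contMDiff_modelFlat (k := k) (S := S)).continuous.tendsto
      (zeroPoint s)
  have hz2 : Tendsto (fun m : Model (k := k) S => m.1 2) (𝓝 (zeroPoint s)) (𝓝 0) := by
    have : Continuous fun m : Model (k := k) S => m.1 2 :=
      (EuclideanSpace.proj (𝕜 := ℝ) (2 : Fin 3)).continuous.comp continuous_fst
    simpa [zeroPoint] using this.tendsto (zeroPoint s)
  have hGt : Tendsto G (𝓝 (zeroPoint s)) (𝓝 (f (0, s))) := by
    rw [← hGz]
    exact (hG.smooth s).self_of_nhds.continuousAt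
  filter_upwards [(hz2.prodMk_nhds (hGt.comp hflat)).eventually h4,
    hflat.eventually ((isOpen_extChartAt_source (I := modelI k) _).mem_nhds
      (mem_extChartAt_source (zeroPoint s)))] with m h5 h6
  rw [← modelChart_modelFlat, show modelRep I f s G (modelChart s (modelFlat m))
    = extChartAt I (f (0, s)) (G (modelFlat m)) from chartRep_extChartAt h6]
  exact h5

theorem modelIncl_eq_symm {s₀ : S} {y : ModelVec k} (hy : y ∈ (modelChart s₀).target)
    (h1 : y.1 2 = 0) (h2 : y.2.2 = 0) :
    modelIncl (modelProj ((modelChart s₀).symm y)) = (modelChart s₀).symm y := by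
  have hsrc := mem_modelChart_source.1 ((modelChart s₀).map_target hy)
  refine (modelChart s₀).injOn (modelIncl_mem_source.2 hsrc) ((modelChart s₀).map_target hy) ?_
  rw [modelChart_modelIncl hsrc, (modelChart s₀).right_inv hy]
  refine Prod.ext ?_ (Prod.ext ?_ h2.symm)
  · change planeIncl (planeProj ((modelChart s₀).symm y).1) = y.1
    rw [modelChart_symm_fst hy, planeIncl_planeProj, h1]
    simp
  · change extChartAt (𝓡 k) s₀ ((modelChart s₀).symm y).2.1 = y.2.1
    rw [← modelChart_apply_snd_fst, (modelChart s₀).right_inv hy]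

theorem IsAdapted.rep_form {σ : S → ℝ} {G : Model (k := k) S → M} (hG : IsAdapted α f σ G) (s : S) :
    ∀ᶠ y in 𝓝 (modelChart s (zeroPoint (k := k) s)), y.1 2 = 0 → y.2.2 = 0 → ∀ V,
      α.inChart (f (0, s)) (modelRep I f s G y) (fderiv ℝ (modelRep I f s G) y V)
        = standardForm k y V - V.1 2 := by
  have hz : zeroPoint (k := k) s ∈ (modelChart s).source := mem_extChartAt_source _
  have hGz : G (zeroPoint s) = f (0, s) := by
    rw [← modelIncl_zero]
    exact (hG.apply_incl s).self_of_nhds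
  have hκ : ∀ᶠ m in 𝓝 (zeroPoint (k := k) s), G m ∈ (extChartAt I (f (0, s))).source :=
    (hG.smooth s).self_of_nhds.continuousAt.eventually
      ((isOpen_extChartAt_source _).mem_nhds (by rw [hGz]; exact mem_extChartAt_source _))
  have hsymm := tendsto_extChartAt_symm (I := modelI k) hz
  filter_upwards [eventually_mem_target (I := modelI k) hz,
    hsymm.eventually ((hG.smooth s).and hκ),
    ((tendsto_modelProj s).comp hsymm).eventually (hG.form s)] with y h1 h2 h3 hy1 hy2 V
  have h4 := modelIncl_eq_symm h1 hy1 hy2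
  have h5 : ∀ m : Model (k := k) S, modelIncl (modelProj ((modelChart s).symm y)) = m →
      ∀ v : TangentSpace (modelI k) m, α.pull G m v = modelForm (k := k) S m v - v.1 2 := by
    rintro _ rfl
    exact h3
  have h6 := (modelChart s).map_target h1
  let v : TangentSpace (modelI k) ((modelChart s).symm y) :=
    mfderiv 𝓘(ℝ, ModelVec k) (modelI k) (modelChart s).symm y V
  have h7 : mfderiv (modelI k) 𝓘(ℝ, ModelVec k) (modelChart s) ((modelChart s).symm y) v = V :=
    mfderiv_extChartAt_symm_apply _ h1 V
  have h8 := h5 _ h4 v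
  rw [OneForm.pull_apply_chartRep (x₀ := zeroPoint s) (y₀ := f (0, s)) α h6 h2.2
    (h2.1.mdifferentiableAt (by simp)), modelForm_apply h6, ← mfderiv_modelChart_fst h6,
    (modelChart s).right_inv h1] at h8
  have key : ∀ V' : ModelVec k, V' = V →
      α.inChart (f (0, s)) (modelRep I f s G y) (fderiv ℝ (modelRep I f s G) y V')
        = standardForm k y V' - V'.1 2 →
      α.inChart (f (0, s)) (modelRep I f s G y) (fderiv ℝ (modelRep I f s G) y V)
        = standardForm k y V - V.1 2 := by
    rintro _ rfl h
    exact h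
  exact key _ h7 h8

theorem IsAdapted.rep_curl (hα : IsContactForm α) {G : Model (k := k) S → M}
    (hG : IsAdapted α f 1 G) (s : S) :
    ∀ᶠ y in 𝓝 (modelChart s (zeroPoint (k := k) s)), y.1 = 0 → y.2.2 = 0 → ∀ V τ,
      curl (α.inChart (f (0, s))) (modelRep I f s G y) (fderiv ℝ (modelRep I f s G) y V)
          (fderiv ℝ (modelRep I f s G) y (0, (τ, 0)))
        = curl (standardForm k) y V (0, (τ, 0)) := by
  have hz : zeroPoint (k := k) s ∈ (modelChart s).source := mem_extChartAt_source _
  have hGz : G (zeroPoint s) = f (0, s) := by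
    rw [← modelIncl_zero]
    exact (hG.apply_incl s).self_of_nhds
  have hκ : ∀ᶠ m in 𝓝 (zeroPoint (k := k) s), G m ∈ (extChartAt I (f (0, s))).source :=
    (hG.smooth s).self_of_nhds.continuousAt.eventually
      ((isOpen_extChartAt_source _).mem_nhds (by rw [hGz]; exact mem_extChartAt_source _))
  have hsymm := tendsto_extChartAt_symm (I := modelI k) hz
  filter_upwards [eventually_mem_target (I := modelI k) hz,
    hsymm.eventually ((hG.smooth s).and hκ)] with y h1 h2 hy1 hy2 V τ
  let s' : S := (extChartAt (𝓡 k) s).symm y.2.1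
  have hs' : s' ∈ (extChartAt (𝓡 k) s).source :=
    (extChartAt (𝓡 k) s).map_target (mem_modelChart_target.1 h1)
  have hy : modelChart s (zeroPoint (k := k) s') = y := by
    rw [modelChart_zeroPoint hs', (extChartAt (𝓡 k) s).right_inv (mem_modelChart_target.1 h1)]
    exact Prod.ext hy1.symm (Prod.ext rfl hy2.symm)
  have hz' := zeroPoint_mem_source.2 hs'
  have hy' : (modelChart s).symm y = zeroPoint s' := by
    rw [← hy, (modelChart s).left_inv hz']
  rw [hy'] at h2
  obtain ⟨v, hv⟩ := mfderiv_extChartAt_surjective (I := modelI k) hz' V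
  obtain ⟨τ, rfl⟩ := mfderiv_extChartAt_surjective (I := 𝓡 k) hs' τ
  have hT := mfderiv_modelChart_zeroPoint hs' τ
  have h8 := hG.extDeriv s' v τ
  rw [OneForm.pullExtDeriv_chartRep (x₀ := zeroPoint s) (y₀ := f (0, s)) hα.smooth hz' h2.2
    (h2.1.mdifferentiableAt (by simp)), modelForm_extDeriv_zeroPoint hs', Pi.one_apply,
    one_mul] at h8
  have key : ∀ (V' T T' : ModelVec k) (τ' : EuclideanSpace ℝ (Fin k)), V' = V → T' = T →
      T = (0, (τ', 0)) →
      curl (α.inChart (f (0, s))) (modelRep I f s G (modelChart s (zeroPoint (k := k) s')))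
        (fderiv ℝ (modelRep I f s G) (modelChart s (zeroPoint (k := k) s')) V')
        (fderiv ℝ (modelRep I f s G) (modelChart s (zeroPoint (k := k) s')) T') = -V'.2.2 τ' →
      curl (α.inChart (f (0, s))) (modelRep I f s G y) (fderiv ℝ (modelRep I f s G) y V)
          (fderiv ℝ (modelRep I f s G) y T) = curl (standardForm k) y V T := by
    rintro _ _ _ τ' rfl rfl rfl h
    rw [hy] at h
    rw [h, curl_standardForm]
    simp
  exact key _ _ _ _ hv hT rfl h8

set_option maxHeartbeats 800000 in
-- In charts the extension pulls `α` back to `dz` plus the pullback of `G^*α` by `flatProj`, and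
-- `α₀` is `dz` plus its own pullback by `flatProj`. In the difference only the pullback of `G^*α -
-- α₀` remains.
theorem IsAdapted.reebExtension_isFlatPerturbation (hα : IsContactForm α) {G : Model (k := k) S → M} (hG : IsAdapted α f 1 G) :
    (∀ s : S, ∀ᶠ m in 𝓝 (zeroPoint (k := k) s),
      ContMDiffAt (modelI k) I ∞ (reebExtension α G) m) ∧
    IsFlatPerturbation (k := k)
      (fun m => α.pull (reebExtension α G) m - modelForm (k := k) S m) := by
  rw [IsFlatPerturbation, ← forall_and]
  intro s
  obtain ⟨Φ, hΦ, hΦ0, hΦa, hΦe⟩ := hG.exists_reebExtension_eq hα s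
  have hz : zeroPoint (k := k) s ∈ (modelChart s).source := mem_extChartAt_source _
  have hGz : G (zeroPoint s) = f (0, s) := by
    rw [← modelIncl_zero]
    exact (hG.apply_incl s).self_of_nhds
  have hfs := mem_extChartAt_source (I := I) (f (0, s))
  have hGs := eventually_contDiffAt_chartRep (I := modelI k) hz (by rwa [hGz]) (hG.smooth s)
  have hflatz : flatProj k (modelChart s (zeroPoint s)) = modelChart s (zeroPoint s) := by
    rw [← modelChart_modelFlat, modelFlat_zeroPoint]
  have hflat : Tendsto (flatProj k) (𝓝 (modelChart s (zeroPoint s)))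
      (𝓝 (modelChart s (zeroPoint s))) := by
    have h := (flatProj k).continuous.tendsto (modelChart s (zeroPoint s))
    rwa [hflatz] at h
  let ℓ : ModelVec k →L[ℝ] ℝ := (EuclideanSpace.proj (2 : Fin 3)).comp
    (ContinuousLinearMap.fst ℝ (EuclideanSpace ℝ (Fin 3))
      (EuclideanSpace ℝ (Fin k) × (EuclideanSpace ℝ (Fin k) →L[ℝ] ℝ)))
  let a := α.inChart (f (0, s))
  let g := modelRep I f s G
  let Ψ : ModelVec k → E := fun y => Φ (ℓ y) (g (flatProj k y))
  have hgz : g (modelChart s (zeroPoint s)) = extChartAt I (f (0, s)) (f (0, s)) := by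
    rw [← hGz]
    exact (chartRep_extChartAt hz).trans (by rw [hGz])
  have hℓz : ℓ (modelChart s (zeroPoint (k := k) s)) = 0 := by
    rw [modelChart_zeroPoint (mem_extChartAt_source (I := 𝓡 k) s)]
    simp [ℓ]
  have hΨs : ∀ᶠ y in 𝓝 (modelChart s (zeroPoint (k := k) s)), ContDiffAt ℝ ∞ Ψ y := by
    filter_upwards [hflat.eventually hGs] with y h1
    exact hΦ.contDiffAt.comp y (ℓ.contDiff.contDiffAt.prodMk
      (ContDiffAt.comp (g := g) y h1 (flatProj k).contDiff.contDiffAt))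
  have hΨz : Ψ (modelChart s (zeroPoint s)) = extChartAt I (f (0, s)) (f (0, s)) := by
    simp only [Ψ, hflatz, hℓz, hΦ0, hgz]
  have hΨt : ∀ᶠ y in 𝓝 (modelChart s (zeroPoint (k := k) s)),
      Ψ y ∈ (extChartAt I (f (0, s))).target := by
    have h1 := hΨs.self_of_nhds.continuousAt
    rw [ContinuousAt, hΨz] at h1
    exact h1.eventually (eventually_mem_target hfs)
  have hsm : ∀ᶠ m in 𝓝 (zeroPoint (k := k) s),
      ContMDiffAt (modelI k) I ∞ (reebExtension α G) m := by
    filter_upwards [hΦe.eventually_nhds, (tendsto_extChartAt (I := modelI k) hz).eventually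
      (hΨs.and hΨt), (isOpen_extChartAt_source (I := modelI k) _).mem_nhds hz] with m h1 h2 h3
    have h4 : ContMDiffAt (modelI k) I ∞ (fun m =>
        (extChartAt I (f (0, s))).symm (Ψ (modelChart s m))) m :=
      ContMDiffAt.comp m (contMDiffAt_extChartAt_symm h2.2)
        (h2.1.contMDiffAt.comp m (contMDiffAt_extChartAt' (by simpa using h3)))
    exact h4.congr_of_eventuallyEq h1
  refine ⟨hsm, ?_⟩
  have hsymm := tendsto_extChartAt_symm (I := modelI k) hz
  have htgt := eventually_mem_target (I := modelI k) hz
  have hRep : modelRep I f s (reebExtension α G) =ᶠ[𝓝 (modelChart s (zeroPoint s))] Ψ := by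
    filter_upwards [hsymm.eventually hΦe, hΨt, htgt] with y h1 h2 h3
    have h4 : reebExtension α G ((modelChart s).symm y)
        = (extChartAt I (f (0, s))).symm (Ψ y) := by
      rw [h1, (modelChart s).right_inv h3, modelChart_symm_fst h3]
      rfl
    simp only [modelRep, chartRep, Function.comp_apply, h4, (extChartAt I (f (0, s))).right_inv h2]
  let δ : ModelVec k → ModelVec k →L[ℝ] ℝ := fun y =>
    (a (g y)).comp (fderiv ℝ g y) - standardForm k y
  have hgt : ∀ᶠ y in 𝓝 (modelChart s (zeroPoint (k := k) s)),
      g y ∈ (extChartAt I (f (0, s))).target := by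
    have h1 : ContinuousAt g (modelChart s (zeroPoint (k := k) s)) := hGs.self_of_nhds.continuousAt
    rw [ContinuousAt, hgz] at h1
    exact h1.eventually (eventually_mem_target hfs)
  have hγs : ∀ᶠ y in 𝓝 (modelChart s (zeroPoint (k := k) s)),
      ContDiffAt ℝ ∞ (fun y => (a (g y)).comp (fderiv ℝ g y)) y := by
    filter_upwards [hGs, hgt] with y h1 h2
    exact (ContDiffAt.comp (g := a) y (hα.smooth.contDiffAt_inChart _ h2) h1).clm_comp
      (h1.fderiv_right (by simp))
  have hδs : ∀ᶠ y in 𝓝 (modelChart s (zeroPoint (k := k) s)), ContDiffAt ℝ ∞ δ y := by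
    filter_upwards [hγs] with y h1
    exact h1.sub contDiff_standardForm.contDiffAt
  have hpair : Tendsto (fun y => (ℓ y, g (flatProj k y))) (𝓝 (modelChart s (zeroPoint (k := k) s)))
      (𝓝 (0, extChartAt I (f (0, s)) (f (0, s)))) := by
    have h1 : Tendsto ℓ (𝓝 (modelChart s (zeroPoint (k := k) s))) (𝓝 0) := by
      have h2 := ℓ.continuous.tendsto (modelChart s (zeroPoint (k := k) s))
      rwa [hℓz] at h2
    have h3 : ContinuousAt g (modelChart s (zeroPoint (k := k) s)) := hGs.self_of_nhds.continuousAt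
    rw [ContinuousAt, hgz] at h3
    exact h1.prodMk_nhds (h3.comp hflat)
  have hκ : ∀ᶠ m in 𝓝 (zeroPoint (k := k) s),
      reebExtension α G m ∈ (extChartAt I (f (0, s))).source := by
    filter_upwards [hΦe, (tendsto_extChartAt (I := modelI k) hz).eventually hΨt] with m h1 h2
    rw [h1]
    exact (extChartAt I (f (0, s))).map_target h2
  have hβ : OneForm.inChart (I := modelI k)
      (fun m => α.pull (reebExtension α G) m - modelForm (k := k) S m) (zeroPoint s)
      =ᶠ[𝓝 (modelChart s (zeroPoint s))] fun y => (δ (flatProj k y)).comp (flatProj k) := by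
    filter_upwards [htgt, hsymm.eventually (hsm.and hκ), hRep.eventually_nhds,
      hflat.eventually hGs, hpair.eventually hΦa, hΨt] with y h1 h2 h3 h4 h5 h6
    refine ContinuousLinearMap.ext fun V => ?_
    have hc := hα.isContactAt_inChart (f (0, s)) h6
    have h7 := congrArg (fun T : ModelVec k →L[ℝ] ℝ => T V)
      (α.inChart_pull h1 h2.2 (h2.1.mdifferentiableAt (by simp)))
    have h8 := congrArg (fun T : ModelVec k →L[ℝ] ℝ => T V) (modelForm_inChart (S := S) h1)
    have h3' : modelRep I f s (reebExtension α G) =ᶠ[𝓝 y] Ψ := h3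
    have h9 : a (modelRep I f s (reebExtension α G) y)
        (fderiv ℝ (modelRep I f s (reebExtension α G)) y V)
        = ℓ V + a (g (flatProj k y)) (fderiv ℝ g (flatProj k y) (flatProj k V)) := by
      rw [h3'.fderiv_eq, h3'.self_of_nhds]
      exact flow_extension_pullback hΦ (h4.differentiableAt (by simp)) h5.1
        (hc.1.apply_reebField hc.2) h5.2 V
    have h10 := standardForm_flatProj y V
    have h11 : ℓ V = V.1 2 := rfl
    refine (congrArg₂ (· - ·) (h7.trans h9) h8).trans ?_
    simp only [δ, ContinuousLinearMap.comp_apply, sub_apply, h10, h11]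
    ring
  exact flatPerturbation_of_rep hγs (hGs.and hgt |>.mono fun y h => ⟨h.1,
    (hα.smooth.contDiffAt_inChart _ h.2).differentiableAt (by simp)⟩) hflat
    (hG.rep_form s) (hG.rep_curl hα s) hβ

end ReebExtension

/-! ### Moser correction of the error term. -/

section VerticalInvariance

open Topology Filter

variable {Y : Type*} [NormedAddCommGroup Y] [NormedSpace ℝ Y]

/-- Cartan's formula for translation along `e`: both the Lie derivative of `a` and the differential
of `a(e)` vanish. This keeps `∂/∂z` the Reeb field during the deformation. -/
theorem curl_eq_zero_of_eventually_const {a : Y → Y →L[ℝ] ℝ} {y e : Y} {c : ℝ}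
    (ha : DifferentiableAt ℝ a y) (h1 : ∀ᶠ z in 𝓝 y, a z e = c) (h2 : fderiv ℝ a y e = 0) :
    curl a y e = 0 := by
  refine ContinuousLinearMap.ext fun W => ?_
  have h3 : HasFDerivAt (fun z => a z e) ((ContinuousLinearMap.apply ℝ ℝ e).comp (fderiv ℝ a y)) y :=
    (ContinuousLinearMap.apply ℝ ℝ e).hasFDerivAt.comp y ha.hasFDerivAt
  have h4 : HasFDerivAt (fun z => a z e) (0 : Y →L[ℝ] ℝ) y :=
    (hasFDerivAt_const c y).congr_of_eventuallyEq h1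
  have h5 := DFunLike.congr_fun (h3.unique h4) W
  have h6 : fderiv ℝ a y W e = 0 := h5
  rw [curl_apply, h2, h6]
  simp

theorem fderiv_smul_apply_eq_zero {b : Y → Y →L[ℝ] ℝ} {c : Y → ℝ} {y e : Y}
    (hb : DifferentiableAt ℝ b y) (hc : DifferentiableAt ℝ c y) (h1 : fderiv ℝ b y e = 0)
    (h2 : fderiv ℝ c y e = 0) : fderiv ℝ (fun z => c z • b z) y e = 0 := by
  rw [(hc.hasFDerivAt.fun_smul hb.hasFDerivAt).fderiv]
  simp [h1, h2]

theorem curl_add_smul {a b : Y → Y →L[ℝ] ℝ} {c : Y → ℝ} {y : Y} (ha : DifferentiableAt ℝ a y)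
    (hb : DifferentiableAt ℝ b y) (hc : DifferentiableAt ℝ c y) (hy : b y = 0) (v w : Y) :
    curl (fun z => a z + c z • b z) y v w = curl a y v w + c y * curl b y v w := by
  have h := (ha.hasFDerivAt.fun_add (hc.hasFDerivAt.fun_smul hb.hasFDerivAt)).fderiv
  simp only [curl_apply, h]
  simp [hy]
  ring

theorem fderiv_apply_eq_zero_of_eventually {b : Y → Y →L[ℝ] ℝ} {y T : Y}
    (hb : DifferentiableAt ℝ b y) (h : ∀ᶠ t : ℝ in 𝓝 0, b (y + t • T) = 0) :
    fderiv ℝ b y T = 0 := by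
  refine ContinuousLinearMap.ext fun W => ?_
  refine (hasDerivAt_apply_line hb T W).unique
    ((hasDerivAt_const (0 : ℝ) (0 : ℝ)).congr_of_eventuallyEq ?_)
  filter_upwards [h] with t ht
  rw [ht]
  rfl

end VerticalInvariance

section PerturbedContact

open Topology Filter

variable {k : ℕ}

theorem standardForm_zVec (y : ModelVec k) : standardForm k y (zVec k) = 1 := by
  simp [standardForm_apply, zVec]

theorem fderiv_standardForm_zVec (y : ModelVec k) :
    fderiv ℝ (standardForm k) y (zVec k) = 0 := by
  refine ContinuousLinearMap.ext fun W => ?_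
  refine (hasDerivAt_apply_line ((contDiff_standardForm (k := k)).differentiable (by simp) y)
    _ W).unique ((hasDerivAt_const (0 : ℝ) (standardForm k y W)).congr_of_eventuallyEq
      (Eventually.of_forall fun t => ?_))
  simp [standardForm_apply, zVec]

/-- The equations for a vector `v` in the kernel are triangular. The perturbation does not pair with
directions `τ` along `S`, so these give `v.2.2 = 0`. It then does not pair `v` with the plane
either, because `b` vanishes on the plane times the zero section; this gives `v.1 = 0`. What is left
is tangent to `S` and is detected by the covector directions. -/
theorem isContactAt_standardForm_add {b : ModelVec k → ModelVec k →L[ℝ] ℝ} {c : ModelVec k → ℝ}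
    {y : ModelVec k} (hy1 : y.1 = 0) (hy2 : y.2.2 = 0) (hb : DifferentiableAt ℝ b y)
    (hc : DifferentiableAt ℝ c y) (hb0 : ∀ᶠ z in 𝓝 y, z.1 2 = 0 → z.2.2 = 0 → b z = 0)
    (hcurl : ∀ V τ, curl b y V (0, (τ, 0)) = 0) :
    IsContactAt (fun z => standardForm k z + c z • b z) y := by
  have hby : b y = 0 := hb0.self_of_nhds (by rw [hy1]; rfl) hy2
  -- Derivatives of `b` along the submanifold on which it vanishes are zero, so `db` vanishes on
  -- pairs of tangent vectors.
  have htan : ∀ T : ModelVec k, T.1 2 = 0 → T.2.2 = 0 → fderiv ℝ b y T = 0 := fun T h1 h2 => by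
    refine fderiv_apply_eq_zero_of_eventually hb ?_
    have h3 : Tendsto (fun t : ℝ => y + t • T) (𝓝 0) (𝓝 y) := by
      have : Continuous fun t : ℝ => y + t • T := by fun_prop
      simpa using this.tendsto 0
    filter_upwards [h3.eventually hb0] with t ht
    exact ht (by simp [hy1, h1]) (by simp [hy2, h2])
  have hform : ∀ v, standardForm k y v + c y • b y v = v.1 2 := fun v => by
    simp [hby, standardForm_apply, hy1, hy2]
  have hcurl2 := fun v w => curl_add_smul
    ((contDiff_standardForm (k := k)).differentiable (by simp) y) hb hc hby v w
  intro v hv h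
  have hv2 : v.1 2 = 0 := (hform v).symm.trans hv
  have h' : ∀ w : ModelVec k, w.1 2 = 0 →
      v.1 0 * w.1 1 - v.1 1 * w.1 0 - v.2.2 w.2.1 + w.2.2 v.2.1 + c y * curl b y v w = 0 :=
    fun w hw => by
      rw [← curl_standardForm y, ← hcurl2]
      exact h w ((hform w).trans hw)
  have hvp : v.2.2 = 0 := ContinuousLinearMap.ext fun τ => by
    have h1 := h' (0, (τ, 0)) rfl
    rw [hcurl] at h1
    simpa using h1
  have htt : ∀ w : ModelVec k, w.1 2 = 0 → w.2.2 = 0 → curl b y v w = 0 := fun w h1 h2 => by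
    rw [curl_apply, htan v hv2 hvp, htan w h1 h2]
    simp
  have h0 : v.1 0 = 0 := by
    have h1 := h' (EuclideanSpace.single 1 1, 0) (by simp)
    rw [htt _ (by simp) rfl] at h1
    simpa using h1
  have h1 : v.1 1 = 0 := by
    have h1 := h' (EuclideanSpace.single 0 1, 0) (by simp)
    rw [htt _ (by simp) rfl] at h1
    simpa using h1
  have hX : v.1 = 0 := by
    ext i
    fin_cases i
    · exact h0
    · exact h1
    · exact hv2
  have hv' : v = (0, (v.2.1, 0)) := Prod.ext hX (Prod.ext rfl hvp)
  have hq : v.2.1 = 0 := by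
    by_contra hne
    obtain ⟨p, hp⟩ : ∃ p : EuclideanSpace ℝ (Fin k) →L[ℝ] ℝ, p v.2.1 ≠ 0 :=
      ⟨innerSL ℝ v.2.1, by simpa using hne⟩
    have h2 := h' (0, (0, p)) rfl
    rw [curl_swap, hv', hcurl] at h2
    refine hp ?_
    simpa using h2
  rw [hv', hq]
  rfl

end PerturbedContact

section Correction

open Topology Filter

variable {k : ℕ} {S : Type*} [TopologicalSpace S] [ChartedSpace (EuclideanSpace ℝ (Fin k)) S]
  [IsManifold (𝓡 k) ∞ S]

/-- The standard form, deformed by a multiple of `β`. -/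
def deformedForm (β : OneForm (modelI k) (Model (k := k) S)) (σ : S → ℝ) :
    OneForm (modelI k) (Model (k := k) S) :=
  fun m => modelForm (k := k) S m + σ m.2.1 • β m

theorem deformedForm_inChart (β : OneForm (modelI k) (Model (k := k) S)) (σ : S → ℝ) {s₀ : S}
    {y : ModelVec k} (hy : y ∈ (modelChart s₀).target) :
    (deformedForm β σ).inChart (zeroPoint s₀) y = standardForm k y
      + σ ((extChartAt (𝓡 k) s₀).symm y.2.1) • β.inChart (zeroPoint s₀) y := by
  rw [← modelForm_inChart (S := S) hy, ← modelChart_symm_snd_fst hy]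
  rfl

/-- `h` is defined near the zero section, fixes the plane times the zero section and pulls the
form deformed by `σ` back to the form deformed by `σ'`. -/
structure IsCorrection (β : OneForm (modelI k) (Model (k := k) S)) (σ σ' : S → ℝ)
    (h : Model (k := k) S → Model (k := k) S) : Prop where
  smooth : ∀ s : S, ∀ᶠ m in 𝓝 (zeroPoint (k := k) s), ContMDiffAt (modelI k) (modelI k) ∞ h m
  apply_incl : ∀ s : S, ∀ᶠ n in 𝓝 ((0, s) : EuclideanSpace ℝ (Fin 2) × S),
    h (modelIncl n) = modelIncl n
  form : ∀ s : S, ∀ᶠ m in 𝓝 (zeroPoint (k := k) s),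
    (deformedForm β σ).pull h m = deformedForm β σ' m

theorem isCorrection_id (β : OneForm (modelI k) (Model (k := k) S)) (σ : S → ℝ) :
    IsCorrection β σ σ id where
  smooth s := Eventually.of_forall fun m => contMDiffAt_id
  apply_incl s := Eventually.of_forall fun n => rfl
  form s := Eventually.of_forall fun m => by
    rw [OneForm.pull, mfderiv_id]
    rfl

theorem OneForm.pull_comp_apply {E : Type*} [NormedAddCommGroup E] [NormedSpace ℝ E]
    {H : Type*} [TopologicalSpace H] {I : ModelWithCorners ℝ E H}
    {X : Type*} [TopologicalSpace X] [ChartedSpace H X]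
    {E' : Type*} [NormedAddCommGroup E'] [NormedSpace ℝ E']
    {H' : Type*} [TopologicalSpace H'] {I' : ModelWithCorners ℝ E' H'}
    {Y : Type*} [TopologicalSpace Y] [ChartedSpace H' Y]
    {E'' : Type*} [NormedAddCommGroup E''] [NormedSpace ℝ E'']
    {H'' : Type*} [TopologicalSpace H''] {I'' : ModelWithCorners ℝ E'' H''}
    {Z : Type*} [TopologicalSpace Z] [ChartedSpace H'' Z] (α : OneForm I'' Z) {g : Y → Z} {f : X → Y}
    {m : X} (hg : MDifferentiableAt I' I'' g (f m)) (hf : MDifferentiableAt I I' f m)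
    (v : TangentSpace I m) :
    α.pull (I := I) (g ∘ f) m v = α.pull (I := I') g (f m) (mfderiv I I' f m v) :=
  congrArg (α (g (f m))) (DFunLike.congr_fun (mfderiv_comp m hg hf) v)

theorem IsCorrection.comp {β : OneForm (modelI k) (Model (k := k) S)} {σ σ' σ'' : S → ℝ}
    {g h : Model (k := k) S → Model (k := k) S} (hg : IsCorrection β σ σ' g)
    (hh : IsCorrection β σ' σ'' h) : IsCorrection β σ σ'' (g ∘ h) := by
  have hz : ∀ s, h (zeroPoint s) = zeroPoint s := fun s => by
    rw [← modelIncl_zero]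
    exact (hh.apply_incl s).self_of_nhds
  have ht : ∀ s, Tendsto h (𝓝 (zeroPoint s)) (𝓝 (zeroPoint s)) := fun s => by
    have h1 := (hh.smooth s).self_of_nhds.continuousAt
    rwa [ContinuousAt, hz] at h1
  refine ⟨fun s => ?_, fun s => ?_, fun s => ?_⟩
  · filter_upwards [(ht s).eventually (hg.smooth s), hh.smooth s] with m h1 h2
    exact h1.comp m h2
  · filter_upwards [hg.apply_incl s, hh.apply_incl s] with n h1 h2
    rw [Function.comp_apply, h2, h1]
  · filter_upwards [(ht s).eventually ((hg.smooth s).and (hg.form s)),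
      (hh.smooth s).and (hh.form s)] with m h1 h2
    refine ContinuousLinearMap.ext fun v => ?_
    rw [OneForm.pull_comp_apply _ (h1.1.mdifferentiableAt (by simp))
      (h2.1.mdifferentiableAt (by simp)), h1.2, ← h2.2]
    rfl

end Correction

section SmulForm

variable {Y : Type*} [NormedAddCommGroup Y] [NormedSpace ℝ Y]

theorem contDiffAt_smul_form {b : Y → Y →L[ℝ] ℝ} {c : Y → ℝ} {y : Y} (hc : ContDiffAt ℝ ∞ c y)
    (hb : ContDiffAt ℝ ∞ b y) : ContDiffAt ℝ ∞ (fun z => c z • b z) y :=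
  hc.smul hb

theorem contDiffAt_add_form {a b : Y → Y →L[ℝ] ℝ} {y : Y} (ha : ContDiffAt ℝ ∞ a y)
    (hb : ContDiffAt ℝ ∞ b y) : ContDiffAt ℝ ∞ (fun z => a z + b z) y :=
  ha.add hb

theorem fderiv_add_form_apply_eq_zero {a b : Y → Y →L[ℝ] ℝ} {y e : Y} (ha : ContDiffAt ℝ ∞ a y)
    (hb : ContDiffAt ℝ ∞ b y) (h1 : fderiv ℝ a y e = 0) (h2 : fderiv ℝ b y e = 0) :
    fderiv ℝ (fun z => a z + b z) y e = 0 := by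
  rw [((ha.differentiableAt (by simp)).hasFDerivAt.fun_add
    (hb.differentiableAt (by simp)).hasFDerivAt).fderiv]
  simp [h1, h2]

end SmulForm

section Normalization

open Topology Filter

variable {k : ℕ} {S : Type*} [TopologicalSpace S] [ChartedSpace (EuclideanSpace ℝ (Fin k)) S]
  [IsManifold (𝓡 k) ∞ S]

theorem fderiv_comp_chart_symm_zVec {ρ : S → ℝ} (s₀ : S) (y : ModelVec k)
    (h : DifferentiableAt ℝ (fun y : ModelVec k => ρ ((extChartAt (𝓡 k) s₀).symm y.2.1)) y) :
    fderiv ℝ (fun y : ModelVec k => ρ ((extChartAt (𝓡 k) s₀).symm y.2.1)) y (zVec k) = 0 := by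
  have h1 : HasDerivAt (fun t : ℝ => y + t • zVec k) (zVec k) 0 := by
    simpa using ((hasDerivAt_id (0 : ℝ)).smul_const (zVec k)).const_add y
  have h2 : HasFDerivAt (fun y : ModelVec k => ρ ((extChartAt (𝓡 k) s₀).symm y.2.1))
      (fderiv ℝ (fun y : ModelVec k => ρ ((extChartAt (𝓡 k) s₀).symm y.2.1)) y)
      (y + (0 : ℝ) • zVec k) := by
    simpa using h.hasFDerivAt
  refine (h2.comp_hasDerivAt (0 : ℝ) h1).unique ?_
  refine (hasDerivAt_const (0 : ℝ) (ρ ((extChartAt (𝓡 k) s₀).symm y.2.1))).congr_of_eventuallyEq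
    (Eventually.of_forall fun t => ?_)
  simp [zVec]

set_option maxHeartbeats 800000 in
-- Moser's argument runs from `α₀ + σ b` with perturbation `ρ b`. The coefficients are functions on
-- `S`, so invariance in the direction of `z` is kept; where `b` vanishes their differentials do not
-- enter the exterior derivative, and the contact condition along `S` is that of
-- `isContactAt_standardForm_add`.
theorem exists_local_correction {b : ModelVec k → ModelVec k →L[ℝ] ℝ} {σ ρ : S → ℝ}
    (hσ : ContMDiff (𝓡 k) 𝓘(ℝ, ℝ) ∞ σ) (hρ : ContMDiff (𝓡 k) 𝓘(ℝ, ℝ) ∞ ρ) (s₀ : S)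
    {K : Set (ModelVec k)} (hK : IsCompact K) (hK1 : ∀ y ∈ K, y.1 = 0 ∧ y.2.2 = 0)
    (hKt : ∀ y ∈ K, y ∈ (modelChart s₀).target) (hb : ∀ y ∈ K, ∀ᶠ z in 𝓝 y, IsFlatAt b z) :
    ∃ φ : ModelVec k → ModelVec k, ContDiff ℝ ∞ φ ∧
      (∀ y, ρ ((extChartAt (𝓡 k) s₀).symm y.2.1) • b y = 0 → φ y = y) ∧
      ∀ y ∈ K, ∀ᶠ z in 𝓝 y,
        (standardForm k (φ z) + (σ + ρ) ((extChartAt (𝓡 k) s₀).symm (φ z).2.1) • b (φ z)).comp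
          (fderiv ℝ φ z)
          = standardForm k z + σ ((extChartAt (𝓡 k) s₀).symm z.2.1) • b z := by
  have htgt : ∀ y ∈ K, ∀ᶠ z in 𝓝 y, z.2.1 ∈ (extChartAt (𝓡 k) s₀).target := fun y hy => by
    filter_upwards [(isOpen_extChartAt_target (I := modelI k) _).mem_nhds (hKt y hy)] with z hz
    exact mem_modelChart_target.1 hz
  have hst : ContDiff ℝ ∞ (standardForm k) := contDiff_standardForm
  let σ' : ModelVec k → ℝ := fun y => σ ((extChartAt (𝓡 k) s₀).symm y.2.1)
  let ρ' : ModelVec k → ℝ := fun y => ρ ((extChartAt (𝓡 k) s₀).symm y.2.1)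
  obtain ⟨φ, h1, h2, h3⟩ := exists_moser (a := fun z => standardForm k z + σ' z • b z)
    (b := fun z => ρ' z • b z) (e := zVec k) hK
    (fun y hy => by
      filter_upwards [(htgt y hy).eventually_nhds, (hb y hy).eventually_nhds] with z h1 h2
      have hs : ∀ᶠ w in 𝓝 z, ContDiffAt ℝ ∞ σ' w := by
        filter_upwards [h1] with w hw
        exact contDiffAt_comp_chart_symm hσ hw
      have hev : ∀ᶠ w in 𝓝 z, standardForm k w (zVec k) + σ' w * b w (zVec k) = 1 := by
        filter_upwards [h2] with w hw
        rw [standardForm_zVec, hw.2.1]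
        simp
      have hd := h2.self_of_nhds.1
      have hsb := contDiffAt_smul_form hs.self_of_nhds hd
      have hsum := contDiffAt_add_form hst.contDiffAt hsb
      exact ⟨hsum, hev.self_of_nhds, curl_eq_zero_of_eventually_const (c := 1)
        (hsum.differentiableAt (by simp)) hev
        (fderiv_add_form_apply_eq_zero hst.contDiffAt hsb (fderiv_standardForm_zVec z)
          (fderiv_smul_apply_eq_zero (hd.differentiableAt (by simp))
            (hs.self_of_nhds.differentiableAt (by simp)) h2.self_of_nhds.2.2.1
            (fderiv_comp_chart_symm_zVec s₀ z (hs.self_of_nhds.differentiableAt (by simp)))))⟩)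
    (fun y hy => by
      filter_upwards [(htgt y hy).eventually_nhds, (hb y hy).eventually_nhds] with z h1 h2
      have hs : ContDiffAt ℝ ∞ ρ' z := contDiffAt_comp_chart_symm hρ h1.self_of_nhds
      have hev : ∀ᶠ w in 𝓝 z, ρ' w * b w (zVec k) = 0 := by
        filter_upwards [h2] with w hw
        rw [hw.2.1, mul_zero]
      have hd := h2.self_of_nhds.1
      have hsb := contDiffAt_smul_form hs hd
      exact ⟨hsb, hev.self_of_nhds, curl_eq_zero_of_eventually_const (c := 0)
        (hsb.differentiableAt (by simp)) hev (fderiv_smul_apply_eq_zero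
          (hd.differentiableAt (by simp)) (hs.differentiableAt (by simp)) h2.self_of_nhds.2.2.1
          (fderiv_comp_chart_symm_zVec s₀ z (hs.differentiableAt (by simp))))⟩)
    (fun y hy => by
      have h := (hb y hy).self_of_nhds.2.2.2.1 (by rw [(hK1 y hy).1]; rfl) (hK1 y hy).2
      simp only [h, smul_zero])
    (fun y hy t _ => by
      have h := (hb y hy).self_of_nhds
      have hs : ContDiffAt ℝ ∞ ρ' y := contDiffAt_comp_chart_symm hρ (htgt y hy).self_of_nhds
      have hs' : ContDiffAt ℝ ∞ σ' y := contDiffAt_comp_chart_symm hσ (htgt y hy).self_of_nhds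
      have h1 := isContactAt_standardForm_add (b := b) (c := fun z => σ' z + t * ρ' z) (hK1 y hy).1
        (hK1 y hy).2 (h.1.differentiableAt (by simp))
        ((hs'.add (contDiffAt_const.mul hs)).differentiableAt (by simp))
        ((hb y hy).mono fun z hz => hz.2.2.2.1) (h.2.2.2.2 (hK1 y hy).1 (hK1 y hy).2)
      have h2 : (fun z => standardForm k z + (σ' z + t * ρ' z) • b z)
          = fun z => standardForm k z + σ' z • b z + t • ρ' z • b z := by
        funext z
        rw [add_smul, mul_smul, add_assoc]
      rwa [h2] at h1)
  refine ⟨φ, h1, h2, fun y hy => ?_⟩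
  filter_upwards [h3 y hy] with z hz
  refine Eq.trans ?_ hz
  refine congrArg (fun A : ModelVec k →L[ℝ] ℝ => A.comp (fderiv ℝ φ z)) ?_
  simp only [σ', ρ', Pi.add_apply, add_smul, add_assoc]

theorem deformedForm_congr {β : OneForm (modelI k) (Model (k := k) S)} {σ σ' : S → ℝ}
    {m : Model (k := k) S} (h : σ m.2.1 = σ' m.2.1) :
    deformedForm β σ m = deformedForm β σ' m := by
  rw [deformedForm, h]
  rfl

variable [CompactSpace S]

set_option maxHeartbeats 800000 in
theorem exists_isCorrection_add {β : OneForm (modelI k) (Model (k := k) S)} {s₀ : S}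
    {σ ρ : S → ℝ} (hσ : ContMDiff (𝓡 k) 𝓘(ℝ, ℝ) ∞ σ) (hρ : ContMDiff (𝓡 k) 𝓘(ℝ, ℝ) ∞ ρ)
    (hs : ∀ s ∈ tsupport ρ, s ∈ (extChartAt (𝓡 k) s₀).source ∧
      ∀ᶠ y in 𝓝 (modelChart s₀ (zeroPoint (k := k) s)), IsFlatAt (β.inChart (zeroPoint s₀)) y) :
    ∃ h, IsCorrection β (σ + ρ) σ h := by
  let K : Set (ModelVec k) := (fun s => modelChart s₀ (zeroPoint (k := k) s)) '' tsupport ρ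
  have hK : IsCompact K := (isClosed_tsupport ρ).isCompact.image_of_continuousOn fun s h =>
    (ContinuousAt.comp (g := modelChart s₀)
      (tendsto_extChartAt (I := modelI k) (zeroPoint_mem_source.2 (hs s h).1))
      contMDiff_zeroPoint.continuous.continuousAt).continuousWithinAt
  obtain ⟨φ, hφ, hφ0, hφe⟩ := exists_local_correction (b := β.inChart (zeroPoint s₀)) hσ hρ s₀ hK
    (by
      rintro _ ⟨s, h, rfl⟩
      simp only [modelChart_zeroPoint (hs s h).1, and_self])
    (by
      rintro _ ⟨s, h, rfl⟩
      exact (modelChart s₀).map_source (zeroPoint_mem_source.2 (hs s h).1))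
    (by
      rintro _ ⟨s, h, rfl⟩
      exact (hs s h).2)
  have hφz : ∀ s ∈ tsupport ρ,
      φ (modelChart s₀ (zeroPoint (k := k) s)) = modelChart s₀ (zeroPoint (k := k) s) :=
    fun s h => by
      refine hφ0 _ ?_
      rw [(hs s h).2.self_of_nhds.2.2.2.1, smul_zero]
      all_goals rw [modelChart_zeroPoint (hs s h).1]
      rfl
  classical
  -- The local solution `φ` fixes every point where `ρ b` is zero, so the two cases match near the
  -- support of `ρ`.
  let G : Model (k := k) S → Model (k := k) S := fun m => if ρ m.2.1 = 0 then m else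
    (modelChart s₀).symm (φ (modelChart s₀ m))
  have hin : ∀ s ∈ tsupport ρ, G =ᶠ[𝓝 (zeroPoint s)] fun m =>
      (modelChart s₀).symm (φ (modelChart s₀ m)) := by
    intro s h
    filter_upwards [(isOpen_extChartAt_source (I := modelI k) _).mem_nhds
      (zeroPoint_mem_source.2 (hs s h).1)] with m hm
    by_cases h0 : ρ m.2.1 = 0
    · have h1 : φ (modelChart s₀ m) = modelChart s₀ m := hφ0 _ (by
        rw [modelChart_apply_snd_fst, (extChartAt (𝓡 k) s₀).left_inv (mem_modelChart_source.1 hm),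
          h0, zero_smul])
      simp only [G, h0, if_true, h1]
      exact ((modelChart s₀).left_inv hm).symm
    · simp only [G, h0, if_false]
  have hout : ∀ s ∉ tsupport ρ, (∀ᶠ m in 𝓝 (zeroPoint (k := k) s), ρ m.2.1 = 0) ∧
      G =ᶠ[𝓝 (zeroPoint s)] id := by
    intro s h
    have h1 := notMem_tsupport_iff_eventuallyEq.1 h
    have h2 : Tendsto (fun m : Model (k := k) S => m.2.1) (𝓝 (zeroPoint s)) (𝓝 s) :=
      (continuous_snd.comp contMDiff_modelProj.continuous).tendsto (zeroPoint (k := k) s)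
    refine ⟨h2.eventually h1, ?_⟩
    filter_upwards [h2.eventually h1] with m hm
    have hm' : ρ m.2.1 = 0 := hm
    simp only [G, hm', if_true, id]
  have hnear : ∀ s ∈ tsupport ρ, ∀ᶠ m in 𝓝 (zeroPoint (k := k) s),
      m ∈ (modelChart s₀).source ∧ φ (modelChart s₀ m) ∈ (modelChart s₀).target := fun s h => by
    have hz := zeroPoint_mem_source (k := k).2 (hs s h).1
    have h1 : Tendsto (fun m => φ (modelChart s₀ m)) (𝓝 (zeroPoint (k := k) s))
        (𝓝 (modelChart s₀ (zeroPoint s))) := by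
      have h2 := (hφ.continuous.tendsto _).comp (tendsto_extChartAt (I := modelI k) hz)
      have h3 : φ (extChartAt (modelI k) (zeroPoint s₀) (zeroPoint (k := k) s))
        = modelChart s₀ (zeroPoint (k := k) s) := hφz s h
      rwa [h3] at h2
    exact Eventually.and ((isOpen_extChartAt_source (I := modelI k) _).mem_nhds hz)
      (h1.eventually (eventually_mem_target (I := modelI k) hz))
  have hsm : ∀ s, ∀ᶠ m in 𝓝 (zeroPoint (k := k) s), ContMDiffAt (modelI k) (modelI k) ∞ G m := by
    intro s
    by_cases h : s ∈ tsupport ρ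
    · filter_upwards [(hin s h).eventually_nhds, hnear s h] with m h1 h2
      have h3 : ContMDiffAt (modelI k) (modelI k) ∞ (fun m =>
          (modelChart s₀).symm (φ (modelChart s₀ m))) m :=
        ContMDiffAt.comp m (contMDiffAt_extChartAt_symm h2.2)
          (hφ.contDiffAt.contMDiffAt.comp m (contMDiffAt_extChartAt' (by simpa using h2.1)))
      exact h3.congr_of_eventuallyEq h1
    · filter_upwards [(hout s h).2.eventually_nhds] with m h1
      exact contMDiffAt_id.congr_of_eventuallyEq h1
  refine ⟨G, hsm, fun s => ?_, fun s => ?_⟩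
  · by_cases h : s ∈ tsupport ρ
    · have h1 : ∀ᶠ m in 𝓝 (zeroPoint (k := k) s),
          IsFlatAt (β.inChart (zeroPoint s₀)) (modelChart s₀ m) :=
        (tendsto_extChartAt (I := modelI k) (zeroPoint_mem_source.2 (hs s h).1)).eventually
          (hs s h).2
      filter_upwards [(tendsto_modelIncl s).eventually ((hin s h).and ((hnear s h).and h1))]
        with n h2
      have h3 : φ (modelChart s₀ (modelIncl n)) = modelChart s₀ (modelIncl n) := hφ0 _ (by
        have h4 := modelChart_modelIncl (k := k) (modelIncl_mem_source.1 h2.2.1.1)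
        rw [h2.2.2.2.2.2.1, smul_zero]
        · rw [h4]
          simp
        · rw [h4])
      rw [h2.1, h3]
      exact (modelChart s₀).left_inv h2.2.1.1
    · filter_upwards [(tendsto_modelIncl s).eventually (hout s h).2] with n h1
      exact h1
  · by_cases h : s ∈ tsupport ρ
    · have hz := zeroPoint_mem_source (k := k).2 (hs s h).1
      filter_upwards [(hin s h).eventually_nhds, hnear s h, hsm s,
        (tendsto_extChartAt (I := modelI k) hz).eventually (hφe _ ⟨s, h, rfl⟩),
        (hnear s h).eventually_nhds]
        with m h1 h2 h3 h4 h6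
      have hy := (modelChart s₀).map_source h2.1
      have hm := (modelChart s₀).left_inv h2.1
      have hGm : G m = (modelChart s₀).symm (φ (modelChart s₀ m)) := h1.self_of_nhds
      have hrep : chartRep (modelI k) (modelI k) (zeroPoint s₀) (zeroPoint s₀) G
          =ᶠ[𝓝 (modelChart s₀ m)] φ := by
        filter_upwards [(tendsto_extChartAt_symm (I := modelI k) h2.1).eventually (h1.and h6),
          eventually_mem_target (I := modelI k) h2.1] with y h7 h8
        have h9 := (modelChart s₀).right_inv h8
        have h10 := h7.2.2
        have h11 := congrArg (modelChart s₀) h7.1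
        rw [show modelChart s₀ ((extChartAt (modelI k) (zeroPoint s₀)).symm y) = y from h9]
          at h10 h11
        exact h11.trans ((modelChart s₀).right_inv h10)
      refine OneForm.ext_inChart h2.1 ?_
      have h7 := (deformedForm β (σ + ρ)).inChart_pull (I := modelI k) (I' := modelI k) (g := G)
        (x₀ := zeroPoint s₀) (y₀ := zeroPoint s₀) hy
        (by
          rw [show (extChartAt (modelI k) (zeroPoint s₀)).symm (modelChart s₀ m) = m from hm, hGm]
          exact (modelChart s₀).map_target h2.2)
        (by
          rw [show (extChartAt (modelI k) (zeroPoint s₀)).symm (modelChart s₀ m) = m from hm]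
          exact h3.mdifferentiableAt (by simp))
      refine h7.trans ?_
      rw [hrep.fderiv_eq, hrep.self_of_nhds]
      refine Eq.trans ?_ (h4.trans (deformedForm_inChart β σ hy).symm)
      exact congrArg (fun A : ModelVec k →L[ℝ] ℝ => A.comp (fderiv ℝ φ (modelChart s₀ m)))
        (deformedForm_inChart β (σ + ρ) h2.2)
    · filter_upwards [(hout s h).1, (hout s h).2.eventually_nhds] with m h1 h2
      refine (OneForm.pull_congr _ h2).trans ?_
      have h3 : (deformedForm β (σ + ρ)).pull (I := modelI k) id m = deformedForm β (σ + ρ) m := by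
        rw [OneForm.pull, mfderiv_id]
        rfl
      exact h3.trans (deformedForm_congr (by rw [Pi.add_apply, h1, add_zero]))

variable [T2Space S]

/-- Corrections compose: one from `σ + ρ` to `σ` followed in this chain by one from `σ` to `0` gives
one from `σ + ρ` to `0`. Patching then reaches `σ = 1`. -/
theorem IsFlatPerturbation.exists_isCorrection
    {β : OneForm (modelI k) (Model (k := k) S)} (hβ : IsFlatPerturbation β) :
    ∃ h, IsCorrection β 1 0 h := by
  refine patching_induction (k := k) (P := fun σ => ∃ h, IsCorrection β σ 0 h)
    ⟨_, isCorrection_id β 0⟩ fun s₀ => ?_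
  let O' : Set S := {s | s ∈ (extChartAt (𝓡 k) s₀).source ∧
    ∀ᶠ y in 𝓝 (modelChart s₀ (zeroPoint (k := k) s)), IsFlatAt (β.inChart (zeroPoint s₀)) y}
  have hO' : O' ∈ 𝓝 s₀ := by
    have h2 : Tendsto (fun s => modelChart s₀ (zeroPoint (k := k) s)) (𝓝 s₀)
        (𝓝 (modelChart s₀ (zeroPoint (k := k) s₀))) :=
      (tendsto_extChartAt (I := modelI k) (mem_extChartAt_source _)).comp
        (contMDiff_zeroPoint.continuous.tendsto s₀)
    filter_upwards [extChartAt_source_mem_nhds (I := 𝓡 k) s₀,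
      h2.eventually (hβ s₀).eventually_nhds] with s h3 h4
    exact ⟨h3, h4⟩
  refine ⟨interior O', isOpen_interior, mem_interior_iff_mem_nhds.2 hO', ?_⟩
  rintro σ ρ hσ hρ hsupp ⟨h, hh⟩
  obtain ⟨g, hg⟩ := exists_isCorrection_add (β := β) (s₀ := s₀) hσ hρ
    fun s hs => interior_subset (s := O') (hsupp hs)
  exact ⟨_, hg.comp hh⟩

end Normalization

/-! ### The inverse function theorem near a point and near a compact set. -/

section InverseFunction

open Topology Filter

variable {E : Type*} [NormedAddCommGroup E] [NormedSpace ℝ E] [FiniteDimensional ℝ E]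
  {H : Type*} [TopologicalSpace H] {I : ModelWithCorners ℝ E H} [I.Boundaryless]
  {X : Type*} [TopologicalSpace X] [ChartedSpace H X] [IsManifold I ∞ X]
  {E' : Type*} [NormedAddCommGroup E'] [NormedSpace ℝ E'] [FiniteDimensional ℝ E']
  {H' : Type*} [TopologicalSpace H'] {I' : ModelWithCorners ℝ E' H'} [I'.Boundaryless]
  {Y : Type*} [TopologicalSpace Y] [ChartedSpace H' Y] [IsManifold I' ∞ Y]

theorem exists_contMDiffAt_local_inverse {g : X → Y} {m : X} (hg : ContMDiffAt I I' ∞ g m)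
    (hinj : Function.Injective (mfderiv I I' g m))
    (hdim : Module.finrank ℝ E = Module.finrank ℝ E') :
    ∃ r : Y → X, ContMDiffAt I' I ∞ r (g m) ∧ r (g m) = m ∧ (∀ᶠ x in 𝓝 m, r (g x) = x) ∧
      ∀ᶠ y in 𝓝 (g m), g (r y) = y := by
  have hm := mem_extChartAt_source (I := I) m
  have hgm := mem_extChartAt_source (I := I') (g m)
  have hd := hg.mdifferentiableAt (n := ∞) (by simp)
  have hG : ContDiffAt ℝ ∞ (chartRep I I' m (g m) g) (extChartAt I m m) :=
    (ContMDiffAt.comp (I' := I') _ (by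
      simp only [Function.comp_apply, (extChartAt I m).left_inv hm]
      exact contMDiffAt_extChartAt) (ContMDiffAt.comp (I' := I) (g := g) _ (by
        rw [(extChartAt I m).left_inv hm]
        exact hg) (contMDiffAt_extChartAt_symm ((extChartAt I m).map_source hm)))).contDiffAt
  let A : E →L[ℝ] E' := fderiv ℝ (chartRep I I' m (g m) g) (extChartAt I m m)
  have hA : Function.Injective A := by
    refine (injective_iff_map_eq_zero A).2 fun V hV => ?_
    obtain ⟨v, rfl⟩ := mfderiv_extChartAt_surjective hm V
    have h1 := (fderiv_chartRep hm hgm hd v).symm.trans hV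
    have h2 : mfderiv I I' g m v = 0 :=
      mfderiv_extChartAt_injective hgm (h1.trans (map_zero _).symm)
    have h3 : v = 0 := hinj (h2.trans (map_zero _).symm)
    rw [h3]
    exact map_zero _
  let A' : E ≃L[ℝ] E' := (LinearEquiv.ofInjectiveOfFinrankEq (A : E →ₗ[ℝ] E') hA
    hdim).toContinuousLinearEquiv
  have hA' : HasFDerivAt (chartRep I I' m (g m) g) (A' : E →L[ℝ] E') (extChartAt I m m) := by
    have h1 : (A' : E →L[ℝ] E') = A := ContinuousLinearMap.ext fun V => rfl
    rw [h1]
    exact (hG.differentiableAt (by simp)).hasFDerivAt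
  have hst := hG.hasStrictFDerivAt' hA' (by simp)
  let ℓ : E' → E := HasStrictFDerivAt.localInverse _ A' _ hst
  have hval : chartRep I I' m (g m) g (extChartAt I m m) = extChartAt I' (g m) (g m) :=
    chartRep_extChartAt hm
  have hℓs : ContDiffAt ℝ ∞ ℓ (extChartAt I' (g m) (g m)) := by
    rw [← hval]
    exact hG.to_localInverse hA' (by simp)
  have hℓ0 : ℓ (extChartAt I' (g m) (g m)) = extChartAt I m m := by
    rw [← hval]
    exact hst.localInverse_apply_image
  have hl := hst.eventually_left_inverse
  have hr := hst.eventually_right_inverse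
  rw [hval] at hr
  have hℓt : ∀ᶠ z in 𝓝 (extChartAt I' (g m) (g m)), ℓ z ∈ (extChartAt I m).target := by
    have h1 := hℓs.continuousAt
    rw [ContinuousAt, hℓ0] at h1
    exact h1.eventually (eventually_mem_target hm)
  have hrs : ContMDiffAt I' I ∞ (fun y => (extChartAt I m).symm (ℓ (extChartAt I' (g m) y)))
      (g m) :=
    ContMDiffAt.comp (g m) (contMDiffAt_extChartAt_symm hℓt.self_of_nhds)
      (ContMDiffAt.comp (g m) hℓs.contMDiffAt contMDiffAt_extChartAt)
  have hr0 : (extChartAt I m).symm (ℓ (extChartAt I' (g m) (g m))) = m := by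
    rw [hℓ0, (extChartAt I m).left_inv hm]
  refine ⟨_, hrs, hr0, ?_, ?_⟩
  · filter_upwards [(tendsto_extChartAt hm).eventually hl,
      (isOpen_extChartAt_source (I := I) m).mem_nhds hm] with x h1 h2
    rw [chartRep_extChartAt h2] at h1
    rw [show ℓ (extChartAt I' (g m) (g x)) = extChartAt I m x from h1,
      (extChartAt I m).left_inv h2]
  · have hc := hrs.continuousAt
    rw [ContinuousAt, hr0] at hc
    filter_upwards [(tendsto_extChartAt hgm).eventually (hr.and hℓt),
      (isOpen_extChartAt_source (I := I') (g m)).mem_nhds hgm,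
      (hg.continuousAt.tendsto.comp hc).eventually
        ((isOpen_extChartAt_source (I := I') (g m)).mem_nhds hgm)] with y h1 h2 h3
    have h4 : extChartAt I' (g m) (g ((extChartAt I m).symm (ℓ (extChartAt I' (g m) y))))
        = extChartAt I' (g m) y := h1.1
    exact (extChartAt I' (g m)).injOn h3 h2 h4

/-- A smooth map which is injective on a compact set and whose derivative is invertible nearby is a
diffeomorphism from a neighborhood of this set onto an open set. -/
theorem exists_diffeomorph_near_compact [T2Space Y] [Nonempty X] {g : X → Y} {K W : Set X}
    (hK : IsCompact K) (hW : IsOpen W) (hKW : K ⊆ W) (hg : ∀ m ∈ W, ContMDiffAt I I' ∞ g m)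
    (hinj : ∀ m ∈ W, Function.Injective (mfderiv I I' g m)) (hKi : InjOn g K)
    (hdim : Module.finrank ℝ E = Module.finrank ℝ E') :
    ∃ Φ : OpenPartialHomeomorph Y X, K ⊆ Φ.target ∧ Φ.target ⊆ W ∧ (∀ x, Φ.symm x = g x) ∧
      ContMDiffOn I' I ∞ Φ Φ.source ∧ ContMDiffOn I I' ∞ Φ.symm Φ.target := by
  -- Injectivity on the compact set together with local injectivity at its points gives injectivity
  -- on a neighborhood of it.
  obtain ⟨t, ht, hti⟩ := hKi.exists_mem_nhdsSet hK
    (fun m hm => (hg m (hKW hm)).continuousAt) fun m hm => by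
      obtain ⟨r, -, -, h1, -⟩ :=
        exists_contMDiffAt_local_inverse (hg m (hKW hm)) (hinj m (hKW hm)) hdim
      exact ⟨_, h1, fun x hx y hy hxy => by
        have hx' : r (g x) = x := hx
        rw [← hx', hxy]
        exact hy⟩
  let U : Set X := interior t ∩ W
  have hU : IsOpen U := isOpen_interior.inter hW
  have hUi : InjOn g U := hti.mono (inter_subset_left.trans interior_subset)
  have hloc : ∀ m ∈ U, ∃ r : Y → X, ContMDiffAt I' I ∞ r (g m) ∧
      ∀ᶠ y in 𝓝 (g m), r y ∈ U ∧ g (r y) = y := fun m hm => by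
    obtain ⟨r, h1, h2, -, h3⟩ :=
      exists_contMDiffAt_local_inverse (hg m hm.2) (hinj m hm.2) hdim
    have h4 := h1.continuousAt
    rw [ContinuousAt, h2] at h4
    exact ⟨r, h1, (h4.eventually (hU.mem_nhds hm)).and h3⟩
  have hsm : ∀ y ∈ g '' U, ContMDiffAt I' I ∞ (Function.invFunOn g U) y := by
    rintro _ ⟨m, hm, rfl⟩
    obtain ⟨r, h1, h2⟩ := hloc m hm
    refine h1.congr_of_eventuallyEq ?_
    filter_upwards [h2] with y hy
    have h3 : ∃ x ∈ U, g x = y := ⟨r y, hy⟩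
    exact hUi (Function.invFunOn_mem h3) hy.1 ((Function.invFunOn_eq h3).trans hy.2.symm)
  let Φ : OpenPartialHomeomorph Y X :=
    { toFun := Function.invFunOn g U
      invFun := g
      source := g '' U
      target := U
      map_source' := fun y hy => Function.invFunOn_mem hy
      map_target' := fun x hx => mem_image_of_mem g hx
      left_inv' := fun y hy => Function.invFunOn_eq hy
      right_inv' := fun x hx => hUi.leftInvOn_invFunOn hx
      open_source := isOpen_iff_mem_nhds.2 (by
        rintro _ ⟨m, hm, rfl⟩
        obtain ⟨r, -, h2⟩ := hloc m hm
        filter_upwards [h2] with y hy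
        exact ⟨r y, hy⟩)
      open_target := hU
      continuousOn_toFun := fun y hy => (hsm y hy).continuousAt.continuousWithinAt
      continuousOn_invFun := fun x hx => (hg x hx.2).continuousAt.continuousWithinAt }
  exact ⟨Φ, fun m hm => ⟨mem_interior_iff_mem_nhds.2 (mem_nhdsSet_iff_forall.1 ht m hm), hKW hm⟩,
    inter_subset_right, fun x => rfl, fun y hy => (hsm y hy).contMDiffWithinAt,
    fun x hx => (hg x hx.2).contMDiffWithinAt⟩

end InverseFunction

/-! ### The strict contact embedding near `S`. -/

section StandardGerm

open Topology Filter

variable {k : ℕ}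

theorem isContactAt_standardForm (y : ModelVec k) : IsContactAt (standardForm k) y := by
  intro v hv h
  simp only [curl_standardForm, standardForm_apply] at h hv
  have hq : v.2.1 = 0 := by
    by_contra hne
    obtain ⟨p, hp⟩ : ∃ p : EuclideanSpace ℝ (Fin k) →L[ℝ] ℝ, p v.2.1 ≠ 0 :=
      ⟨innerSL ℝ v.2.1, by simpa using hne⟩
    have h1 := h (0, (0, p)) (by simp)
    refine hp ?_
    simpa using h1
  have hp : v.2.2 = 0 := ContinuousLinearMap.ext fun τ => by
    -- Here and below the `z`-component of the test vector is chosen to place it in the kernel of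
    -- the form.
    have h1 := h (EuclideanSpace.single 2 (y.2.2 τ), (τ, 0)) (by simp)
    simpa using h1
  have h0 : v.1 0 = 0 := by
    have h1 := h (EuclideanSpace.single 1 1 + EuclideanSpace.single 2 (-(1 / 2 * y.1 0)), 0)
      (by simp)
    simpa using h1
  have h1 : v.1 1 = 0 := by
    have h1 := h (EuclideanSpace.single 0 1 + EuclideanSpace.single 2 (1 / 2 * y.1 1), 0)
      (by simp)
    simpa using h1
  have h2 : v.1 2 = 0 := by
    simpa [h0, h1, hq] using hv
  refine Prod.ext ?_ (Prod.ext hq hp)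
  ext i
  fin_cases i
  · exact h0
  · exact h1
  · exact h2

theorem finrank_modelVec : Module.finrank ℝ (ModelVec k) = 2 * k + 3 := by
  have h : Module.finrank ℝ (EuclideanSpace ℝ (Fin k) →L[ℝ] ℝ) = k := by
    rw [← LinearMap.toContinuousLinearMap.finrank_eq, Module.finrank_linearMap]
    simp
  rw [Module.finrank_prod, Module.finrank_prod, h]
  simp
  ring

variable {S : Type*} [TopologicalSpace S] [ChartedSpace (EuclideanSpace ℝ (Fin k)) S]
  [IsManifold (𝓡 k) ∞ S]
  {E : Type*} [NormedAddCommGroup E] [NormedSpace ℝ E] [FiniteDimensional ℝ E]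
  {H : Type*} [TopologicalSpace H] {I : ModelWithCorners ℝ E H} [I.Boundaryless]
  {M : Type*} [TopologicalSpace M] [ChartedSpace H M] [IsManifold I ∞ M] {α : OneForm I M}
  {f : EuclideanSpace ℝ (Fin 2) × S → M}

/-- A vector killed by the derivative of `Ψ` is annihilated by both `Ψ^*α = α₀` and `Ψ^*dα = dα₀`.
The contact condition for `α₀` makes it zero. -/
theorem mfderiv_injective_of_pull_eq_modelForm (hα : α.IsSmooth) {Ψ : Model (k := k) S → M}
    {m : Model (k := k) S} (hΨ : ∀ᶠ m' in 𝓝 m, ContMDiffAt (modelI k) I ∞ Ψ m')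
    (hform : ∀ᶠ m' in 𝓝 m, α.pull Ψ m' = modelForm (k := k) S m') :
    Function.Injective (mfderiv (modelI k) I Ψ m) := by
  have hm : m ∈ (modelChart m.2.1).source :=
    mem_modelChart_source.2 (mem_extChartAt_source (I := 𝓡 k) m.2.1)
  have hκ := mem_extChartAt_source (I := I) (Ψ m)
  have hd : MDifferentiableAt (modelI k) I Ψ m := hΨ.self_of_nhds.mdifferentiableAt (by simp)
  let g : ModelVec k → E := chartRep (modelI k) I (zeroPoint m.2.1) (Ψ m) Ψ
  let a := α.inChart (Ψ m)
  have hg : ∀ᶠ y in 𝓝 (modelChart m.2.1 m), ContDiffAt ℝ ∞ g y :=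
    eventually_contDiffAt_chartRep (I := modelI k) hm hκ hΨ
  have hgm : g (modelChart m.2.1 m) = extChartAt I (Ψ m) (Ψ m) := chartRep_extChartAt hm
  have hpull : ∀ᶠ y in 𝓝 (modelChart m.2.1 m), (a (g y)).comp (fderiv ℝ g y) = standardForm k y := by
    have h1 : ∀ᶠ m' in 𝓝 m, Ψ m' ∈ (extChartAt I (Ψ m)).source :=
      hΨ.self_of_nhds.continuousAt.eventually ((isOpen_extChartAt_source _).mem_nhds hκ)
    filter_upwards [eventually_mem_target (I := modelI k) hm,
      (tendsto_extChartAt_symm (I := modelI k) hm).eventually (hΨ.and (hform.and h1))] with y h2 h3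
    rw [← modelForm_inChart (S := S) h2]
    refine (α.inChart_pull h2 h3.2.2 (h3.1.mdifferentiableAt (by simp))).symm.trans ?_
    have h4 := h3.2.1
    refine ContinuousLinearMap.ext fun V => ?_
    exact DFunLike.congr_fun h4 _
  have hcurl : ∀ V W, curl (standardForm k) (modelChart m.2.1 m) V W
      = curl a (g (modelChart m.2.1 m)) (fderiv ℝ g (modelChart m.2.1 m) V)
        (fderiv ℝ g (modelChart m.2.1 m) W) := fun V W => by
    rw [← curl_pullback (hg.self_of_nhds.of_le (by norm_cast))]
    · exact congrArg (fun A : ModelVec k →L[ℝ] ModelVec k →L[ℝ] ℝ => A V W)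
        (curl_congr hpull).symm
    · rw [hgm]
      exact (hα.contDiffAt_inChart _ (mem_extChartAt_target _)).differentiableAt (by simp)
  have hker : ∀ V, fderiv ℝ g (modelChart m.2.1 m) V = 0 → V = 0 := fun V hV => by
    refine isContactAt_standardForm (modelChart m.2.1 m) V ?_ fun W _ => ?_
    · rw [← hpull.self_of_nhds, ContinuousLinearMap.comp_apply, hV, map_zero]
    · rw [hcurl, hV, map_zero]
      rfl
  refine (injective_iff_map_eq_zero _).2 fun v hv => ?_
  have h1 := fderiv_chartRep (I := modelI k) hm hκ hd v
  rw [hv, map_zero] at h1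
  exact mfderiv_extChartAt_injective (I := modelI k) hm ((hker _ h1).trans (map_zero _).symm)

theorem reebFlow_zero (x : M) : reebFlow α 0 x = x := by
  rw [reebFlow]
  split_ifs with h
  · exact h.choose_spec.1
  · rfl

theorem reebExtension_modelIncl (G : Model (k := k) S → M) (n : EuclideanSpace ℝ (Fin 2) × S) :
    reebExtension α G (modelIncl n) = G (modelIncl n) := by
  have h : (modelIncl (k := k) n).1 2 = 0 := by simp [modelIncl]
  rw [reebExtension, h, reebFlow_zero, modelFlat_modelIncl]

variable [CompactSpace S] [T2Space S] [T2Space M]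

theorem IsEllipticDisk.exists_pull_eq_modelForm (hα : IsContactForm α)
    (hf : IsEllipticDisk (k := k) α f) : ∃ Ψ : Model (k := k) S → M, ∀ s : S,
      (∀ᶠ m in 𝓝 (zeroPoint (k := k) s), ContMDiffAt (modelI k) I ∞ Ψ m ∧
        α.pull Ψ m = modelForm (k := k) S m) ∧
      ∀ᶠ n in 𝓝 ((0, s) : EuclideanSpace ℝ (Fin 2) × S), Ψ (modelIncl n) = f n := by
  obtain ⟨G, hG⟩ := hf.exists_isAdapted_one hα
  obtain ⟨hsm, hflat⟩ := hG.reebExtension_isFlatPerturbation hα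
  obtain ⟨h, hh⟩ := hflat.exists_isCorrection
  refine ⟨reebExtension α G ∘ h, fun s => ?_⟩
  have hz : h (zeroPoint s) = zeroPoint s := by
    rw [← modelIncl_zero]
    exact (hh.apply_incl s).self_of_nhds
  have ht : Tendsto h (𝓝 (zeroPoint s)) (𝓝 (zeroPoint s)) := by
    have h1 := (hh.smooth s).self_of_nhds.continuousAt
    rwa [ContinuousAt, hz] at h1
  constructor
  · filter_upwards [ht.eventually (hsm s), hh.smooth s, hh.form s] with m h1 h2 h3
    refine ⟨h1.comp m h2, ContinuousLinearMap.ext fun v => ?_⟩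
    rw [OneForm.pull_comp_apply _ (h1.mdifferentiableAt (by simp)) (h2.mdifferentiableAt (by simp))]
    have h4 := DFunLike.congr_fun h3 v
    -- The deformation with `σ = 1` is the pullback of `α` by the Reeb extension, and with `σ = 0`
    -- it is the model form.
    have h5 : deformedForm (k := k) (S := S)
        (fun m => α.pull (reebExtension α G) m - modelForm (k := k) S m) 1
        = α.pull (I := modelI k) (reebExtension α G) := by
      funext m
      rw [deformedForm, Pi.one_apply, one_smul]
      exact add_sub_cancel _ _
    have h6 : deformedForm (k := k) (S := S)
        (fun m => α.pull (reebExtension α G) m - modelForm (k := k) S m) 0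
        = modelForm (k := k) S := by
      funext m
      rw [deformedForm, Pi.zero_apply, zero_smul]
      exact add_zero _
    rw [h5, h6] at h4
    exact h4
  · filter_upwards [hh.apply_incl s, hG.apply_incl s] with n h1 h2
    rw [Function.comp_apply, h1, reebExtension_modelIncl, h2]

theorem IsEllipticDisk.exists_standard_neighborhood [Nonempty S] (hα : IsContactForm α)
    (hf : IsEllipticDisk (k := k) α f) (hinj : Function.Injective fun s => f (0, s))
    (hdim : Module.finrank ℝ E = 2 * k + 3) :
    ∃ Φ : OpenPartialHomeomorph M (Model (k := k) S), Φ.target ⊆ Metric.ball 0 1 ×ˢ univ ∧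
      ContMDiffOn I (modelI k) ∞ Φ Φ.source ∧ ContMDiffOn (modelI k) I ∞ Φ.symm Φ.target ∧
      (∀ p ∈ Φ.source, ∀ v : TangentSpace I p,
        α p v = modelForm (k := k) S (Φ p) (mfderiv I (modelI k) Φ p v)) ∧
      ∀ s : S, ∀ᶠ n in 𝓝 ((0, s) : EuclideanSpace ℝ (Fin 2) × S),
        f n ∈ Φ.source ∧ Φ (f n) = modelIncl n := by
  obtain ⟨Ψ, hΨ⟩ := hf.exists_pull_eq_modelForm hα
  have hΨz : ∀ s, Ψ (zeroPoint s) = f (0, s) := fun s => by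
    rw [← modelIncl_zero]
    exact (hΨ s).2.self_of_nhds
  let W : Set (Model (k := k) S) := interior {m | ContMDiffAt (modelI k) I ∞ Ψ m ∧
    α.pull Ψ m = modelForm (k := k) S m} ∩ (Metric.ball 0 1 ×ˢ univ)
  have hW : IsOpen W := isOpen_interior.inter (Metric.isOpen_ball.prod isOpen_univ)
  have hnear : ∀ m ∈ W, ∀ᶠ m' in 𝓝 m, ContMDiffAt (modelI k) I ∞ Ψ m' ∧
      α.pull Ψ m' = modelForm (k := k) S m' := fun m hm => mem_interior_iff_mem_nhds.1 hm.1
  have : Nonempty (Model (k := k) S) := ⟨zeroPoint (Classical.arbitrary S)⟩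
  obtain ⟨Φ, hK, hΦW, hsymm, hs1, hs2⟩ := exists_diffeomorph_near_compact (I := modelI k) (I' := I)
    (g := Ψ) (K := range (zeroPoint (k := k) (S := S))) (W := W)
    (isCompact_range contMDiff_zeroPoint.continuous) hW
    (by
      rintro _ ⟨s, rfl⟩
      refine ⟨mem_interior_iff_mem_nhds.2 (hΨ s).1, ?_, mem_univ _⟩
      exact Metric.mem_ball_self one_pos)
    (fun m hm => (hnear m hm).self_of_nhds.1)
    (fun m hm => mfderiv_injective_of_pull_eq_modelForm hα.smooth ((hnear m hm).mono fun _ h => h.1)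
      ((hnear m hm).mono fun _ h => h.2))
    (by
      rintro _ ⟨s, rfl⟩ _ ⟨s', rfl⟩ h
      rw [hΨz, hΨz] at h
      rw [hinj h])
    (finrank_modelVec.trans hdim.symm)
  refine ⟨Φ, hΦW.trans inter_subset_right, hs1, hs2, fun p hp v => ?_, fun s => ?_⟩
  · have h1 := Φ.map_source hp
    have h2 := hnear _ (hΦW h1)
    have h3 : Ψ (Φ p) = p := (hsymm _).symm.trans (Φ.left_inv hp)
    have h4 : MDifferentiableAt I (modelI k) Φ p :=
      (hs1.contMDiffAt (Φ.open_source.mem_nhds hp)).mdifferentiableAt (by simp)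
    have h5 := OneForm.pull_comp_apply α (h2.self_of_nhds.1.mdifferentiableAt (by simp)) h4 v
    have h6 : Ψ ∘ Φ =ᶠ[𝓝 p] id := by
      filter_upwards [Φ.open_source.mem_nhds hp] with q hq
      exact (hsymm _).symm.trans (Φ.left_inv hq)
    rw [h2.self_of_nhds.2, OneForm.pull_congr α h6] at h5
    rw [← h5, OneForm.pull, mfderiv_id]
    rfl
  · filter_upwards [(hΨ s).2, (tendsto_modelIncl s).eventually
      (Φ.open_target.mem_nhds (hK ⟨s, rfl⟩))] with n h1 h2
    rw [← h1, ← hsymm]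
    exact ⟨Φ.map_target h2, Φ.right_inv h2⟩

end StandardGerm

/-! ### Immersions and extension of functions from submanifolds. -/

section Immersions

open Topology Filter

/-- In the normal form the immersion is a linear inclusion, and reading off the first component
gives a left inverse `w`. Differentiating `w ∘ f = id` proves injectivity. -/
theorem mfderiv_injective_of_isImmersionAt
    {E : Type*} [NormedAddCommGroup E] [NormedSpace ℝ E]
    {H : Type*} [TopologicalSpace H] {I : ModelWithCorners ℝ E H}
    {X : Type*} [TopologicalSpace X] [ChartedSpace H X] [IsManifold I ∞ X]
    {E' : Type*} [NormedAddCommGroup E'] [NormedSpace ℝ E']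
    {H' : Type*} [TopologicalSpace H'] {I' : ModelWithCorners ℝ E' H'}
    {Y : Type*} [TopologicalSpace Y] [ChartedSpace H' Y] [IsManifold I' ∞ Y]
    {f : X → Y} {x : X} (hf : Manifold.IsImmersionAt I I' ∞ f x) :
    Function.Injective (mfderiv I I' f x) := by
  let D := hf.domChart
  let C := hf.codChart
  let L : E' → E := fun z => (hf.equiv.symm z).1
  have hL : ContDiff ℝ ∞ L := contDiff_fst.comp hf.equiv.symm.contDiff
  let w : Y → X := fun p => (D.extend I).symm (L (C.extend I' p))
  -- If `X` has a boundary, the first component may leave the range of the chart. The left inverse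
  -- is therefore used only within `u`, which contains the image of `f` near `f x`.
  let u : Set Y := C.source ∩ {p | L (C.extend I' p) ∈ I '' D.target}
  have hLf : ∀ x' ∈ D.source, L (C.extend I' (f x')) = D.extend I x' := fun x' hx' => by
    have h1 := hf.writtenInCharts ((D.extend I).map_source (by rwa [D.extend_source]))
    have h2 : (D.extend I).symm (D.extend I x') = x' :=
      (D.extend I).left_inv (by rwa [D.extend_source])
    simp only [Function.comp_apply] at h1
    rw [h2] at h1
    simp only [L, C, h1, ContinuousLinearEquiv.symm_apply_apply]
  have hmaps : D.source ⊆ f ⁻¹' u := fun x' hx' => by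
    refine ⟨hf.source_subset_preimage_source hx', ?_⟩
    rw [mem_ofPred_eq, hLf x' hx']
    exact ⟨D x', D.map_source hx', rfl⟩
  have hx := hf.mem_domChart_source
  have hw : ContMDiffWithinAt I' I ∞ w u (f x) := by
    have h1 : ContMDiffWithinAt I' 𝓘(ℝ, E) ∞ (fun p => L (C.extend I' p)) u (f x) :=
      (hL.contMDiff.contMDiffAt.comp (f x)
        (hf.codChart.contMDiffAt_extend hf.codChart_mem_maximalAtlas
          hf.mem_codChart_source)).contMDiffWithinAt
    have h2 := contMDiffOn_extend_symm hf.domChart_mem_maximalAtlas _ (hmaps hx).2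
    exact ContMDiffWithinAt.comp (f x) h2 h1 fun p hp => hp.2
  have h1 := (hw.mdifferentiableWithinAt (by simp)).hasMFDerivWithinAt.comp x
    (hf.contMDiffAt.mdifferentiableAt (by simp)).hasMFDerivAt.hasMFDerivWithinAt hmaps
  have h2 : w ∘ f =ᶠ[𝓝 x] id := by
    filter_upwards [D.open_source.mem_nhds hx] with x' hx'
    rw [Function.comp_apply, id]
    simp only [w]
    rw [hLf x' hx']
    exact (D.extend I).left_inv (by rwa [D.extend_source])
  have h3 := hasMFDerivAt_unique (hasMFDerivAt_id x)
    ((h1.hasMFDerivAt (D.open_source.mem_nhds hx)).congr_of_eventuallyEq h2.symm)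
  intro v v' hv
  have h4 := fun v => DFunLike.congr_fun h3 v
  refine (h4 v).trans (Eq.trans ?_ (h4 v').symm)
  exact congrArg (mfderivWithin I' I w u (f x)) hv

variable {E : Type*} [NormedAddCommGroup E] [NormedSpace ℝ E] [FiniteDimensional ℝ E]
  {H : Type*} [TopologicalSpace H] {I : ModelWithCorners ℝ E H} [I.Boundaryless]
  {X : Type*} [TopologicalSpace X] [ChartedSpace H X] [IsManifold I ∞ X]
  {E' : Type*} [NormedAddCommGroup E'] [NormedSpace ℝ E'] [FiniteDimensional ℝ E']
  {H' : Type*} [TopologicalSpace H'] {I' : ModelWithCorners ℝ E' H'} [I'.Boundaryless]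
  {Y : Type*} [TopologicalSpace Y] [ChartedSpace H' Y] [IsManifold I' ∞ Y]

theorem eventually_injective_mfderiv {g : X → E} {m : X}
    (hg : ∀ᶠ x in 𝓝 m, ContMDiffAt I 𝓘(ℝ, E) ∞ g x)
    (hinj : Function.Injective (mfderiv I 𝓘(ℝ, E) g m)) :
    ∀ᶠ x in 𝓝 m, Function.Injective (mfderiv I 𝓘(ℝ, E) g x) := by
  obtain ⟨r, h1, -, h2, -⟩ := exists_contMDiffAt_local_inverse hg.self_of_nhds hinj rfl
  -- Order `1` suffices, and unlike order `∞` it spreads from a point to a neighborhood.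
  have h3 : ∀ᶠ y in 𝓝 (g m), ContMDiffAt 𝓘(ℝ, E) I 1 r y :=
    (contMDiffAt_iff_contMDiffAt_nhds (by simp)).1 (h1.of_le (by norm_cast))
  filter_upwards [hg, h2.eventually_nhds, hg.self_of_nhds.continuousAt.eventually h3]
    with x h4 h5 h6
  have h7 := (h6.mdifferentiableAt (by simp)).hasMFDerivAt.comp x
    (h4.mdifferentiableAt (by simp)).hasMFDerivAt
  have h8 := hasMFDerivAt_unique (hasMFDerivAt_id x)
    (h7.congr_of_eventuallyEq (h5.mono fun z hz => hz.symm))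
  intro v v' hv
  have h9 := fun v => DFunLike.congr_fun h8 v
  refine (h9 v).trans (Eq.trans ?_ (h9 v').symm)
  exact congrArg (mfderiv 𝓘(ℝ, E) I r (g x)) hv

/-- A linear left inverse of the derivative, composed with a chart of `Y`, reduces the claim to a
map between equal dimensions. -/
theorem exists_contMDiffAt_left_inverse {g : X → Y} {m : X}
    (hg : ∀ᶠ x in 𝓝 m, ContMDiffAt I I' ∞ g x)
    (hinj : Function.Injective (mfderiv I I' g m)) :
    ∃ r : Y → X, r (g m) = m ∧ (∀ᶠ y in 𝓝 (g m), ContMDiffAt I' I ∞ r y) ∧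
      ∀ᶠ x in 𝓝 m, r (g x) = x := by
  have hκ := mem_extChartAt_source (I := I') (g m)
  have hd : MDifferentiableAt I I' g m := hg.self_of_nhds.mdifferentiableAt (by simp)
  let A : E →L[ℝ] E' := (mfderiv I' 𝓘(ℝ, E') (extChartAt I' (g m)) (g m)).comp (mfderiv I I' g m)
  have hA : Function.Injective A := (mfderiv_extChartAt_injective hκ).comp hinj
  obtain ⟨B₀, hB₀⟩ := (A : E →ₗ[ℝ] E').exists_leftInverse_of_injective (LinearMap.ker_eq_bot.2 hA)
  let B : E' →L[ℝ] E := LinearMap.toContinuousLinearMap B₀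
  have hB : ∀ v, B (A v) = v := fun v => LinearMap.congr_fun hB₀ v
  let G : X → E := fun x => B (extChartAt I' (g m) (g x))
  have hsrc : ∀ᶠ x in 𝓝 m, g x ∈ (extChartAt I' (g m)).source :=
    hg.self_of_nhds.continuousAt.eventually ((isOpen_extChartAt_source _).mem_nhds hκ)
  have hG : ∀ᶠ x in 𝓝 m, ContMDiffAt I 𝓘(ℝ, E) ∞ G x := by
    filter_upwards [hg, hsrc] with x h1 h2
    exact B.contDiff.contMDiff.contMDiffAt.comp x
      (ContMDiffAt.comp x (contMDiffAt_extChartAt' (by simpa using h2)) h1)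
  have hGd : mfderiv I 𝓘(ℝ, E) G m = B.comp A := by
    refine HasMFDerivAt.mfderiv ?_
    exact (B.hasMFDerivAt (x := extChartAt I' (g m) (g m))).comp m
      (((contMDiffAt_extChartAt (I := I') (n := ∞)).mdifferentiableAt
        (by simp)).hasMFDerivAt.comp m hd.hasMFDerivAt)
  have hGi : Function.Injective (mfderiv I 𝓘(ℝ, E) G m) := by
    rw [hGd]
    intro v v' h
    exact (hB v).symm.trans (h.trans (hB v'))
  have hev := hG.and (eventually_injective_mfderiv hG hGi)
  have : Nonempty X := ⟨m⟩
  obtain ⟨Φ, h1, -, h3, h4, -⟩ := exists_diffeomorph_near_compact (I := I) (I' := 𝓘(ℝ, E)) (g := G)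
    (K := {m}) (W := interior {x | ContMDiffAt I 𝓘(ℝ, E) ∞ G x ∧
      Function.Injective (mfderiv I 𝓘(ℝ, E) G x)}) isCompact_singleton isOpen_interior
    (singleton_subset_iff.2 (mem_interior_iff_mem_nhds.2 hev))
    (fun x hx => (interior_subset hx).1) (fun x hx => (interior_subset hx).2)
    (injOn_singleton _ _) rfl
  have hm : m ∈ Φ.target := h1 rfl
  have hleft : ∀ x ∈ Φ.target, Φ (G x) = x := fun x hx => by
    rw [← h3]
    exact Φ.right_inv hx
  refine ⟨fun y => Φ (B (extChartAt I' (g m) y)), hleft m hm, ?_, ?_⟩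
  · have h5 : Tendsto (fun y => B (extChartAt I' (g m) y)) (𝓝 (g m)) (𝓝 (G m)) :=
      (B.continuous.tendsto _).comp (tendsto_extChartAt hκ)
    have h6 : G m ∈ Φ.source := by
      rw [← h3]
      exact Φ.map_target hm
    filter_upwards [h5.eventually (Φ.open_source.mem_nhds h6),
      (isOpen_extChartAt_source (I := I') (g m)).mem_nhds hκ] with y h7 h8
    exact ContMDiffAt.comp y (h4.contMDiffAt (Φ.open_source.mem_nhds h7))
      (B.contDiff.contMDiff.contMDiffAt.comp y (contMDiffAt_extChartAt' (by simpa using h8)))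
  · filter_upwards [Φ.open_target.mem_nhds hm] with x hx
    exact hleft x hx

/-- A positive smooth function on an embedded submanifold extends, near a compact set, to a positive
smooth function on the ambient manifold. -/
theorem exists_contMDiff_pos_extension [T2Space Y] [SigmaCompactSpace Y] {g : X → Y} {A K : Set X}
    (hA : IsOpen A) (hK : IsCompact K) (hKA : K ⊆ A) (hg : ContMDiffOn I I' ∞ g A)
    (hinj : ∀ a ∈ A, Function.Injective (mfderiv I I' g a))
    (hemb : ∀ a ∈ A, ∀ B ∈ 𝓝 a, ∃ O ∈ 𝓝 (g a), ∀ b ∈ A, g b ∈ O → b ∈ B)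
    {c : X → ℝ} (hc : ContMDiffOn I 𝓘(ℝ, ℝ) ∞ c A) (hpos : ∀ a ∈ A, 0 < c a) :
    ∃ h : Y → ℝ, ContMDiff I' 𝓘(ℝ, ℝ) ∞ h ∧ (∀ y, 0 < h y) ∧ ∀ a ∈ K, h (g a) = c a := by
  -- The admissible values at each point form a convex set, so local solutions can be averaged. Near
  -- `g '' K` a local solution is `c ∘ r` with a left inverse `r`; off this closed set the constant
  -- `1` will do.
  obtain ⟨h, hh⟩ := exists_contMDiffMap_forall_mem_convex_of_local (n := (⊤ : ℕ∞)) I'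
    (t := fun y => {x : ℝ | 0 < x ∧ ∀ a ∈ K, g a = y → x = c a})
    (fun y x hx x' hx' α β hα hβ hαβ => by
      refine ⟨(convex_Ioi (0 : ℝ)) hx.1 hx'.1 hα hβ hαβ, fun a ha hay => ?_⟩
      rw [hx.2 a ha hay, hx'.2 a ha hay, ← add_smul, hαβ, one_smul])
    (fun y => by
      by_cases hy : y ∈ g '' K
      · obtain ⟨a, ha, rfl⟩ := hy
        have hga : ∀ᶠ x in 𝓝 a, ContMDiffAt I I' ∞ g x := by
          filter_upwards [hA.mem_nhds (hKA ha)] with x hx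
          exact hg.contMDiffAt (hA.mem_nhds hx)
        obtain ⟨r, h1, h2, h3⟩ := exists_contMDiffAt_left_inverse hga (hinj a (hKA ha))
        -- No distant part of `g '' A` comes near `g a`, so `r` is a left inverse at every `b ∈ A`
        -- with `g b ∈ O`.
        obtain ⟨O, hO, hOr⟩ := hemb a (hKA ha) _ h3
        have h4 : ∀ᶠ y in 𝓝 (g a), r y ∈ A := by
          have h5 := h2.self_of_nhds.continuousAt
          rw [ContinuousAt, h1] at h5
          exact h5.eventually (hA.mem_nhds (hKA ha))
        refine ⟨_, h2.and (h4.and hO), c ∘ r, fun y hy => ?_, fun y hy => ⟨hpos _ hy.2.1, ?_⟩⟩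
        · exact ((hc.contMDiffAt (hA.mem_nhds hy.2.1)).comp y hy.1).contMDiffWithinAt
        · rintro b hb rfl
          have h5 : r (g b) = b := hOr b (hKA hb) hy.2.2
          rw [Function.comp_apply, h5]
      · have hcl : IsClosed (g '' K) := (hK.image_of_continuousOn (hg.continuousOn.mono hKA)).isClosed
        refine ⟨_, hcl.isOpen_compl.mem_nhds hy, fun _ => 1, contMDiffOn_const,
          fun z hz => ⟨one_pos, fun a ha haz => (hz ⟨a, ha, haz⟩).elim⟩⟩)
  exact ⟨h, h.contMDiff, fun y => (hh y).1, fun a ha => (hh (g a)).2 a ha rfl⟩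

end Immersions

/-! ### Conformal change of contact forms. -/

section ConformalChange

open Topology Filter

variable {E : Type*} [NormedAddCommGroup E] [NormedSpace ℝ E]

theorem curl_smul {b : E → E →L[ℝ] ℝ} {c : E → ℝ} {y : E} (hb : DifferentiableAt ℝ b y)
    (hc : DifferentiableAt ℝ c y) (v w : E) :
    curl (fun z => c z • b z) y v w
      = c y * curl b y v w + (fderiv ℝ c y v * b y w - fderiv ℝ c y w * b y v) := by
  simp only [curl_apply, (hc.hasFDerivAt.fun_smul hb.hasFDerivAt).fderiv]
  simp
  ring

variable {H : Type*} [TopologicalSpace H] {I : ModelWithCorners ℝ E H} [I.Boundaryless]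
  {X : Type*} [TopologicalSpace X] [ChartedSpace H X] [IsManifold I ∞ X]

/-- In `d(h α) = h dα + dh ∧ α` the second term vanishes on pairs of vectors in `ker α`, so
nondegeneracy there is unaffected. -/
theorem IsContactForm.smul {α : OneForm I X} (hα : IsContactForm α) {h : X → ℝ}
    (hh : ContMDiff I 𝓘(ℝ, ℝ) ∞ h) (hpos : ∀ x, 0 < h x) :
    IsContactForm (fun x => h x • α x) := by
  have hin : ∀ (x₀ : X) (y : E), OneForm.inChart (I := I) (fun x => h x • α x) x₀ y
      = h ((extChartAt I x₀).symm y) • α.inChart x₀ y := fun x₀ y => rfl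
  have hc : ∀ (x₀ : X), ∀ y ∈ (extChartAt I x₀).target,
      ContDiffAt ℝ ∞ (fun y => h ((extChartAt I x₀).symm y)) y := fun x₀ y hy =>
    (hh.contMDiffAt.comp y (contMDiffAt_extChartAt_symm hy)).contDiffAt
  have hsm : OneForm.IsSmooth (I := I) (fun x => h x • α x) := fun x₀ => by
    refine OneForm.isSmoothAt_of_contDiffAt_inChart ?_
    have hy := mem_extChartAt_target (I := I) x₀
    exact contDiffAt_smul_form (hc x₀ _ hy) (hα.smooth.contDiffAt_inChart x₀ hy)
  refine ⟨hα.odd_finrank, hsm, fun x h0 => ?_, fun x v hv hvw => ?_⟩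
  · exact hα.ne_zero x ((smul_eq_zero_iff_right (hpos x).ne').1 h0)
  · have hα0 : ∀ w, h x • α x w = 0 → α x w = 0 := fun w hw =>
      (smul_eq_zero_iff_right (hpos x).ne').1 hw
    refine hα.nondegenerate x v (hα0 v hv) fun w hw => ?_
    have h1 := hvw w ((congrArg (h x • ·) hw).trans (smul_zero _))
    have hx := mem_extChartAt_source (I := I) x
    have hy := mem_extChartAt_target (I := I) x
    rw [OneForm.extDeriv_eq hsm hx] at h1
    have h2 := curl_smul ((hα.smooth.contDiffAt_inChart x hy).differentiableAt (by simp))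
      ((hc x _ hy).differentiableAt (by simp)) (mfderiv I 𝓘(ℝ, E) (extChartAt I x) x v)
      (mfderiv I 𝓘(ℝ, E) (extChartAt I x) x w)
    rw [α.inChart_apply_mfderiv hx, α.inChart_apply_mfderiv hx, hw, hα0 v hv, mul_zero, mul_zero,
      sub_zero, add_zero, (extChartAt I x).left_inv hx, ← OneForm.extDeriv_eq hα.smooth hx] at h2
    exact (mul_eq_zero.1 (h2.symm.trans h1)).resolve_left (hpos x).ne'

end ConformalChange

/-! ### Normalisation of elliptic charts and the standard neighborhood. -/

section Twist

open Topology Filter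

/-- The map `(x, y) ↦ (x, c y) / √2` of the plane. -/
def twist (c : ℝ) : EuclideanSpace ℝ (Fin 2) →L[ℝ] EuclideanSpace ℝ (Fin 2) :=
  (√2)⁻¹ • ((EuclideanSpace.proj 0).smulRight (EuclideanSpace.single 0 1)
    + c • (EuclideanSpace.proj 1).smulRight (EuclideanSpace.single 1 1))

@[simp] theorem twist_apply_zero (c : ℝ) (x : EuclideanSpace ℝ (Fin 2)) :
    twist c x 0 = (√2)⁻¹ * x 0 := by
  simp [twist]

@[simp] theorem twist_apply_one (c : ℝ) (x : EuclideanSpace ℝ (Fin 2)) :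
    twist c x 1 = (√2)⁻¹ * (c * x 1) := by
  simp [twist]

theorem inv_sqrt_two_mul_self : (√2)⁻¹ * (√2)⁻¹ = (1 / 2 : ℝ) := by
  rw [← mul_inv, Real.mul_self_sqrt (by norm_num)]
  norm_num

/-- For `c^2 = 1` the square of `twist c` is multiplication by `1/2`, so twice the map is its own
inverse. -/
theorem twist_two_smul_twist {c : ℝ} (hc : c * c = 1) (x : EuclideanSpace ℝ (Fin 2)) :
    twist c ((2 : ℝ) • twist c x) = x := by
  ext i
  fin_cases i
  · have h : 2 * ((√2)⁻¹ * ((√2)⁻¹ * x 0)) = x 0 := by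
      linear_combination 2 * x 0 * inv_sqrt_two_mul_self
    simpa using h
  · have h : 2 * ((√2)⁻¹ * (c * ((√2)⁻¹ * (c * x 1)))) = x 1 := by
      linear_combination 2 * x 1 * c * c * inv_sqrt_two_mul_self + x 1 * hc
    simpa using h

theorem injective_twist {c : ℝ} (hc : c * c = 1) : Function.Injective (twist c) := by
  refine Function.LeftInverse.injective (g := fun x => twist c ((2 : ℝ) • x)) fun x => ?_
  have h : (2 : ℝ) • twist c x = twist c ((2 : ℝ) • x) := (map_smul _ _ _).symm
  exact twist_two_smul_twist hc x

theorem continuous_twist {Z : Type*} [TopologicalSpace Z] {c : Z → ℝ}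
    {x : Z → EuclideanSpace ℝ (Fin 2)} (hc : Continuous c) (hx : Continuous x) :
    Continuous fun z => twist (c z) (x z) := by
  unfold twist
  fun_prop

/-- The sign of `g` along `0 × S`. -/
def centerSign {S : Type*} (g : EuclideanSpace ℝ (Fin 2) × S → ℝ) (s : S) : ℝ :=
  (|g (0, s)|)⁻¹ * g (0, s)

theorem centerSign_mul_self {S : Type*} {g : EuclideanSpace ℝ (Fin 2) × S → ℝ} {s : S}
    (h : g (0, s) ≠ 0) : centerSign g s * centerSign g s = 1 := by
  have h1 := abs_pos.2 h
  have h2 := abs_mul_abs_self (g (0, s))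
  rw [centerSign]
  field_simp
  rw [sq, sq, h2]

theorem eq_centerSign_mul_abs {S : Type*} {g : EuclideanSpace ℝ (Fin 2) × S → ℝ} {s : S}
    {x : ℝ} (h : 0 < x * g (0, s)) : x = centerSign g s * |x| := by
  rw [centerSign]
  rcases pos_and_pos_or_neg_and_neg_of_mul_pos h with ⟨h1, h2⟩ | ⟨h1, h2⟩
  · rw [abs_of_pos h1, abs_of_pos h2, inv_mul_cancel₀ h2.ne', one_mul]
  · rw [abs_of_neg h1, abs_of_neg h2, inv_neg, neg_mul, inv_mul_cancel₀ h2.ne, neg_mul_neg,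
      one_mul]

end Twist

section EllipticChart

open Topology Filter

variable {k : ℕ}
  {M : Type*} [TopologicalSpace M] [ChartedSpace (EuclideanSpace ℝ (Fin (2 * k + 3))) M]
  [IsManifold (𝓡 (2 * k + 3)) ∞ M]
  {HF : Type*} [TopologicalSpace HF] {IF : ModelWithCorners ℝ (EuclideanSpace ℝ (Fin (k + 2))) HF}
  {F : Type*} [TopologicalSpace F] [ChartedSpace HF F] [IsManifold IF ∞ F]
  {S : Type*} [TopologicalSpace S] [ChartedSpace (EuclideanSpace ℝ (Fin k)) S]
  [IsManifold (𝓡 k) ∞ S]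
  {α : OneForm (𝓡 (2 * k + 3)) M} {ι : F → M} {j : S → F} {r : ℝ}
  {ψ : OpenPartialHomeomorph (EuclideanSpace ℝ (Fin 2) × S) F}
  {g : EuclideanSpace ℝ (Fin 2) × S → ℝ}

theorem IsEllipticChart.zero_mem_source (hψ : IsEllipticChart IF α ι j r ψ g) (s : S) :
    ((0, s) : EuclideanSpace ℝ (Fin 2) × S) ∈ ψ.source := by
  rw [hψ.source_eq]
  exact ⟨Metric.mem_ball_self hψ.radius_pos, mem_univ _⟩

theorem IsEllipticChart.contMDiffOn_comp (hψ : IsEllipticChart IF α ι j r ψ g)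
    (hι : Manifold.IsSmoothEmbedding IF (𝓡 (2 * k + 3)) ∞ ι) :
    ContMDiffOn ((𝓡 2).prod (𝓡 k)) (𝓡 (2 * k + 3)) ∞ (ι ∘ ψ) ψ.source :=
  hι.contMDiff.comp_contMDiffOn hψ.smooth

theorem IsEllipticChart.mfderiv_comp_apply (hψ : IsEllipticChart IF α ι j r ψ g)
    (hι : Manifold.IsSmoothEmbedding IF (𝓡 (2 * k + 3)) ∞ ι) {a : EuclideanSpace ℝ (Fin 2) × S}
    (ha : a ∈ ψ.source) (v : TangentSpace ((𝓡 2).prod (𝓡 k)) a) :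
    mfderiv ((𝓡 2).prod (𝓡 k)) (𝓡 (2 * k + 3)) (ι ∘ ψ) a v
      = mfderiv IF (𝓡 (2 * k + 3)) ι (ψ a) (mfderiv ((𝓡 2).prod (𝓡 k)) IF ψ a v) :=
  DFunLike.congr_fun (mfderiv_comp a (hι.contMDiff.contMDiffAt.mdifferentiableAt (by simp))
    ((hψ.smooth.contMDiffAt (ψ.open_source.mem_nhds ha)).mdifferentiableAt (by simp))) v

theorem IsEllipticChart.mfderiv_comp_injective (hψ : IsEllipticChart IF α ι j r ψ g)
    (hι : Manifold.IsSmoothEmbedding IF (𝓡 (2 * k + 3)) ∞ ι) {a : EuclideanSpace ℝ (Fin 2) × S}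
    (ha : a ∈ ψ.source) :
    Function.Injective (mfderiv ((𝓡 2).prod (𝓡 k)) (𝓡 (2 * k + 3)) (ι ∘ ψ) a) := by
  have h1 : MDifferentiableAt ((𝓡 2).prod (𝓡 k)) IF ψ a :=
    (hψ.smooth.contMDiffAt (ψ.open_source.mem_nhds ha)).mdifferentiableAt (by simp)
  have h2 : MDifferentiableAt IF ((𝓡 2).prod (𝓡 k)) ψ.symm (ψ a) :=
    (hψ.smooth_symm.contMDiffAt (ψ.open_target.mem_nhds (ψ.map_source ha))).mdifferentiableAt
      (by simp)
  have h3 : ψ.symm ∘ ψ =ᶠ[𝓝 a] id := by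
    filter_upwards [ψ.open_source.mem_nhds ha] with b hb
    exact ψ.left_inv hb
  have h4 := hasMFDerivAt_unique (hasMFDerivAt_id a)
    ((h2.hasMFDerivAt.comp a h1.hasMFDerivAt).congr_of_eventuallyEq h3.symm)
  intro v w h
  rw [hψ.mfderiv_comp_apply hι ha, hψ.mfderiv_comp_apply hι ha] at h
  have h5 := mfderiv_injective_of_isImmersionAt (hι.isImmersion.isImmersionAt (ψ a)) h
  have h6 := fun v => DFunLike.congr_fun h4 v
  refine (h6 v).trans (Eq.trans ?_ (h6 w).symm)
  exact congrArg (mfderiv IF ((𝓡 2).prod (𝓡 k)) ψ.symm (ψ a)) h5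

theorem IsEllipticChart.pull_comp (hψ : IsEllipticChart IF α ι j r ψ g)
    (hι : Manifold.IsSmoothEmbedding IF (𝓡 (2 * k + 3)) ∞ ι) {a : EuclideanSpace ℝ (Fin 2) × S}
    (ha : a ∈ ψ.source) (v : TangentSpace ((𝓡 2).prod (𝓡 k)) a) :
    α ((ι ∘ ψ) a) (mfderiv ((𝓡 2).prod (𝓡 k)) (𝓡 (2 * k + 3)) (ι ∘ ψ) a v)
      = g a * (a.1 0 * v.1 1 - a.1 1 * v.1 0) := by
  refine Eq.trans ?_ (hψ.form_eq a ha v.1 v.2)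
  exact congrArg (α (ι (ψ a))) (hψ.mfderiv_comp_apply hι ha v)

theorem IsEllipticChart.continuous_centerSign (hψ : IsEllipticChart IF α ι j r ψ g) :
    Continuous (centerSign g) := by
  have h1 : Continuous fun s : S => g (0, s) := by
    refine continuous_iff_continuousAt.2 fun s => ?_
    exact ContinuousAt.comp (g := g)
      (hψ.smooth_factor.continuousOn.continuousAt (ψ.open_source.mem_nhds (hψ.zero_mem_source s)))
      (continuous_const.prodMk continuous_id).continuousAt
  exact (h1.abs.inv₀ fun s => abs_ne_zero.2 (hψ.factor_ne_zero _ (hψ.zero_mem_source s))).mul h1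

theorem IsEllipticChart.centerSign_mul_self (hψ : IsEllipticChart IF α ι j r ψ g) (s : S) :
    centerSign g s * centerSign g s = 1 :=
  ContactGeometry.centerSign_mul_self (hψ.factor_ne_zero _ (hψ.zero_mem_source s))

/-- A continuous function with values `1` and `-1` is locally constant. As `S` may be disconnected,
its sign can differ between components. -/
theorem IsEllipticChart.eventually_centerSign_eq (hψ : IsEllipticChart IF α ι j r ψ g) (s₀ : S) :
    ∀ᶠ s in 𝓝 s₀, centerSign g s = centerSign g s₀ := by
  have h1 : ∀ᶠ s in 𝓝 s₀, 0 < centerSign g s * centerSign g s₀ := by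
    have h2 : ContinuousAt (fun s => centerSign g s * centerSign g s₀) s₀ :=
      (hψ.continuous_centerSign.mul continuous_const).continuousAt
    refine h2.eventually (lt_mem_nhds ?_)
    exact one_pos.trans_eq (hψ.centerSign_mul_self s₀).symm
  filter_upwards [h1] with s hs
  have h2 := hψ.centerSign_mul_self s
  have h3 := hψ.centerSign_mul_self s₀
  rcases mul_self_eq_one_iff.1 h2 with h4 | h4 <;> rcases mul_self_eq_one_iff.1 h3 with h5 | h5 <;>
    rw [h4, h5] at hs ⊢ <;> norm_num at hs

theorem hasMFDerivAt_twist (c : ℝ) (n : EuclideanSpace ℝ (Fin 2) × S) :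
    HasMFDerivAt ((𝓡 2).prod (𝓡 k)) ((𝓡 2).prod (𝓡 k))
      (fun n : EuclideanSpace ℝ (Fin 2) × S => (twist c n.1, n.2)) n
      (((twist c).comp (ContinuousLinearMap.fst ℝ _ _)).prod (ContinuousLinearMap.snd ℝ _ _)) :=
  (((twist c).hasMFDerivAt (x := n.1)).comp n (hasMFDerivAt_fst (I := 𝓡 2) (I' := 𝓡 k) n)).prodMk
    (hasMFDerivAt_snd (I := 𝓡 2) (I' := 𝓡 k) n)

/-- The twist multiplies `x dy - y dx` by `c / 2`, where `c` is the sign of `g`. Since `g = c |g|`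
and `h |g| = 1`, the pullback of `h α` is `(x dy - y dx) / 2`. Near a given point of `0 × S` the
sign is constant and `f` is a composition with a fixed linear map. -/
theorem IsEllipticChart.isEllipticDisk (hψ : IsEllipticChart IF α ι j r ψ g)
    (hι : Manifold.IsSmoothEmbedding IF (𝓡 (2 * k + 3)) ∞ ι) {h : M → ℝ}
    (hh : ∀ s : S, ∀ᶠ a in 𝓝 ((0, s) : EuclideanSpace ℝ (Fin 2) × S), h (ι (ψ a)) * |g a| = 1) :
    IsEllipticDisk (k := k) (fun p => h p • α p)
      (fun n : EuclideanSpace ℝ (Fin 2) × S => ι (ψ (twist (centerSign g n.2) n.1, n.2))) := by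
  have key : ∀ s₀ : S, ∃ c : ℝ, c * c = 1 ∧ ∀ᶠ n in 𝓝 ((0, s₀) : EuclideanSpace ℝ (Fin 2) × S),
      ((fun n : EuclideanSpace ℝ (Fin 2) × S => ι (ψ (twist (centerSign g n.2) n.1, n.2)))
        =ᶠ[𝓝 n] (ι ∘ ψ) ∘ fun n => (twist c n.1, n.2)) ∧
      (twist c n.1, n.2) ∈ ψ.source ∧ h (ι (ψ (twist c n.1, n.2))) * |g (twist c n.1, n.2)| = 1 ∧
      g (twist c n.1, n.2) = c * |g (twist c n.1, n.2)| := by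
    intro s₀
    refine ⟨centerSign g s₀, hψ.centerSign_mul_self s₀, ?_⟩
    have h0 := hψ.zero_mem_source s₀
    have ht : Tendsto (fun n : EuclideanSpace ℝ (Fin 2) × S => (twist (centerSign g s₀) n.1, n.2))
        (𝓝 (0, s₀)) (𝓝 (0, s₀)) := by
      have h1 := (hasMFDerivAt_twist (k := k) (centerSign g s₀)
        ((0, s₀) : EuclideanSpace ℝ (Fin 2) × S)).continuousAt
      rw [ContinuousAt] at h1
      simpa using h1
    have h1 : ∀ᶠ n in 𝓝 ((0, s₀) : EuclideanSpace ℝ (Fin 2) × S),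
        centerSign g n.2 = centerSign g s₀ :=
      (continuous_snd.tendsto ((0, s₀) : EuclideanSpace ℝ (Fin 2) × S)).eventually
        (hψ.eventually_centerSign_eq s₀)
    have h2 : ∀ᶠ a in 𝓝 ((0, s₀) : EuclideanSpace ℝ (Fin 2) × S), 0 < g a * g (0, s₀) := by
      have h3 : ContinuousAt (fun a => g a * g (0, s₀)) (0, s₀) :=
        (hψ.smooth_factor.continuousOn.continuousAt (ψ.open_source.mem_nhds h0)).mul
          continuousAt_const
      exact h3.eventually (lt_mem_nhds (mul_self_pos.2 (hψ.factor_ne_zero _ h0)))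
    filter_upwards [h1.eventually_nhds, ht.eventually (ψ.open_source.mem_nhds h0),
      ht.eventually (hh s₀), ht.eventually h2] with n h3 h4 h5 h6
    refine ⟨?_, h4, h5, eq_centerSign_mul_abs h6⟩
    filter_upwards [h3] with n' hn'
    rw [hn']
    rfl
  have hG := hψ.contMDiffOn_comp hι
  refine ⟨fun s => ?_, fun s => ?_, fun s => ?_⟩
  all_goals obtain ⟨c, hc, hev⟩ := key s
  · filter_upwards [hev] with n hn
    refine ContMDiffAt.congr_of_eventuallyEq ?_ hn.1
    have h1 : ContMDiffAt ((𝓡 2).prod (𝓡 k)) ((𝓡 2).prod (𝓡 k)) ∞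
        (fun n : EuclideanSpace ℝ (Fin 2) × S => (twist c n.1, n.2)) n :=
      ((twist c).contDiff.contMDiff.contMDiffAt.comp n contMDiffAt_fst).prodMk contMDiffAt_snd
    exact ContMDiffAt.comp n (hG.contMDiffAt (ψ.open_source.mem_nhds hn.2.1)) h1
  · filter_upwards [hev] with n hn v
    rw [OneForm.pull_congr _ hn.1, OneForm.pull_comp_apply _ (g := ι ∘ ψ)
      (f := fun n : EuclideanSpace ℝ (Fin 2) × S => (twist c n.1, n.2)) ((hG.contMDiffAt (ψ.open_source.mem_nhds hn.2.1)).mdifferentiableAt (by simp))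
      (hasMFDerivAt_twist c n).mdifferentiableAt, (hasMFDerivAt_twist c n).mfderiv]
    have h1 := hψ.pull_comp hι hn.2.1 (twist c v.1, v.2)
    have h2 := congrArg (h (ι (ψ (twist c n.1, n.2))) * ·) h1
    refine Eq.trans h2 ?_
    simp only [twist_apply_zero, twist_apply_one]
    rw [hn.2.2.2]
    linear_combination (n.1 0 * v.1 1 - n.1 1 * v.1 0) * (c * c * ((√2)⁻¹ * (√2)⁻¹) * hn.2.2.1
      + ((√2)⁻¹ * (√2)⁻¹) * hc + inv_sqrt_two_mul_self)
  · have hn := hev.self_of_nhds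
    have hG' : MDifferentiableAt ((𝓡 2).prod (𝓡 k)) (𝓡 (2 * k + 3)) (ι ∘ ψ)
        (twist c (0, s).1, (0, s).2) :=
      (hG.contMDiffAt (ψ.open_source.mem_nhds hn.2.1)).mdifferentiableAt (by simp)
    have h1 := ((hG'.hasMFDerivAt.comp ((0, s) : EuclideanSpace ℝ (Fin 2) × S)
      (hasMFDerivAt_twist c (0, s))).congr_of_eventuallyEq hn.1).mfderiv
    intro v w h
    rw [h1] at h
    have h2 := hψ.mfderiv_comp_injective hι hn.2.1 h
    have h3 : (twist c v.1, v.2) = (twist c w.1, w.2) := h2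
    exact Prod.ext (injective_twist hc (Prod.mk.inj h3).1) (Prod.mk.inj h3).2

/-- As `ι` is an embedding, other parts of `F` can be kept away from a neighborhood of `S` in `M`.
-/
theorem exists_isOpen_preimage_eq_image
    (hι : Manifold.IsSmoothEmbedding IF (𝓡 (2 * k + 3)) ∞ ι)
    {B : Set (EuclideanSpace ℝ (Fin 2) × S)} (hB : IsOpen B) (hBs : B ⊆ ψ.source) :
    ∃ O : Set M, IsOpen O ∧ ∀ q, ι q ∈ O ↔ q ∈ ψ '' B := by
  obtain ⟨O, hO, h⟩ := hι.isEmbedding.isInducing.isOpen_iff.1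
    (ψ.isOpen_image_of_subset_source hB hBs)
  exact ⟨O, hO, fun q => by rw [← h]; rfl⟩

theorem IsEllipticChart.exists_conformal_factor [T2Space M] [SecondCountableTopology M]
    [CompactSpace S] (hψ : IsEllipticChart IF α ι j r ψ g)
    (hι : Manifold.IsSmoothEmbedding IF (𝓡 (2 * k + 3)) ∞ ι) :
    ∃ h : M → ℝ, ContMDiff (𝓡 (2 * k + 3)) 𝓘(ℝ, ℝ) ∞ h ∧ (∀ p, 0 < h p) ∧
      ∀ s : S, ∀ᶠ a in 𝓝 ((0, s) : EuclideanSpace ℝ (Fin 2) × S), h (ι (ψ a)) * |g a| = 1 := by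
  have : LocallyCompactSpace M := 
    ChartedSpace.locallyCompactSpace (EuclideanSpace ℝ (Fin (2 * k + 3))) M
  -- The function `1 / |g|` is extended from the image of the closed disk of half the radius times
  -- `S`, which is compact and still a neighborhood of `0 × S`.
  obtain ⟨h, h1, h2, h3⟩ := exists_contMDiff_pos_extension (I := (𝓡 2).prod (𝓡 k))
    (I' := 𝓡 (2 * k + 3)) (g := ι ∘ ψ) (A := ψ.source)
    (K := Metric.closedBall 0 (r / 2) ×ˢ univ) (c := fun a => (|g a|)⁻¹) ψ.open_source
    ((isCompact_closedBall _ _).prod isCompact_univ)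
    (by
      rw [hψ.source_eq]
      exact prod_mono (Metric.closedBall_subset_ball (half_lt_self hψ.radius_pos)) subset_rfl)
    (hψ.contMDiffOn_comp hι) (fun a ha => hψ.mfderiv_comp_injective hι ha)
    (fun a ha B hB => by
      obtain ⟨O, hO, hOB⟩ := exists_isOpen_preimage_eq_image hι
        (isOpen_interior.inter ψ.open_source) (inter_subset_right (s := interior B))
      refine ⟨O, hO.mem_nhds ((hOB _).2 ⟨a, ⟨mem_interior_iff_mem_nhds.2 hB, ha⟩, rfl⟩),
        fun b hb hbO => ?_⟩
      obtain ⟨b', hb', hbb⟩ := (hOB _).1 hbO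
      rw [← ψ.injOn hb'.2 hb hbb]
      exact interior_subset hb'.1)
    (fun a ha => by
      have h1 : ContDiffAt ℝ ∞ (fun t : ℝ => (|t|)⁻¹) (g a) :=
        (contDiffAt_abs (hψ.factor_ne_zero a ha)).inv (abs_ne_zero.2 (hψ.factor_ne_zero a ha))
      exact h1.contMDiffAt.comp_contMDiffWithinAt a (hψ.smooth_factor a ha))
    fun a ha => inv_pos.2 (abs_pos.2 (hψ.factor_ne_zero a ha))
  refine ⟨h, h1, h2, fun s => ?_⟩
  have hball : Metric.closedBall (0 : EuclideanSpace ℝ (Fin 2)) (r / 2) ×ˢ (univ : Set S)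
      ∈ 𝓝 ((0, s) : EuclideanSpace ℝ (Fin 2) × S) :=
    prod_mem_nhds (Metric.closedBall_mem_nhds _ (half_pos hψ.radius_pos)) univ_mem
  filter_upwards [hball, ψ.open_source.mem_nhds (hψ.zero_mem_source s)] with a ha ha'
  have h4 : h (ι (ψ a)) = (|g a|)⁻¹ := h3 a ha
  rw [h4, inv_mul_cancel₀ (abs_ne_zero.2 (hψ.factor_ne_zero a ha'))]

theorem IsEllipticChart.exists_isStandardNeighborhood [T2Space M] [CompactSpace S] [Nonempty S]
    (hα : IsContactForm α) (hψ : IsEllipticChart IF α ι j r ψ g)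
    (hι : Manifold.IsSmoothEmbedding IF (𝓡 (2 * k + 3)) ∞ ι) {h : M → ℝ}
    (hsm : ContMDiff (𝓡 (2 * k + 3)) 𝓘(ℝ, ℝ) ∞ h) (hpos : ∀ p, 0 < h p)
    (hh : ∀ s : S, ∀ᶠ a in 𝓝 ((0, s) : EuclideanSpace ℝ (Fin 2) × S), h (ι (ψ a)) * |g a| = 1) :
    ∃ Φ : OpenPartialHomeomorph M (Model (k := k) S),
      IsStandardNeighborhood α ι j Φ (fun p => (h p)⁻¹) := by
  let f : EuclideanSpace ℝ (Fin 2) × S → M := fun n => ι (ψ (twist (centerSign g n.2) n.1, n.2))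
  have hf0 : ∀ s, f (0, s) = ι (j s) := fun s => by
    simp only [f, map_zero]
    rw [hψ.apply_zero]
  have hinj : Function.Injective fun s => f (0, s) := fun s s' h => by
    have h1 : f (0, s) = f (0, s') := h
    rw [hf0, hf0, ← hψ.apply_zero, ← hψ.apply_zero] at h1
    exact congrArg Prod.snd (ψ.injOn (hψ.zero_mem_source s) (hψ.zero_mem_source s')
      (hι.isEmbedding.injective h1))
  have hf := hψ.isEllipticDisk hι hh
  -- `S` is Hausdorff because it maps continuously and injectively to `M`.
  have : T2Space S := by
    refine T2Space.of_injective_continuous hinj (continuous_iff_continuousAt.2 fun s => ?_)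
    exact ContinuousAt.comp (g := f) (hf.smooth s).self_of_nhds.continuousAt
      (continuous_const.prodMk continuous_id).continuousAt
  obtain ⟨Φ, h1, h2, h3, h4, h5⟩ := hf.exists_standard_neighborhood (hα.smul hsm hpos) hinj
    (by simp)
  let N : Set (EuclideanSpace ℝ (Fin 2) × S) :=
    interior {n | f n ∈ Φ.source ∧ Φ (f n) = modelIncl n}
  -- The map `u` undoes the twist, so that `f ∘ u = ι ∘ ψ`.
  let u : EuclideanSpace ℝ (Fin 2) × S → EuclideanSpace ℝ (Fin 2) × S :=
    fun a => ((2 : ℝ) • twist (centerSign g a.2) a.1, a.2)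
  have hu : Continuous u := ((continuous_twist (hψ.continuous_centerSign.comp continuous_snd)
    continuous_fst).const_smul (2 : ℝ)).prodMk continuous_snd
  have hfu : ∀ a, f (u a) = ι (ψ a) := fun a => by
    simp only [f, u, twist_two_smul_twist (hψ.centerSign_mul_self a.2)]
  -- Restricting `Φ` to `O` leaves only points of `F` that lie in the elliptic chart and at which `Φ
  -- ∘ f` is known to be the model inclusion.
  obtain ⟨O, hO, hOB⟩ := exists_isOpen_preimage_eq_image hι
    (ψ.open_source.inter (isOpen_interior.preimage hu : IsOpen (u ⁻¹' N))) inter_subset_left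
  have h0 : ∀ s, f (0, s) ∈ Φ.source ∧ Φ (f (0, s)) = modelIncl (0, s) :=
    fun s => (h5 s).self_of_nhds
  refine ⟨Φ.restrOpen O hO, ?_, ?_, ?_, ?_, ?_, ?_, ?_, ?_, ?_⟩
  · intro s
    refine ⟨hf0 s ▸ (h0 s).1, (hOB _).2 ⟨(0, s), ⟨hψ.zero_mem_source s, ?_⟩, hψ.apply_zero s⟩⟩
    have h6 : u (0, s) = (0, s) := by
      simp only [u, map_zero, smul_zero]
    rw [mem_preimage, h6]
    exact mem_interior_iff_mem_nhds.2 (h5 s)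
  · exact fun m hm => h1 hm.1
  · exact h2.mono fun p hp => hp.1
  · exact h3.mono fun m hm => hm.1
  · intro s
    have h6 := (h0 s).2
    rw [hf0] at h6
    exact h6.trans (modelIncl_zero s)
  · exact fun p hp => (hsm.contMDiffAt.inv₀ (hpos p).ne').contMDiffWithinAt
  · exact fun p hp => inv_pos.2 (hpos p)
  · intro p hp v
    have h6 := h4 p hp.1 v
    have h7 : h p * α p v = modelForm (k := k) S (Φ p)
      (mfderiv (𝓡 (2 * k + 3)) (modelI k) Φ p v) := h6
    refine Eq.trans ?_ (congrArg ((h p)⁻¹ * ·) h7)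
    rw [inv_mul_cancel_left₀ (hpos p).ne']
  · intro q hq
    obtain ⟨a, ha, rfl⟩ := (hOB q).1 hq.2
    have h6 : Φ (f (u a)) = modelIncl (u a) := (interior_subset ha.2).2
    rw [hfu] at h6
    have h7 : ∀ m : Model (k := k) S, m = modelIncl (u a) → m.1 2 = 0 ∧ m.2.2 = 0 := by
      rintro _ rfl
      exact ⟨by simp [modelIncl], rfl⟩
    exact h7 _ h6

end EllipticChart

end ContactGeometry

end

theorem mainTheorem8 (k : ℕ)
    {M : Type*} [TopologicalSpace M] [T2Space M] [SecondCountableTopology M]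
    [ChartedSpace (EuclideanSpace ℝ (Fin (2 * k + 3))) M] [IsManifold (𝓡 (2 * k + 3)) ∞ M]
    {HF : Type*} [TopologicalSpace HF]
    (IF : ModelWithCorners ℝ (EuclideanSpace ℝ (Fin (k + 2))) HF)
    {F : Type*} [TopologicalSpace F] [ChartedSpace HF F] [IsManifold IF ∞ F]
    {S : Type*} [TopologicalSpace S] [ChartedSpace (EuclideanSpace ℝ (Fin k)) S]
    [IsManifold (𝓡 k) ∞ S] [Nonempty S]
    (α : ContactGeometry.OneForm (𝓡 (2 * k + 3)) M) (hα : ContactGeometry.IsContactForm α)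
    (ι : F → M) (hι : ContactGeometry.IsMaximallyFoliated IF α ι)
    (j : S → F) (hj : ContactGeometry.IsEllipticSingularSet IF α ι j) :
    (∃ (Φ : OpenPartialHomeomorph M (ContactGeometry.Model (k := k) S)) (h : M → ℝ),
      ContactGeometry.IsStandardNeighborhood α ι j Φ h) ∧
    (ContactGeometry.IsStrictEllipticSingularSet IF α ι j →
      ∃ Φ : OpenPartialHomeomorph M (ContactGeometry.Model (k := k) S),
        ContactGeometry.IsStandardNeighborhood α ι j Φ (fun _ => 1)) := by
  obtain ⟨_, -, r, ψ, g, hψ⟩ := hj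
  constructor
  · obtain ⟨h, h1, h2, h3⟩ := hψ.exists_conformal_factor hι.embedding
    obtain ⟨Φ, hΦ⟩ := hψ.exists_isStandardNeighborhood hα hι.embedding h1 h2 h3
    exact ⟨Φ, _, hΦ⟩
  · rintro ⟨-, -, r', ψ', hψ'⟩
    -- With `g = 1` the factor `h = 1` already satisfies `h |g| = 1`, and no conformal change is
    -- made.
    obtain ⟨Φ, hΦ⟩ := hψ'.exists_isStandardNeighborhood hα hι.embedding (h := fun _ => 1)
      contMDiff_const (fun _ => one_pos) (fun s => Filter.Eventually.of_forall fun a => by simp)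
    exact ⟨Φ, by simpa only [inv_one] using hΦ⟩
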